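/- Let $n\ge 0$ and $[n]=\{1,\dots,n\}$. Let $M_n$ be the poset of all minors (square submatrices) of an $n\times n$ matrix: its elements are the pairs $(A,B)$ with $A,B\subseteq[n]$ and $|A|=|B|$ (the sets of rows and of columns), ordered by $(A,B)\le(A',B')$ iff $A\subseteq A'$ and $B\subseteq B'$; put $\hat 0=(\emptyset,\emptyset)$ and $\hat 1=([n],[n])$. Let $B_n$ be the Boolean lattice of all subsets of $[n]$. For a finite poset $P$, $\Delta(P)$ is the simplicial complex of its chains, $\mathrm{rk}(p)$ is the length of a longest chain with top element $p$, and $\widehat P$ is $P$ with a new bottom and a new top element added. $P$ is pure if all its maximal chains have the same length. $P$ is Cohen–Macaulay over a field $k$ if it is pure and, for all $x<y$ in $\widehat P$, the reduced homology $\widetilde H_i(\Delta((x,y));k)$ of the open interval vanishes for all $i\ne \mathrm{rk}(y)-\mathrm{rk}(x)-2$. It is homotopically Cohen–Macaulay if it is pure and, for all $x<y$ in $\widehat P$, $\Delta((x,y))$ is homotopy equivalent to a wedge of spheres of dimension $\mathrm{rk}(y)-\mathrm{rk}(x)-2$. (The sphere of dimension $-1$ is the empty space, which counts as the wedge of exactly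 one such sphere; a wedge of no spheres of dimension $\ge 0$ is a point.) Two permutations $\sigma,\tau$ of $[n]$ have no common ascent if there is no $i\in[n-1]$ with $\sigma(i)<\sigma(i+1)$ and $\tau(i)<\tau(i+1)$. Let $N_n$ be the number of pairs $(\sigma,\tau)$ of permutations of $[n]$ with no common ascent. Then: 1. $M_n$ is isomorphic, by the identity on pairs $(A,B)$, to the Segre square $B_n\circ_{\mathrm{rk}}B_n=\{(A,B)\in B_n\times B_n : \mathrm{rk}(A)=\mathrm{rk}(B)\}$. 2. $M_n$ is Cohen–Macaulay over every field $k$, and homotopically Cohen–Macaulay. 3. The Möbius function $\mu$ of $M_n$ satisfies $(-1)^n\mu(\hat0,\hat1)=N_n$. For $n\ge1$, $\Delta(M_n\setminus\{\hat0,\hat1\})$ is homotopy equivalent to a wedge of $N_n$ spheres of dimension $n-2$. 4. Label each covering $(A_1,B_1)\lessdot(A_2,B_2)$ of $M_n$ by $(a,b)\in[n]\times[n]$, where $A_2\setminus A_1=\{a\}$ and $B_2\setminus B_1=\{b\}$; such $a,b$ exist. With the product order on $[n]\times[n]$ this is an EL-labeling: each interval $[x,y]$ has exactly one maximal chain whose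 labels satisfy $\lambda_1\le\lambda_2\le\cdots$, and the label word of this chain lexicographically precedes the label word of every other maximal chain of $[x,y]$ (in the first place where they differ, its label is smaller). The falling maximal chains of $M_n$, those for which there is no $i$ with $\lambda_i\le\lambda_{i+1}$, correspond bijectively through their label words to the words $(\sigma(1),\tau(1))\cdots(\sigma(n),\tau(n))$ with $\sigma,\tau$ permutations of $[n]$ with no common ascent. 5. $(-1)^n\mu(\hat0,\hat1)=\sum_{J\subseteq[n-1]}\alpha_J\beta_J$, where $\alpha_J$ is the number of maximal chains of the subposet $\{A\in B_n : |A|\in J\}$ of $B_n$ and $\beta_J=\sum_{I\subseteq J}(-1)^{|J\setminus I|}\alpha_I$. -/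

import Mathlib

open scoped ContinuousMap

noncomputable section

/-! ### Pure posets, Segre products, minors -/

/-- A poset is pure if all its maximal chains have the same length. -/
def IsPurePoset (P : Type*) [PartialOrder P] : Prop :=
  ∀ s t : Set P, IsMaxChain (· ≤ ·) s → IsMaxChain (· ≤ ·) t → s.encard = t.encard

/-- The Segre product `P ∘_{f,g} Q`, an induced subposet of the product poset `P × Q`. -/
abbrev SegreProduct {P Q S : Type*} (f : P → S) (g : Q → S) : Type _ :=
  {x : P × Q // f x.1 = g x.2}

/-- The unweighted Segre product `P ∘_rk Q`: the rank of an element `p` is the length of a longest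
chain with top element `p`, i.e. `Order.height p`. -/
abbrev RankSegreProduct (P Q : Type*) [PartialOrder P] [PartialOrder Q] : Type _ :=
  SegreProduct (Order.height : P → ℕ∞) (Order.height : Q → ℕ∞)

/-- The poset `M_n` of minors of an `n × n` matrix: a square submatrix is given by its set of rows
and its set of columns, which have the same size; submatrices are ordered by containment. -/
abbrev Minor (n : ℕ) : Type :=
  {m : Finset (Fin n) × Finset (Fin n) // m.1.card = m.2.card}

instance Minor.instBoundedOrder (n : ℕ) : BoundedOrder (Minor n) where
  top := ⟨(Finset.univ, Finset.univ), rfl⟩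
  le_top _ := ⟨Finset.subset_univ _, Finset.subset_univ _⟩
  bot := ⟨(∅, ∅), rfl⟩
  bot_le _ := ⟨Finset.empty_subset _, Finset.empty_subset _⟩

/-- The augmented poset `P̂`, with a new bottom and a new top element. -/
abbrev Augmented (P : Type*) : Type _ := WithBot (WithTop P)

/-! ### Reduced homology of the order complex, Cohen–Macaulay posets -/

/-- The chains `p₀ < ⋯ < p_{m-1}` with `m` elements of the poset `P`, i.e. the faces of dimension
`m - 1` of the order complex `Δ(P)`; the empty face is the only one for `m = 0`. -/
abbrev OrderedChain (P : Type*) [PartialOrder P] (m : ℕ) : Type _ :=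
  {c : Fin m → P // StrictMono c}

/-- Omit the element with index `j` from a chain. -/
def OrderedChain.face {P : Type*} [PartialOrder P] {m : ℕ} (c : OrderedChain P (m + 1))
    (j : Fin (m + 1)) : OrderedChain P m :=
  ⟨c.1 ∘ j.succAbove, c.2.comp (Fin.strictMono_succAbove j)⟩

/-- The boundary map `∂(p₀ < ⋯ < p_m) = ∑ j, (-1)^j (p₀ < ⋯ < p̂_j < ⋯ < p_m)` of the augmented
simplicial chain complex of `Δ(P)` over `k`, from dimension `m` to dimension `m - 1`. -/
def orderBoundary (k : Type*) [Field k] (P : Type*) [PartialOrder P] (m : ℕ) :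
    (OrderedChain P (m + 1) →₀ k) →ₗ[k] (OrderedChain P m →₀ k) :=
  Finsupp.linearCombination k fun c =>
    ∑ j : Fin (m + 1), Finsupp.single (c.face j) ((-1 : k) ^ (j : ℕ))

theorem orderBoundary_comp_orderBoundary (k : Type*) [Field k] (P : Type*) [PartialOrder P]
    (m : ℕ) : orderBoundary k P m ∘ₗ orderBoundary k P (m + 1) = 0 := by
  ext1 c
  ext1
  simp only [orderBoundary, LinearMap.comp_apply, Finsupp.lsingle_apply,
    Finsupp.linearCombination_single, one_smul, map_sum, LinearMap.zero_apply, Finset.smul_sum,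
    Finsupp.smul_single, smul_eq_mul]
  rw [← Fintype.sum_prod_type']
  refine Finset.sum_involution (fun x _ => (x.1.succAbove x.2, x.2.predAbove x.1)) ?_ ?_ ?_ ?_
  · rintro ⟨i, j⟩ -
    have h : (c.face (i.succAbove j)).face (j.predAbove i) = (c.face i).face j := by
      apply Subtype.ext
      funext l
      simp only [OrderedChain.face, Function.comp_apply]
      rw [Fin.succAbove_succAbove_succAbove_predAbove]
    simp only [h, ← Finsupp.single_add, ← pow_add, Fin.neg_one_pow_succAbove_add_predAbove]
    simp
  · rintro ⟨i, j⟩ - - h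
    exact Fin.succAbove_ne i j (congrArg Prod.fst h)
  · simp
  · rintro ⟨i, j⟩ -
    simp [Fin.succAbove_succAbove_predAbove, Fin.predAbove_predAbove_succAbove]

/-- The cycles of dimension `m - 1`; in dimension `-1` every chain is a cycle. -/
def reducedCycles (k : Type*) [Field k] (P : Type*) [PartialOrder P] :
    (m : ℕ) → Submodule k (OrderedChain P m →₀ k)
  | 0 => ⊤
  | m + 1 => LinearMap.ker (orderBoundary k P m)

/-- The reduced simplicial homology group `H̃_{m-1}(P; k)` of `Δ(P)`: cycles modulo boundaries, as a
subspace of the chains modulo the boundaries. -/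
abbrev ReducedHomology (k : Type*) [Field k] (P : Type*) [PartialOrder P] (m : ℕ) :
    Submodule k ((OrderedChain P m →₀ k) ⧸ LinearMap.range (orderBoundary k P m)) :=
  (reducedCycles k P m).map (LinearMap.range (orderBoundary k P m)).mkQ

/-- `P` is Cohen–Macaulay over `k`: it is pure, and for all `x < y` in `P̂` the group
`H̃_i((x, y); k)` vanishes for all `i ≠ rk y - rk x - 2`. Here `i = m - 1`; the groups with
`i < -1` are zero anyway. -/
def IsCohenMacaulayPoset (k : Type*) [Field k] (P : Type*) [PartialOrder P] : Prop :=
  IsPurePoset P ∧ ∀ x y : Augmented P, x < y → ∀ m : ℕ,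
    Order.height x + m + 1 ≠ Order.height y → Subsingleton (ReducedHomology k (Set.Ioo x y) m)

/-! ### Geometric realization, wedges of spheres, homotopically Cohen–Macaulay posets -/

/-- The geometric realization of the order complex `Δ(P)` of a finite poset `P`, in barycentric
coordinates. -/
abbrev OrderRealization (P : Type*) [PartialOrder P] [Finite P] : Type _ :=
  {w : P → ℝ // (∀ p, 0 ≤ w p) ∧ ∑ᶠ p, w p = 1 ∧ IsChain (· ≤ ·) (Function.support w)}

/-- The unit sphere of dimension `d`. -/
abbrev UnitSphere (d : ℕ) : Type := Metric.sphere (0 : EuclideanSpace ℝ (Fin (d + 1))) 1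

/-- The base point `(1, 0, …, 0)` of the unit sphere. -/
def UnitSphere.base (d : ℕ) : UnitSphere d := ⟨EuclideanSpace.single 0 1, by simp⟩

/-- The wedge of `r` copies of a space `X` with base point `x₀`: the disjoint union of a point and
of the `r` copies, with the point and all the base points identified. -/
abbrev Wedge (r : ℕ) (X : Type*) [TopologicalSpace X] (x₀ : X) : Type _ :=
  Quot fun a b : Unit ⊕ (Σ _ : Fin r, X) => ∃ j : Fin r, a = Sum.inl () ∧ b = Sum.inr ⟨j, x₀⟩

/-- `X` is homotopy equivalent to a wedge of `r` spheres of dimension `m - 1`. The sphere of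
dimension `-1` is the empty space; it has no base point and is only counted as the wedge of one
sphere of dimension `-1`. The wedge of no spheres of dimension at least `0` is a point. -/
def IsHomotopyWedgeOfSpheres (X : Type*) [TopologicalSpace X] : (m r : ℕ) → Prop
  | 0, r => IsEmpty X ∧ r = 1
  | d + 1, r => Nonempty (X ≃ₕ Wedge r (UnitSphere d) (UnitSphere.base d))

/-- `P` is homotopically Cohen–Macaulay: it is pure, and for all `x < y` in `P̂` the interval
`(x, y)` is homotopy equivalent to a wedge of spheres of dimension `m - 1 = rk y - rk x - 2`. -/
def IsHomotopicallyCohenMacaulayPoset (P : Type*) [PartialOrder P] [Finite P] : Prop :=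
  IsPurePoset P ∧ ∀ x y : Augmented P, x < y → ∃ m r : ℕ,
    Order.height x + m + 1 = Order.height y ∧
      IsHomotopyWedgeOfSpheres (OrderRealization (Set.Ioo x y)) m r

/-! ### EL-labelings -/

/-- A labeling of the covering relations of `P` by elements of `L`. -/
abbrev EdgeLabeling (P L : Type*) [PartialOrder P] : Type _ := ∀ x y : P, x ⋖ y → L

/-- The maximal (unrefinable) chains `x = x₀ ⋖ x₁ ⋖ ⋯ ⋖ x_l = y` of the interval `[x, y]`. -/
abbrev MaxChainBetween {P : Type*} [PartialOrder P] (x y : P) : Type _ :=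
  {c : RelSeries {p : P × P | p.1 ⋖ p.2} // c.head = x ∧ c.last = y}

section Labels

variable {P L : Type*} [PartialOrder P] [PartialOrder L] (lab : EdgeLabeling P L)

/-- The word of labels read along a maximal chain of an interval from bottom to top. -/
def labelWord {x y : P} (c : MaxChainBetween x y) : List L :=
  List.ofFn fun i : Fin c.1.length => lab (c.1 i.castSucc) (c.1 i.succ) (c.1.step i)

/-- A chain is rising if its labels increase weakly. -/
def IsRisingChain {x y : P} (c : MaxChainBetween x y) : Prop :=
  (labelWord lab c).IsChain (· ≤ ·)

/-- A chain is falling if it has no ascent, i.e. no two consecutive labels `a ≤ b`. -/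
def IsFallingChain {x y : P} (c : MaxChainBetween x y) : Prop :=
  (labelWord lab c).IsChain fun a b => ¬ a ≤ b

/-- An EL-labeling with labels in a poset: each interval has a unique rising maximal chain, and its
label word lexicographically precedes those of all other maximal chains of the interval. -/
def IsELLabeling : Prop :=
  ∀ x y : P, x ≤ y → ∃ c : MaxChainBetween x y, IsRisingChain lab c ∧
    ∀ c' : MaxChainBetween x y, c' ≠ c →
      ¬ IsRisingChain lab c' ∧ List.Lex (· < ·) (labelWord lab c) (labelWord lab c')

end Labels

/-! ### Permutations without common ascent, rank-selected invariants -/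

/-- The permutations `σ`, `τ` of `[n]` have no common ascent: there is no position `i` with
`σ i < σ (i + 1)` and `τ i < τ (i + 1)`. -/
def NoCommonAscent {n : ℕ} (σ τ : Equiv.Perm (Fin n)) : Prop :=
  ∀ i j : Fin n, (j : ℕ) = i + 1 → ¬ (σ i < σ j ∧ τ i < τ j)

/-- The rank-selected subposet `P_J`. -/
abbrev RankSelected (P : Type*) [PartialOrder P] (J : Finset ℕ) : Type _ :=
  {p : P // ∃ j ∈ J, Order.height p = j}

/-- The invariant `α_J` of `P`: the number of maximal chains of `P_J`. -/
def rankAlpha (P : Type*) [PartialOrder P] (J : Finset ℕ) : ℕ :=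
  {s : Set (RankSelected P J) | IsMaxChain (· ≤ ·) s}.ncard

/-- The invariant `β_J = ∑_{I ⊆ J} (-1)^{|J \ I|} α_I` of `P`. -/
def rankBeta (P : Type*) [PartialOrder P] (J : Finset ℕ) : ℤ :=
  ∑ I ∈ J.powerset, (-1) ^ (J \ I).card * (rankAlpha P I : ℤ)

end

/-!
The proof rests on a partition of the order complex of the proper part of the poset of minors into
Boolean intervals, indexed by pairs of permutations.

A pair `(σ, τ)` of permutations of `[n]` defines the maximal chain of the minors on the first `i`
values of `σ` and of `τ`. Conversely, any chain of minors gives a chain of row sets and a chain of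
column sets, and each of these is refined by a permutation in the most increasing way (`sortPerm`).
The chains sorted into `(σ, τ)` in this manner are those between the set of the members of the maximal
chain at which `(σ, τ)` has no common ascent and the whole maximal chain (`Minor.sortPerm_eq_iff`).
Passing to a subchain can only remove inversions, so the number of inversions orders the intervals as
a shelling would. The resulting structure (`Minor.properPartition`, an instance of `FacetPartition`)
has an interval with a single element exactly for the pairs without common ascent.

Three consequences are drawn from such a partition in general.

* Homotopy type. Remove the facets whose interval is a single element. In what remains, each interval
  can be collapsed, the one of the largest rank first, until a cone is left
  (`FacetPartition.contractibleSpace_core`). A contractible complex to which `r` facets of dimension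
  `d` are attached along their boundaries is homotopy equivalent to the wedge of `r` spheres obtained
  by collapsing it: in barycentric coordinates there is an explicit deformation of a neighborhood, and
  each facet is mapped to a sphere by inverse stereographic projection
  (`nonempty_homotopyEquiv_wedge`).
* Homology. In the same order, a cycle can be moved off every interval by adding boundaries of cones
  (`exists_homologous_cycle`), which leaves nothing below the dimension of the facets.
* Euler characteristic. Intervals with more than one element cancel in the alternating sum over all
  chains, which by Philip Hall's theorem is the Möbius number (`mu_eq_sum_chainsBetween`).

An open interval of the poset of minors is the proper part of a smaller poset of minors, and the other
intervals of the augmented poset are cones or empty; this gives the Cohen–Macaulay properties.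

For the rank-selected invariants, maximal chains of the subposet of the Boolean lattice with ranks in
`J` correspond, again through `sortPerm`, to the permutations with descent set contained in `J`. Hence
`β_J` counts those with descent set `J`, and reversing the values of `τ` shows that the sum of the
products `α_J β_J` counts the pairs without common ascent.

For the labeling, the label words of the maximal chains of an interval are exactly the words that
contain each new row and each new column once. A word is rising exactly if both of its coordinates are sorted,
which determines it, and it is then lexicographically first; for the whole poset the words are pairs of
permutations, and falling means having no common ascent.
-/

section

open scoped unitInterval

/-! ### Deformation retracts and quotients by contractible subspaces -/

/-- If a deformation `E` of `X`, fixed on the contractible subspace `A`, has moved each point `x` into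
`A` from the time `2 * T x` on, then `A` can be contracted to a point inside `A` by a homotopy of the
whole space: the points close to `A` first follow `E` into `A`, then the contraction. -/
theorem exists_homotopy_contracting_subspace {X : Type*} [TopologicalSpace X] (A : Set X)
    [ContractibleSpace A] (E : X × I → X) (hE : Continuous E) (T : X → ℝ) (hT : Continuous T)
    (hE0 : ∀ x, E (x, 0) = x) (hEA : ∀ x ∈ A, ∀ s, E (x, s) = x) (hTA : ∀ x ∈ A, T x = 0)
    (hmem : ∀ x (s : I), 2 * T x ≤ s → E (x, s) ∈ A) (hT0 : ∀ x, 0 ≤ T x) :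
    ∃ H : C(X × I, X), (∀ x, H (x, 0) = x) ∧ (∀ x ∈ A, ∀ s, H (x, s) ∈ A) ∧
      ∃ a ∈ A, ∀ x ∈ A, H (x, 1) = a := by
  obtain ⟨a, ⟨F⟩⟩ := id_nullhomotopic A
  classical
  -- at the time `s ≥ 2 * T x` the contraction of `A` has been running for the time `s - 2 * T x`
  let Hf : X × I → X := fun z =>
    if h : 2 * T z.1 ≤ z.2 then
      (F (Set.projIcc (0 : ℝ) 1 zero_le_one (z.2 - 2 * T z.1), ⟨E z, hmem z.1 z.2 h⟩) : A)
    else E z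
  have hcont : Continuous Hf := by
    have hC1 : IsClosed {z : X × I | (z.2 : ℝ) ≤ 2 * T z.1} :=
      isClosed_le (by fun_prop) (by fun_prop)
    have hC2 : IsClosed {z : X × I | 2 * T z.1 ≤ (z.2 : ℝ)} :=
      isClosed_le (by fun_prop) (by fun_prop)
    rw [← continuousOn_univ]
    have hu : (Set.univ : Set (X × I)) =
        {z : X × I | (z.2 : ℝ) ≤ 2 * T z.1} ∪ {z : X × I | 2 * T z.1 ≤ (z.2 : ℝ)} := by
      ext z; simp [le_total]
    rw [hu]
    refine ContinuousOn.union_of_isClosed ?_ ?_ hC1 hC2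
    · refine hE.continuousOn.congr ?_
      rintro z (hz : (z.2 : ℝ) ≤ 2 * T z.1)
      simp only [Hf]
      split_ifs with h
      · have : (z.2 : ℝ) - 2 * T z.1 = 0 := by linarith
        rw [this, Set.projIcc_left]
        have := F.apply_zero ⟨E z, hmem z.1 z.2 h⟩
        exact congrArg Subtype.val this
      · rfl
    · rw [continuousOn_iff_continuous_domRestrict]
      have : Set.domRestrict {z : X × I | 2 * T z.1 ≤ (z.2 : ℝ)} Hf = fun z =>
          ((F (Set.projIcc (0 : ℝ) 1 zero_le_one (z.1.2 - 2 * T z.1.1),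
            ⟨E z.1, hmem z.1.1 z.1.2 z.2⟩) : A) : X) := by
        funext z
        exact dif_pos z.2
      rw [this]
      refine continuous_subtype_val.comp (F.continuous.comp (Continuous.prodMk ?_ ?_))
      · exact continuous_projIcc.comp (by fun_prop)
      · exact (hE.comp continuous_subtype_val).subtype_mk _
  refine ⟨⟨Hf, hcont⟩, ?_, ?_, a, a.2, ?_⟩
  · intro x
    change Hf (x, 0) = x
    simp only [Hf]
    split_ifs with h
    · have h0 : T x = 0 := by
        have := hT0 x
        have h' : 2 * T x ≤ 0 := by simpa using h
        linarith
      have h1 : (((0 : I) : ℝ) - 2 * T x) = 0 := by simp [h0]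
      rw [h1, Set.projIcc_left]
      have := F.apply_zero ⟨E (x, 0), hmem x 0 h⟩
      exact (congrArg Subtype.val this).trans (hE0 x)
    · exact hE0 x
  · intro x hx s
    change Hf (x, s) ∈ A
    simp only [Hf]
    split_ifs with h
    · exact Subtype.coe_prop _
    · rw [hEA x hx]; exact hx
  · intro x hx
    change Hf (x, 1) = a
    have h : 2 * T x ≤ ((1 : I) : ℝ) := by rw [hTA x hx]; simp
    simp only [Hf]
    rw [dif_pos h]
    have h1 : (((1 : I) : ℝ) - 2 * T x) = 1 := by simp [hTA x hx]
    rw [h1, Set.projIcc_right]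
    exact congrArg Subtype.val (F.apply_one _)

/-- Collapsing a subspace `A` to a point is a homotopy equivalence if a homotopy of the space contracts
`A` within itself: the end of the homotopy factors through the quotient. -/
theorem nonempty_homotopyEquiv_of_isQuotientMap {X W : Type*} [TopologicalSpace X]
    [TopologicalSpace W] (q : C(X, W)) (hq : Topology.IsQuotientMap q) (A : Set X)
    (hfib : ∀ x y, q x = q y → x = y ∨ (x ∈ A ∧ y ∈ A)) (hA : ∀ x ∈ A, ∀ y ∈ A, q x = q y)
    (H : C(X × I, X)) (hH0 : ∀ x, H (x, 0) = x) (hHA : ∀ x ∈ A, ∀ s, H (x, s) ∈ A)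
    (a : X) (hH1 : ∀ x ∈ A, H (x, 1) = a) : Nonempty (X ≃ₕ W) := by
  let H1 : C(X, X) := ⟨fun x => H (x, 1), by fun_prop⟩
  have hfac : ∀ x y, q x = q y → H1 x = H1 y := by
    intro x y hxy
    rcases hfib x y hxy with rfl | ⟨hx, hy⟩
    · rfl
    · exact (hH1 x hx).trans (hH1 y hy).symm
  let g : C(W, X) := hq.lift H1 hfac
  have hg : ∀ x, g (q x) = H (x, 1) := fun x =>
    congrArg (fun f : C(X, X) => f x) (hq.lift_comp H1 hfac)
  have hinv := Function.surjInv_eq hq.surjective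
  have hqH : ∀ x y s, q x = q y → q (H (x, s)) = q (H (y, s)) := by
    intro x y s hxy
    rcases hfib x y hxy with rfl | ⟨hx, hy⟩
    · rfl
    · exact hA _ (hHA x hx s) _ (hHA y hy s)
  let G : W × I → W := fun z => q (H (Function.surjInv hq.surjective z.1, z.2))
  have hGq : ∀ x s, G (q x, s) = q (H (x, s)) := fun x s => hqH _ _ s (hinv (q x))
  have hG : Continuous G := by
    refine hq.continuous_lift_prod_left ?_
    have : (fun p : X × I => G (q p.1, p.2)) = fun p => q (H p) := by
      funext p; exact hGq p.1 p.2
    rw [this]; fun_prop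
  refine ⟨⟨q, g, ?_, ?_⟩⟩
  · refine ContinuousMap.Homotopic.symm ⟨⟨⟨fun p => H (p.2, p.1), by fun_prop⟩, ?_, ?_⟩⟩
    · intro x; exact hH0 x
    · intro x; exact (hg x).symm
  · refine ContinuousMap.Homotopic.symm ⟨⟨⟨fun p => G (p.2, p.1), by fun_prop⟩, ?_, ?_⟩⟩
    · intro w
      obtain ⟨x, rfl⟩ := hq.surjective w
      change G (q x, 0) = q x
      rw [hGq, hH0]
    · intro w
      obtain ⟨x, rfl⟩ := hq.surjective w
      change G (q x, 1) = q (g (q x))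
      rw [hGq, hg]

/-! ### Realizations of simplicial complexes in barycentric coordinates -/

section Realization

variable {V : Type*} [Fintype V]

open Classical in
/-- The vertices with nonzero weight. -/
noncomputable def weightSupport (w : V → ℝ) : Finset V := Finset.univ.filter fun p => w p ≠ 0

@[simp]
theorem mem_weightSupport {w : V → ℝ} {p : V} : p ∈ weightSupport w ↔ w p ≠ 0 := by
  simp [weightSupport]

/-- The points of the geometric realization, in barycentric coordinates, of the family `K` of
simplices. -/
def simplicialRealization (K : Set (Finset V)) : Set (V → ℝ) :=
  {w | (∀ p, 0 ≤ w p) ∧ ∑ p, w p = 1 ∧ weightSupport w ∈ K}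

/-- A cone with apex `u` is star convex around the vertex `u`. -/
theorem contractibleSpace_simplicialRealization_of_cone [DecidableEq V] {K : Set (Finset V)}
    (hK : IsLowerSet K) (hne : K.Nonempty) (u : V) (hu : ∀ s ∈ K, insert u s ∈ K) :
    ContractibleSpace (simplicialRealization K) := by
  obtain ⟨s, hs⟩ := hne
  have hstar : StarConvex ℝ (Pi.single u 1) (simplicialRealization K) := by
    rintro w ⟨hw0, hw1, hwK⟩ a b ha hb hab
    refine ⟨fun p => ?_, ?_, ?_⟩
    · have : (0 : ℝ) ≤ (Pi.single u 1 : V → ℝ) p := by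
        by_cases h : p = u <;> simp [h]
      have := hw0 p
      simp only [Pi.add_apply, Pi.smul_apply, smul_eq_mul]
      positivity
    · simp [Finset.sum_add_distrib, ← Finset.mul_sum, hw1, hab]
    · refine hK ?_ (hu _ hwK)
      intro p hp
      by_contra h
      simp only [Finset.mem_insert, mem_weightSupport, not_or, not_not] at h
      simp [h.1, h.2] at hp
  refine hstar.contractibleSpace ⟨Pi.single u 1, fun p => ?_, by simp, ?_⟩
  · by_cases h : p = u <;> simp [h]
  · refine hK ?_ (hu s hs)
    intro p hp
    by_contra h
    simp only [Finset.mem_insert, not_or] at h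
    simp [h.1] at hp

/-- Elementary collapse: if the link of the simplex `R` in `K` is a cone with apex `u`, the weight on
`R` may be pushed towards `u` until some vertex of `R` has weight zero. -/
theorem nonempty_homotopyEquiv_collapse [DecidableEq V] {K : Set (Finset V)}
    (hK : IsLowerSet K) (R : Finset V) (hR : R.Nonempty) (u : V) (huR : u ∉ R)
    (hu : ∀ s ∈ K, R ⊆ s → insert u s ∈ K) :
    Nonempty (simplicialRealization K ≃ₕ simplicialRealization {s ∈ K | ¬ R ⊆ s}) := by
  -- the smallest weight on `R`; `push w s` moves `s * t w` from each vertex of `R` to `u`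
  let t : (V → ℝ) → ℝ := fun w => R.inf' hR w
  have htc : Continuous t := Continuous.finset_inf'_apply hR fun i _ => continuous_apply i
  let push : (V → ℝ) → ℝ → V → ℝ := fun w s p =>
    w p - (if p ∈ R then s * t w else 0) + (if p = u then s * t w * R.card else 0)
  have hpc : Continuous fun z : (V → ℝ) × ℝ => push z.1 z.2 := by
    refine continuous_pi fun p => ?_
    simp only [push]
    split_ifs <;> fun_prop
  have ht0 : ∀ w ∈ simplicialRealization K, 0 ≤ t w := by
    intro w hw
    exact Finset.le_inf' _ _ fun i _ => hw.1 i
  have htle : ∀ w, ∀ i ∈ R, t w ≤ w i := fun w i hi => Finset.inf'_le _ hi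
  have htz : ∀ w, (∀ p, 0 ≤ w p) → ¬ R ⊆ weightSupport w → t w ≤ 0 := by
    intro w _ h
    obtain ⟨i, hi, hi'⟩ := Finset.not_subset.1 h
    simp only [mem_weightSupport, not_not] at hi'
    exact (htle w i hi).trans hi'.le
  have hpz : ∀ w s, t w = 0 → push w s = w := by
    intro w s h
    funext p
    simp [push, h]
  have hpmem : ∀ w ∈ simplicialRealization K, ∀ s : ℝ, 0 ≤ s → s ≤ 1 →
      push w s ∈ simplicialRealization K := by
    intro w hw s hs0 hs1
    have htw := ht0 w hw
    rcases htw.eq_or_lt with h0 | hpos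
    · rw [hpz w s h0.symm]; exact hw
    refine ⟨fun p => ?_, ?_, ?_⟩
    · have h2 : 0 ≤ (if p = u then s * t w * R.card else 0) := by split_ifs <;> positivity
      have h1 : 0 ≤ w p - (if p ∈ R then s * t w else 0) := by
        split_ifs with hp
        · have := htle w p hp
          nlinarith
        · simpa using hw.1 p
      exact add_nonneg h1 h2
    · simp only [push, Finset.sum_add_distrib, Finset.sum_sub_distrib, hw.2.1]
      rw [Finset.sum_ite_mem]
      simp
      ring
    · refine hK ?_ (hu _ hw.2.2 ?_)
      · intro p hp
        by_contra h
        simp only [Finset.mem_insert, mem_weightSupport, not_or, not_not] at h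
        have hpR : p ∉ R := fun hp' => absurd (htle w p hp') (by rw [h.2]; exact not_le.2 hpos)
        simp [push, h.1, h.2, hpR] at hp
      · intro p hp
        rw [mem_weightSupport]
        exact (hpos.trans_le (htle w p hp)).ne'
  have hp1 : ∀ w ∈ simplicialRealization K,
      push w 1 ∈ simplicialRealization {s ∈ K | ¬ R ⊆ s} := by
    intro w hw
    have h := hpmem w hw 1 zero_le_one le_rfl
    refine ⟨h.1, h.2.1, h.2.2, fun hsub => ?_⟩
    obtain ⟨i, hi, hti⟩ := Finset.exists_mem_eq_inf' hR w
    have := hsub hi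
    have hiu : i ≠ u := fun h => huR (h ▸ hi)
    rw [mem_weightSupport] at this
    apply this
    simp only [push, hi, hiu, if_true, if_false]
    change w i - 1 * R.inf' hR w + 0 = 0
    rw [hti]; ring
  let r : C(simplicialRealization K, simplicialRealization {s ∈ K | ¬ R ⊆ s}) :=
    ⟨fun w => ⟨push w 1, hp1 w w.2⟩,
      (hpc.comp (by fun_prop : Continuous fun w : simplicialRealization K =>
        ((w : V → ℝ), (1 : ℝ)))).subtype_mk _⟩
  have hsub : ∀ w ∈ simplicialRealization {s ∈ K | ¬ R ⊆ s}, w ∈ simplicialRealization K :=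
    fun w hw => ⟨hw.1, hw.2.1, hw.2.2.1⟩
  let i : C(simplicialRealization {s ∈ K | ¬ R ⊆ s}, simplicialRealization K) :=
    ⟨fun w => ⟨w, hsub w w.2⟩, by fun_prop⟩
  refine ⟨⟨r, i, ?_, ?_⟩⟩
  · refine ContinuousMap.Homotopic.symm ⟨⟨⟨fun p => ⟨push p.2 p.1, hpmem _ p.2.2 _ p.1.2.1 p.1.2.2⟩,
      (hpc.comp (by fun_prop : Continuous fun p : I × simplicialRealization K =>
        ((p.2 : V → ℝ), (p.1 : ℝ)))).subtype_mk _⟩, ?_, ?_⟩⟩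
    · intro w
      apply Subtype.ext
      funext p
      simp [push]
    · intro w
      rfl
  · have : r.comp i = ContinuousMap.id _ := by
      ext1 w
      apply Subtype.ext
      exact hpz _ _ (le_antisymm (htz _ w.2.1 w.2.2.2.2) (ht0 _ (hsub _ w.2)))
    rw [this]

end Realization

/-! ### Collapsing the boundary of a simplex to a point -/

/-- The smallest coordinate of `v`. -/
noncomputable def minCoord {d : ℕ} (v : Fin (d + 1) → ℝ) : ℝ :=
  Finset.univ.inf' Finset.univ_nonempty v

theorem minCoord_le {d : ℕ} (v : Fin (d + 1) → ℝ) (i : Fin (d + 1)) : minCoord v ≤ v i :=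
  Finset.inf'_le _ (Finset.mem_univ i)

theorem exists_eq_minCoord {d : ℕ} (v : Fin (d + 1) → ℝ) : ∃ i, v i = minCoord v := by
  obtain ⟨i, -, hi⟩ := Finset.exists_mem_eq_inf' Finset.univ_nonempty v
  exact ⟨i, hi.symm⟩

theorem continuous_minCoord {d : ℕ} : Continuous (minCoord (d := d)) :=
  Continuous.finset_inf'_apply _ fun i _ => continuous_apply i

/-- The possible weights, on the vertices of a facet of dimension `d`, of a point of a simplicial
complex: either all the mass is on the facet, or some vertex of the facet has weight zero. -/
def FacetWeights (d : ℕ) : Set (Fin (d + 1) → ℝ) :=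
  {v | (∀ i, 0 ≤ v i) ∧ ∑ i, v i ≤ 1 ∧ (0 < minCoord v → ∑ i, v i = 1)}

/-- The squared distance of the weights to the barycenter of the facet, measured in all coordinates
but the first, plus a term that vanishes on the facet and keeps the sum `collapseDist v + 4 m ^ 2`
positive outside of it, where `m` is the smallest coordinate. -/
noncomputable def collapseDist {d : ℕ} (v : Fin (d + 1) → ℝ) : ℝ :=
  ∑ i : Fin d, (v i.succ - 1 / (d + 1)) ^ 2 + (1 - ∑ i, v i) ^ 2

theorem collapseDist_add_pos {d : ℕ} (v : Fin (d + 1) → ℝ) :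
    0 < collapseDist v + 4 * minCoord v ^ 2 := by
  have h1 : 0 ≤ ∑ i : Fin d, (v i.succ - 1 / (d + 1)) ^ 2 :=
    Finset.sum_nonneg fun i _ => sq_nonneg _
  have h2 := sq_nonneg (1 - ∑ i, v i)
  have h3 := sq_nonneg (minCoord v)
  by_contra h
  unfold collapseDist at h
  have e1 : ∑ i : Fin d, (v i.succ - 1 / (d + 1)) ^ 2 = 0 := by linarith
  have e2 : (1 - ∑ i, v i) ^ 2 = 0 := by linarith
  have e3 : minCoord v ^ 2 = 0 := by linarith
  have hs : ∀ i : Fin d, v i.succ = 1 / (d + 1) := by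
    intro i
    have := (Finset.sum_eq_zero_iff_of_nonneg fun i _ => sq_nonneg _).1 e1 i (Finset.mem_univ i)
    have := pow_eq_zero_iff (two_ne_zero) |>.1 this
    linarith
  have hd : (0 : ℝ) < d + 1 := by positivity
  have h0 : v 0 = 1 / (d + 1) := by
    have := pow_eq_zero_iff (two_ne_zero) |>.1 e2
    rw [Fin.sum_univ_succ, Finset.sum_congr rfl fun i _ => hs i] at this
    simp at this
    field_simp at this ⊢
    linarith
  obtain ⟨i, hi⟩ := exists_eq_minCoord v
  have hi' : v i = 1 / (d + 1) := by
    refine Fin.cases h0 hs i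
  have : 0 < minCoord v := by rw [← hi, hi']; positivity
  have := pow_eq_zero_iff (two_ne_zero) |>.1 e3
  linarith

/-- Inverse stereographic projection, applied to the weights rescaled by their minimum. -/
noncomputable def collapseVec {d : ℕ} (v : Fin (d + 1) → ℝ) : EuclideanSpace ℝ (Fin (d + 1)) :=
  WithLp.toLp 2 (Fin.cons
    ((collapseDist v - 4 * minCoord v ^ 2) / (collapseDist v + 4 * minCoord v ^ 2))
    fun i => 4 * minCoord v * (v i.succ - 1 / (d + 1)) / (collapseDist v + 4 * minCoord v ^ 2))

theorem collapseVec_zero {d : ℕ} (v : Fin (d + 1) → ℝ) : collapseVec v 0 =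
    (collapseDist v - 4 * minCoord v ^ 2) / (collapseDist v + 4 * minCoord v ^ 2) := rfl

theorem collapseVec_succ {d : ℕ} (v : Fin (d + 1) → ℝ) (i : Fin d) : collapseVec v i.succ =
    4 * minCoord v * (v i.succ - 1 / (d + 1)) / (collapseDist v + 4 * minCoord v ^ 2) := rfl

theorem continuous_collapseVec {d : ℕ} : Continuous (collapseVec (d := d)) := by
  have h1 := continuous_minCoord (d := d)
  have h2 : Continuous (collapseDist (d := d)) := by unfold collapseDist; fun_prop
  refine (PiLp.continuous_toLp 2 _).comp (continuous_pi fun i => ?_)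
  refine Fin.cases ?_ (fun i => ?_) i
  · exact Continuous.div (by fun_prop) (by fun_prop) fun v => (collapseDist_add_pos v).ne'
  · exact Continuous.div (by fun_prop) (by fun_prop) fun v => (collapseDist_add_pos v).ne'

theorem mem_unitSphere_iff {d : ℕ} (y : EuclideanSpace ℝ (Fin (d + 1))) :
    y ∈ Metric.sphere (0 : EuclideanSpace ℝ (Fin (d + 1))) 1 ↔
      y 0 ^ 2 + ∑ i : Fin d, y i.succ ^ 2 = 1 := by
  rw [mem_sphere_zero_iff_norm, EuclideanSpace.norm_eq, Real.sqrt_eq_one, Fin.sum_univ_succ]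
  simp

theorem collapseVec_mem {d : ℕ} {v : Fin (d + 1) → ℝ} (hv : v ∈ FacetWeights d) :
    collapseVec v ∈ Metric.sphere (0 : EuclideanSpace ℝ (Fin (d + 1))) 1 := by
  rw [mem_unitSphere_iff, collapseVec_zero]
  simp only [collapseVec_succ, div_pow, mul_pow]
  rw [← Finset.sum_div, ← Finset.mul_sum]
  have hpos := collapseDist_add_pos v
  -- a point with positive smallest coordinate has all its mass on the facet
  have hm : minCoord v ^ 2 * (1 - ∑ i, v i) ^ 2 = 0 := by
    obtain ⟨i, hi⟩ := exists_eq_minCoord v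
    rcases (hv.1 i).eq_or_lt with h | h
    · rw [← hi, ← h]; simp
    · rw [hv.2.2 (hi ▸ h)]; simp
  have hS : ∑ i : Fin d, (v i.succ - 1 / (d + 1)) ^ 2 =
      collapseDist v - (1 - ∑ i, v i) ^ 2 := by simp [collapseDist]
  rw [hS, ← add_div, div_eq_one_iff_eq (by positivity)]
  linear_combination (-16) * hm

theorem UnitSphere.eq_base_iff {d : ℕ} (y : UnitSphere d) :
    y = UnitSphere.base d ↔ y.1 0 = 1 := by
  constructor
  · rintro rfl
    simp [UnitSphere.base]
  · intro h
    have h1 := (mem_unitSphere_iff y.1).1 y.2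
    rw [h] at h1
    have h2 : ∑ i : Fin d, y.1 i.succ ^ 2 = 0 := by linarith
    rw [Finset.sum_eq_zero_iff_of_nonneg fun i _ => sq_nonneg _] at h2
    apply Subtype.ext
    ext i
    refine Fin.cases ?_ (fun i => ?_) i
    · simp [UnitSphere.base, h]
    · have := pow_eq_zero_iff (two_ne_zero) |>.1 (h2 i (Finset.mem_univ i))
      simp [UnitSphere.base, this]

/-- The map from a facet to the sphere that collapses the boundary of the facet to the base point;
outside of the facet it is constant. -/
noncomputable def collapseMap (d : ℕ) (v : FacetWeights d) : UnitSphere d :=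
  ⟨collapseVec v.1, collapseVec_mem v.2⟩

theorem continuous_collapseMap (d : ℕ) : Continuous (collapseMap d) :=
  (continuous_collapseVec.comp continuous_subtype_val).subtype_mk _

theorem minCoord_nonneg {d : ℕ} {v : Fin (d + 1) → ℝ} (hv : v ∈ FacetWeights d) :
    0 ≤ minCoord v := by
  obtain ⟨i, hi⟩ := exists_eq_minCoord v
  exact hi ▸ hv.1 i

theorem collapseMap_eq_base_iff {d : ℕ} (v : FacetWeights d) :
    collapseMap d v = UnitSphere.base d ↔ minCoord v.1 = 0 := by
  rw [UnitSphere.eq_base_iff]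
  change collapseVec v.1 0 = 1 ↔ _
  rw [collapseVec_zero, div_eq_one_iff_eq (collapseDist_add_pos _).ne']
  constructor
  · intro h
    have : minCoord v.1 ^ 2 = 0 := by linarith
    exact pow_eq_zero_iff (two_ne_zero) |>.1 this
  · intro h
    rw [h]; ring

/-- The stereographic projection of a point of the sphere recovers the rescaled position relative to
the barycenter: on the last `d` coordinates directly, and on the first one because the weights have
the sum `1`. -/
theorem collapseMap_rescaled_eq {d : ℕ} {v v' : FacetWeights d} (hv : 0 < minCoord v.1)
    (hv' : 0 < minCoord v'.1) (h : collapseMap d v = collapseMap d v') (i : Fin (d + 1)) :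
    (v.1 i - 1 / (d + 1)) / minCoord v.1 = (v'.1 i - 1 / (d + 1)) / minCoord v'.1 := by
  have hvec : collapseVec v.1 = collapseVec v'.1 := congrArg Subtype.val h
  have hD := collapseDist_add_pos v.1
  have hD' := collapseDist_add_pos v'.1
  have h0 : collapseVec v.1 0 = collapseVec v'.1 0 := by rw [hvec]
  have hs : ∀ j : Fin d, (v.1 j.succ - 1 / (d + 1)) / minCoord v.1 =
      (v'.1 j.succ - 1 / (d + 1)) / minCoord v'.1 := by
    intro j
    have hj : collapseVec v.1 j.succ = collapseVec v'.1 j.succ := by rw [hvec]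
    rw [collapseVec_zero, collapseVec_zero] at h0
    rw [collapseVec_succ, collapseVec_succ] at hj
    generalize collapseDist v.1 = S at *
    generalize collapseDist v'.1 = S' at *
    generalize minCoord v.1 = m at *
    generalize minCoord v'.1 = m' at *
    generalize v.1 j.succ - 1 / ((d : ℝ) + 1) = x at *
    generalize v'.1 j.succ - 1 / ((d : ℝ) + 1) = x' at *
    rw [div_eq_div_iff hD.ne' hD'.ne'] at h0 hj
    rw [div_eq_div_iff hv.ne' hv'.ne']
    have h0' : m ^ 2 * (S' + 4 * m' ^ 2) = m' ^ 2 * (S + 4 * m ^ 2) := by linarith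
    have hk : m * (m * (S' + 4 * m' ^ 2)) * (x * m') = m * (m * (S' + 4 * m' ^ 2)) * (x' * m) := by
      linear_combination (m * m' / 4) * hj - m * x' * h0'
    exact mul_left_cancel₀ (by positivity) hk
  have hsum : ∀ u : FacetWeights d, 0 < minCoord u.1 →
      (u.1 0 - 1 / (d + 1)) / minCoord u.1 =
        -∑ j : Fin d, (u.1 j.succ - 1 / (d + 1)) / minCoord u.1 := by
    intro u hu
    have h1 := u.2.2.2 hu
    rw [Fin.sum_univ_succ] at h1
    rw [← Finset.sum_div, Finset.sum_sub_distrib, ← neg_div]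
    congr 1
    have hd : (d : ℝ) + 1 ≠ 0 := by positivity
    simp only [Finset.sum_const, Finset.card_univ, Fintype.card_fin, nsmul_eq_mul]
    have : (d : ℝ) * (1 / (d + 1)) = 1 - 1 / (d + 1) := by field_simp; ring
    rw [this]
    linarith
  refine Fin.cases ?_ hs i
  rw [hsum v hv, hsum v' hv']
  exact congrArg _ (Finset.sum_congr rfl fun j _ => hs j)

theorem collapseMap_injOn {d : ℕ} {v v' : FacetWeights d} (hv : 0 < minCoord v.1)
    (h : collapseMap d v = collapseMap d v') : v = v' := by
  have hv' : 0 < minCoord v'.1 := by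
    refine lt_of_le_of_ne (minCoord_nonneg v'.2) fun h0 => hv.ne' ?_
    rw [← collapseMap_eq_base_iff, h, collapseMap_eq_base_iff, ← h0]
  have hz := collapseMap_rescaled_eq hv hv' h
  -- Along a ray from the barycenter, the smallest coordinate determines the point.
  have key : ∀ u u' : FacetWeights d, 0 < minCoord u.1 → 0 < minCoord u'.1 →
      (∀ i, (u.1 i - 1 / (d + 1)) / minCoord u.1 = (u'.1 i - 1 / (d + 1)) / minCoord u'.1) →
      minCoord u'.1 ≤ minCoord u.1 := by
    intro u u' hu hu' hz
    obtain ⟨i, hi⟩ := exists_eq_minCoord u.1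
    have h1 := hz i
    have h2 := minCoord_le u'.1 i
    have hb : (0 : ℝ) < 1 / (d + 1) := by positivity
    rw [div_eq_div_iff hu.ne' hu'.ne', hi] at h1
    nlinarith
  have hm : minCoord v.1 = minCoord v'.1 :=
    le_antisymm (key v' v hv' hv fun i => (hz i).symm) (key v v' hv hv' hz)
  apply Subtype.ext
  funext i
  have := hz i
  rw [hm, div_left_inj' hv'.ne'] at this
  linarith

/-- The interior of the facet covers the sphere without its base point. -/
theorem exists_collapseMap_eq {d : ℕ} {y : UnitSphere d} (hy : y ≠ UnitSphere.base d) :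
    ∃ v : FacetWeights d, 0 < minCoord v.1 ∧ collapseMap d v = y := by
  have hs := (mem_unitSphere_iff y.1).1 y.2
  have h0 : y.1 0 < 1 := by
    refine lt_of_le_of_ne ?_ fun h => hy ((UnitSphere.eq_base_iff y).2 h)
    have : 0 ≤ ∑ i : Fin d, y.1 i.succ ^ 2 := Finset.sum_nonneg fun i _ => sq_nonneg _
    nlinarith
  have hy0 : 0 < 1 - y.1 0 := by linarith
  -- the stereographic projection of `y`, completed to a direction `z` of coordinate sum zero; the
  -- point sought is the one on the ray from the barycenter along `z` that is `m` times `z` away from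
  -- it, where `m` is its own smallest coordinate
  let z : Fin (d + 1) → ℝ := Fin.cons (-∑ i : Fin d, 2 * y.1 i.succ / (1 - y.1 0))
    fun i => 2 * y.1 i.succ / (1 - y.1 0)
  have hzs : ∀ i : Fin d, z i.succ = 2 * y.1 i.succ / (1 - y.1 0) := fun i => rfl
  have hzsum : ∑ i, z i = 0 := by
    rw [Fin.sum_univ_succ]
    simp [z]
  have hzmin : minCoord z ≤ 0 := by
    by_contra h
    push Not at h
    have : 0 < ∑ i, z i :=
      Finset.sum_pos (fun i _ => h.trans_le (minCoord_le z i)) Finset.univ_nonempty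
    linarith
  have hd : (0 : ℝ) < d + 1 := by positivity
  have hpos : 0 < 1 - minCoord z := by linarith
  set m : ℝ := 1 / (d + 1) / (1 - minCoord z) with hm
  have hmpos : 0 < m := by positivity
  have hmz : 1 / (d + 1) + m * minCoord z = m := by
    have : m * (1 - minCoord z) = 1 / (d + 1) := div_mul_cancel₀ _ hpos.ne'
    linarith
  let v : Fin (d + 1) → ℝ := fun i => 1 / (d + 1) + m * z i
  have hvm : minCoord v = m := by
    apply le_antisymm
    · obtain ⟨i, hi⟩ := exists_eq_minCoord z
      refine (minCoord_le v i).trans ?_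
      simp only [v]
      rw [hi, hmz]
    · refine Finset.le_inf' _ _ fun i _ => ?_
      have := mul_le_mul_of_nonneg_left (minCoord_le z i) hmpos.le
      simp only [v]
      linarith
  have hvsum : ∑ i, v i = 1 := by
    simp only [v, Finset.sum_add_distrib, ← Finset.mul_sum, hzsum]
    simp
    field_simp
  have hvmem : v ∈ FacetWeights d :=
    ⟨fun i => hmpos.le.trans (hvm ▸ minCoord_le v i), hvsum.le, fun _ => hvsum⟩
  refine ⟨⟨v, hvmem⟩, by rw [hvm]; exact hmpos, ?_⟩
  have hS : collapseDist v = 4 * m ^ 2 * (1 + y.1 0) / (1 - y.1 0) := by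
    simp only [collapseDist, hvsum, v, hzs]
    have e : ∀ i : Fin d, (1 / ((d : ℝ) + 1) + m * (2 * y.1 i.succ / (1 - y.1 0)) - 1 / (d + 1)) ^ 2
        = 4 * m ^ 2 / (1 - y.1 0) ^ 2 * y.1 i.succ ^ 2 := by
      intro i; field_simp; ring
    rw [Finset.sum_congr rfl fun i _ => e i, ← Finset.mul_sum]
    have e2 : ∑ i : Fin d, y.1 i.succ ^ 2 = (1 - y.1 0) * (1 + y.1 0) := by linarith
    rw [e2]
    field_simp
    ring
  have hD : collapseDist v + 4 * m ^ 2 = 8 * m ^ 2 / (1 - y.1 0) := by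
    rw [hS]; field_simp; ring
  apply Subtype.ext
  change collapseVec v = y.1
  ext i
  refine Fin.cases ?_ (fun i => ?_) i
  · rw [collapseVec_zero, hvm, hD, hS]
    field_simp
    ring
  · rw [collapseVec_succ, hvm, hD]
    simp only [v, hzs]
    field_simp
    ring

/-! ### Wedges of spheres -/

/-- The inclusion of a wedge of pointed spaces into their product. -/
def Wedge.toPi (r : ℕ) (X : Type*) [TopologicalSpace X] (x₀ : X) (w : Wedge r X x₀) : Fin r → X :=
  Quot.lift (fun z => Sum.elim (fun _ _ => x₀) (fun a => Function.update (fun _ => x₀) a.1 a.2) z)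
    (by
      rintro _ _ ⟨j, rfl, rfl⟩
      simp) w

theorem Wedge.continuous_toPi (r : ℕ) (X : Type*) [TopologicalSpace X] (x₀ : X) :
    Continuous (Wedge.toPi r X x₀) := by
  refine continuous_quot_lift _ (continuous_const.sumElim ?_)
  refine continuous_sigma fun j => ?_
  exact continuous_const.update j continuous_id

theorem Wedge.toPi_injective (r : ℕ) (X : Type*) [TopologicalSpace X] (x₀ : X) :
    Function.Injective (Wedge.toPi r X x₀) := by
  have hb : ∀ j : Fin r, (Quot.mk _ (Sum.inr ⟨j, x₀⟩) : Wedge r X x₀) = Quot.mk _ (Sum.inl ()) :=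
    fun j => (Quot.sound ⟨j, rfl, rfl⟩).symm
  have hl : ∀ (j : Fin r) (x : X), (fun _ => x₀) = Function.update (fun _ : Fin r => x₀) j x →
      x = x₀ := by
    intro j x h
    have := congrFun h j
    simpa using this.symm
  rintro ⟨⟨⟩ | ⟨j, x⟩⟩ ⟨⟨⟩ | ⟨i, y⟩⟩ h
  · rfl
  · obtain rfl := hl i y h
    exact (hb i).symm
  · obtain rfl := hl j x h.symm
    exact hb j
  · have h' : Function.update (fun _ : Fin r => x₀) j x = Function.update (fun _ => x₀) i y := h
    by_cases hij : j = i
    · subst hij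
      have := congrFun h' j
      simp only [Function.update_self] at this
      rw [this]
    · have h1 := congrFun h' j
      have h2 := congrFun h' i
      simp only [Function.update_self, Function.update_of_ne hij,
        Function.update_of_ne (Ne.symm hij)] at h1 h2
      subst h1 h2
      exact (hb j).trans (hb i).symm

/-! ### A contractible complex with full facets attached -/

section AttachFacets

theorem isCompact_simplicialRealization {V : Type*} [Fintype V] (K : Set (Finset V)) (hK : IsLowerSet K) :
    IsCompact (simplicialRealization K) := by
  have hsub : simplicialRealization K ⊆ Set.Icc 0 1 := by
    intro w hw
    refine ⟨hw.1, fun p => ?_⟩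
    have := Finset.single_le_sum (f := w) (fun q _ => hw.1 q) (Finset.mem_univ p)
    rw [hw.2.1] at this
    exact this
  refine isCompact_Icc.of_isClosed_subset ?_ hsub
  have : simplicialRealization K =
      ⋃ s ∈ K, {w : V → ℝ | (∀ p, 0 ≤ w p) ∧ ∑ p, w p = 1 ∧ ∀ p, p ∉ s → w p = 0} := by
    ext w
    simp only [Set.mem_iUnion, Set.mem_ofPred_eq, exists_prop]
    constructor
    · rintro ⟨h0, h1, h2⟩
      exact ⟨_, h2, h0, h1, fun p hp => by simpa using hp⟩
    · rintro ⟨s, hs, h0, h1, h2⟩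
      refine ⟨h0, h1, hK ?_ hs⟩
      intro p hp
      by_contra h
      exact (mem_weightSupport.1 hp) (h2 p h)
  rw [this]
  refine (Set.toFinite K).isClosed_biUnion fun s _ => ?_
  refine IsClosed.inter ?_ (IsClosed.inter ?_ ?_)
  · exact isClosed_le continuous_const continuous_id
  · exact isClosed_eq (by fun_prop) continuous_const
  · have : {w : V → ℝ | ∀ p, p ∉ s → w p = 0} = ⋂ p, ⋂ (_ : p ∉ s), {w : V → ℝ | w p = 0} := by
      ext w; simp
    change IsClosed {w : V → ℝ | ∀ p, p ∉ s → w p = 0}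
    rw [this]
    exact isClosed_iInter fun p => isClosed_iInter fun _ =>
      isClosed_eq (continuous_apply p) continuous_const

-- the facets to be attached, and enumerations of their vertices
variable {V : Type*} {d r : ℕ} (F : Fin r → Finset V)
  (e : ∀ j, Fin (d + 1) ≃ F j)

/-- The smallest weight on the facet `F j`. -/
noncomputable def facetMin (j : Fin r) (w : V → ℝ) : ℝ := minCoord fun i => w (e j i)

theorem continuous_facetMin (j : Fin r) : Continuous (facetMin F e j) :=
  continuous_minCoord.comp (by fun_prop)

theorem facetMin_le (j : Fin r) (w : V → ℝ) {p : V} (hp : p ∈ F j) : facetMin F e j w ≤ w p := by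
  have := minCoord_le (fun i => w (e j i)) ((e j).symm ⟨p, hp⟩)
  simpa [facetMin] using this

theorem exists_eq_facetMin (j : Fin r) (w : V → ℝ) : ∃ p ∈ F j, w p = facetMin F e j w := by
  obtain ⟨i, hi⟩ := exists_eq_minCoord fun i => w (e j i)
  exact ⟨_, (e j i).2, hi⟩

theorem facetMin_nonneg (j : Fin r) {w : V → ℝ} (hw : ∀ p, 0 ≤ w p) : 0 ≤ facetMin F e j w := by
  obtain ⟨p, -, hp⟩ := exists_eq_facetMin F e j w
  exact hp ▸ hw p

/-- Remove weight, up to `c` at each vertex, from the facets `F j`. -/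
noncomputable def shrinkFacets [DecidableEq V] (w : V → ℝ) (c : ℝ) (p : V) : ℝ :=
  w p - ∑ j, if p ∈ F j then min (facetMin F e j w) c else 0

theorem continuous_shrinkFacets [DecidableEq V] :
    Continuous fun z : (V → ℝ) × ℝ => shrinkFacets F e z.1 z.2 := by
  refine continuous_pi fun p => ?_
  unfold shrinkFacets
  refine Continuous.sub (by fun_prop) (continuous_finsetSum _ fun j _ => ?_)
  have := continuous_facetMin F e j
  split_ifs <;> fun_prop

variable [Fintype V] {K : Set (Finset V)}

theorem weightSupport_eq_of_facetMin_pos (hmax : ∀ j, ∀ s ∈ K, F j ⊆ s → s = F j) {j : Fin r}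
    {w : V → ℝ} (hw : w ∈ simplicialRealization K) (h : 0 < facetMin F e j w) :
    weightSupport w = F j := by
  refine hmax j _ hw.2.2 fun p hp => ?_
  rw [mem_weightSupport]
  exact (h.trans_le (facetMin_le F e j w hp)).ne'

theorem facetMin_pos_of_weightSupport_eq {j : Fin r} {w : V → ℝ} (hw : ∀ p, 0 ≤ w p)
    (h : weightSupport w = F j) : 0 < facetMin F e j w := by
  obtain ⟨p, hp, hpe⟩ := exists_eq_facetMin F e j w
  rw [← hpe]
  rw [← h, mem_weightSupport] at hp
  exact lt_of_le_of_ne (hw p) hp.symm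

variable [DecidableEq V]

/-- Nothing happens to the points of the subcomplex. -/
theorem shrinkFacets_eq_self {w : V → ℝ} (hw : ∀ p, 0 ≤ w p) (hA : ∀ j, weightSupport w ≠ F j)
    (hmax : ∀ j, ∀ s ∈ K, F j ⊆ s → s = F j) (hwK : w ∈ simplicialRealization K)
    {c : ℝ} (hc : 0 ≤ c) : shrinkFacets F e w c = w := by
  funext p
  have : ∀ j, facetMin F e j w = 0 := fun j =>
    le_antisymm (not_lt.1 fun h => hA j (weightSupport_eq_of_facetMin_pos F e hmax hwK h))
      (facetMin_nonneg F e j hw)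
  simp [shrinkFacets, this, hc]

theorem shrinkFacets_eq_of_weightSupport_eq (hF : Function.Injective F)
    (hmax : ∀ j, ∀ s ∈ K, F j ⊆ s → s = F j) {w : V → ℝ} (hwK : w ∈ simplicialRealization K)
    {j : Fin r} (hj : weightSupport w = F j) {c : ℝ} (hc : 0 ≤ c) (p : V) :
    shrinkFacets F e w c p = w p - if p ∈ F j then min (facetMin F e j w) c else 0 := by
  rw [shrinkFacets, Finset.sum_eq_single j]
  · intro i _ hij
    have : facetMin F e i w = 0 :=
      le_antisymm (not_lt.1 fun h => hij (hF
        ((weightSupport_eq_of_facetMin_pos F e hmax hwK h).symm.trans hj)))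
        (facetMin_nonneg F e i hwK.1)
    simp [this, hc]
  · simp

/-- If `K` consists of a contractible subcomplex and of `r` further facets of dimension `d`, then
collapsing the subcomplex to a point shows that `K` has the homotopy type of a wedge of spheres. -/
theorem nonempty_homotopyEquiv_wedge (hK : IsLowerSet K) (hF : Function.Injective F)
    (hcard : ∀ j, (F j).card = d + 1)
    (hmem : ∀ j, F j ∈ K) (hmax : ∀ j, ∀ s ∈ K, F j ⊆ s → s = F j)
    [hcontr : ContractibleSpace (simplicialRealization (K \ Set.range F))] :
    Nonempty (simplicialRealization K ≃ₕ Wedge r (UnitSphere d) (UnitSphere.base d)) := by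
  let e : ∀ j, Fin (d + 1) ≃ F j := fun j => ((F j).equivFinOfCardEq (hcard j)).symm
  have hsubK : ∀ w ∈ simplicialRealization (K \ Set.range F), w ∈ simplicialRealization K :=
    fun w hw => ⟨hw.1, hw.2.1, hw.2.2.1⟩
  let A : Set (simplicialRealization K) := {x | x.1 ∈ simplicialRealization (K \ Set.range F)}
  have hAiff : ∀ x : simplicialRealization K, x ∈ A ↔ ∀ j, weightSupport x.1 ≠ F j := by
    intro x
    constructor
    · intro hx j hj
      exact hx.2.2.2 ⟨j, hj.symm⟩
    · intro h
      exact ⟨x.2.1, x.2.2.1, x.2.2.2, fun ⟨j, hj⟩ => h j hj.symm⟩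
  let hA : A ≃ₜ simplicialRealization (K \ Set.range F) :=
    { toFun := fun x => ⟨x.1.1, x.2⟩
      invFun := fun y => ⟨⟨y.1, hsubK _ y.2⟩, y.2⟩
      left_inv := fun x => rfl
      right_inv := fun x => rfl
      continuous_toFun := by fun_prop
      continuous_invFun := by fun_prop }
  have : ContractibleSpace A := hA.contractibleSpace
  have hdpos : (0 : ℝ) < d + 1 := by positivity
  -- The level at which half of the mass of the barycenter of a facet has been removed.
  set c : ℝ := 1 / (2 * (d + 1)) with hcdef
  have hcpos : 0 < c := by positivity
  have hcd : c * (d + 1) = 1 / 2 := by rw [hcdef]; field_simp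
  have hFcard : ∀ j, ((F j).card : ℝ) = d + 1 := by
    intro j
    rw [hcard j]; push_cast; ring
  have hshrink0 : ∀ x : simplicialRealization K, ∀ a : ℝ, 0 ≤ a →
      ∀ p, 0 ≤ shrinkFacets F e x.1 a p ∧ shrinkFacets F e x.1 a p ≤ x.1 p := by
    intro x a ha p
    by_cases hx : ∃ j, weightSupport x.1 = F j
    · obtain ⟨j, hj⟩ := hx
      rw [shrinkFacets_eq_of_weightSupport_eq F e hF hmax x.2 hj ha]
      split_ifs with hp
      · have h1 := facetMin_le F e j x.1 hp
        have h2 := min_le_left (facetMin F e j x.1) a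
        have h3 : 0 ≤ min (facetMin F e j x.1) a := le_min (facetMin_nonneg F e j x.2.1) ha
        constructor <;> linarith
      · simpa using x.2.1 p
    · push Not at hx
      rw [shrinkFacets_eq_self F e x.2.1 hx hmax x.2 ha]
      exact ⟨x.2.1 p, le_rfl⟩
  have hmass : ∀ x : simplicialRealization K, ∀ a : ℝ, 0 ≤ a → a ≤ c →
      1 / 2 ≤ ∑ p, shrinkFacets F e x.1 a p := by
    intro x a ha hac
    by_cases hx : ∃ j, weightSupport x.1 = F j
    · obtain ⟨j, hj⟩ := hx
      rw [Finset.sum_congr rfl fun p _ =>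
        shrinkFacets_eq_of_weightSupport_eq F e hF hmax x.2 hj ha p]
      rw [Finset.sum_sub_distrib, x.2.2.1, Finset.sum_ite_mem]
      simp only [Finset.univ_inter, Finset.sum_const, nsmul_eq_mul, hFcard]
      have h2 := min_le_right (facetMin F e j x.1) a
      nlinarith
    · push Not at hx
      rw [shrinkFacets_eq_self F e x.2.1 hx hmax x.2 ha, x.2.2.1]
      norm_num
  -- `E` removes weight from the open facets and normalizes the total weight; a point of an open facet
  -- reaches the boundary when the smallest of its weights on the facet is used up
  let N : simplicialRealization K × I → V → ℝ := fun z => shrinkFacets F e z.1 (z.2 * c)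
  have hNc : Continuous N :=
    (continuous_shrinkFacets F e).comp (f := fun z : simplicialRealization K × I =>
      ((z.1 : V → ℝ), (z.2 : ℝ) * c)) (by fun_prop)
  have hs0 : ∀ s : I, 0 ≤ (s : ℝ) * c := fun s => mul_nonneg s.2.1 hcpos.le
  have hsc : ∀ s : I, (s : ℝ) * c ≤ c := fun s => mul_le_of_le_one_left hcpos.le s.2.2
  have hNpos : ∀ z, 0 < ∑ p, N z p := fun z =>
    lt_of_lt_of_le (by norm_num) (hmass z.1 _ (hs0 z.2) (hsc z.2))
  have hEmem : ∀ z, (fun p => N z p / ∑ q, N z q) ∈ simplicialRealization K := by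
    intro z
    refine ⟨fun p => div_nonneg (hshrink0 _ _ (hs0 _) p).1 (hNpos z).le, ?_, ?_⟩
    · rw [← Finset.sum_div, div_self (hNpos z).ne']
    · refine hK ?_ z.1.2.2.2
      intro p hp
      rw [mem_weightSupport] at hp ⊢
      intro h
      apply hp
      have h1 := hshrink0 z.1 _ (hs0 z.2) p
      rw [h] at h1
      have : N z p = 0 := le_antisymm h1.2 h1.1
      rw [this, zero_div]
  let E : simplicialRealization K × I → simplicialRealization K := fun z => ⟨_, hEmem z⟩
  have hEc : Continuous E := by
    refine Continuous.subtype_mk (continuous_pi fun p => ?_) _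
    exact Continuous.div (by fun_prop) (by fun_prop) fun z => (hNpos z).ne'
  -- if `2 * T x ≤ s`, then the smallest weight on the facet is at most `s * c`
  let T : simplicialRealization K → ℝ := fun x => ∑ j, (d + 1) * facetMin F e j x.1
  have hTc : Continuous T := by
    refine continuous_finsetSum _ fun j _ => ?_
    have := continuous_facetMin F e j
    fun_prop
  have hNself : ∀ z, N z = z.1.1 → E z = z.1 := by
    intro z hz
    apply Subtype.ext
    funext p
    change N z p / ∑ q, N z q = z.1.1 p
    rw [hz, z.1.2.2.1, div_one]
  have hm0 : ∀ x ∈ A, ∀ j, facetMin F e j x.1 = 0 := fun x hx j =>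
    le_antisymm (not_lt.1 fun h => (hAiff x).1 hx j
      (weightSupport_eq_of_facetMin_pos F e hmax x.2 h)) (facetMin_nonneg F e j x.2.1)
  obtain ⟨H, hH0, hHA, a, -, hH1⟩ := exists_homotopy_contracting_subspace A E hEc T hTc
    (by
      intro x
      refine hNself (x, 0) ?_
      funext p
      have : ∀ j, min (facetMin F e j x.1) 0 = 0 := fun j =>
        min_eq_right (facetMin_nonneg F e j x.2.1)
      simp [N, shrinkFacets, this])
    (fun x hx s => hNself (x, s)
      (shrinkFacets_eq_self F e x.2.1 ((hAiff x).1 hx) hmax x.2 (hs0 s)))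
    (by
      intro x hx
      simp [T, hm0 x hx])
    (by
      intro x s hTs
      rw [hAiff]
      intro i hi
      by_cases hx : ∃ j, weightSupport x.1 = F j
      · obtain ⟨j, hj⟩ := hx
        have hsub : F i ⊆ F j := by
          rw [← hi, ← hj]
          intro p hp
          rw [mem_weightSupport] at hp ⊢
          intro h
          apply hp
          have h1 := hshrink0 x _ (hs0 s) p
          rw [h] at h1
          have : N (x, s) p = 0 := le_antisymm h1.2 h1.1
          change N (x, s) p / _ = 0
          rw [this, zero_div]
        have hij : F i = F j := (hmax i _ (hmem j) hsub).symm
        obtain ⟨p, hp, hpe⟩ := exists_eq_facetMin F e j x.1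
        have hp' : p ∈ weightSupport (E (x, s)).1 := by rw [hi, hij]; exact hp
        rw [mem_weightSupport] at hp'
        apply hp'
        change N (x, s) p / _ = 0
        have hle : facetMin F e j x.1 ≤ s * c := by
          have h1 : (d + 1) * facetMin F e j x.1 ≤ T x :=
            Finset.single_le_sum (f := fun j => ((d : ℝ) + 1) * facetMin F e j x.1)
              (fun j _ => mul_nonneg hdpos.le (facetMin_nonneg F e j x.2.1)) (Finset.mem_univ j)
          have h2 : 2 * ((d + 1) * facetMin F e j x.1) ≤ s := by linarith
          have h3 : (s : ℝ) = s * c * (2 * (d + 1)) := by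
            have : (s : ℝ) * c * (2 * (d + 1)) = s * (2 * (c * (d + 1))) := by ring
            rw [this, hcd]; ring
          rw [h3] at h2
          nlinarith
        have : N (x, s) p = 0 := by
          change shrinkFacets F e x.1 (s * c) p = 0
          rw [shrinkFacets_eq_of_weightSupport_eq F e hF hmax x.2 hj (hs0 s), if_pos hp,
            min_eq_left hle, hpe, sub_self]
        rw [this, zero_div]
      · push Not at hx
        rw [hNself (x, s) (shrinkFacets_eq_self F e x.2.1 hx hmax x.2 (hs0 s))] at hi
        exact hx i hi)
    (fun x => Finset.sum_nonneg fun j _ => mul_nonneg hdpos.le (facetMin_nonneg F e j x.2.1))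
  -- The quotient map onto the wedge; it is continuous because the wedge, a compact space, embeds into
  -- the product of the spheres, and a quotient map because it maps a compact space to a Hausdorff one.
  have hweights : ∀ (x : simplicialRealization K) (j : Fin r),
      (fun i => x.1 (e j i)) ∈ FacetWeights d := by
    intro x j
    have hsum : ∑ i, x.1 (e j i) = ∑ p ∈ F j, x.1 p := by
      rw [(e j).sum_comp fun p => x.1 p]
      exact Finset.sum_coe_sort (F j) x.1
    refine ⟨fun i => x.2.1 _, ?_, fun h => ?_⟩
    · rw [hsum, ← x.2.2.1]
      exact Finset.sum_le_sum_of_subset_of_nonneg (Finset.subset_univ _) fun p _ _ => x.2.1 p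
    · rw [hsum, ← x.2.2.1]
      refine Finset.sum_subset (Finset.subset_univ _) fun p _ hp => ?_
      rw [← weightSupport_eq_of_facetMin_pos F e hmax x.2 h] at hp
      simpa using hp
  let w : ∀ (x : simplicialRealization K) (j : Fin r), FacetWeights d := fun x j =>
    ⟨fun i => x.1 (e j i), hweights x j⟩
  classical
  let qf : simplicialRealization K → Wedge r (UnitSphere d) (UnitSphere.base d) := fun x =>
    if h : ∃ j, weightSupport x.1 = F j then
      Quot.mk _ (Sum.inr ⟨h.choose, collapseMap d (w x h.choose)⟩)
    else Quot.mk _ (Sum.inl ())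
  have hbase : ∀ x j, weightSupport x.1 ≠ F j → collapseMap d (w x j) = UnitSphere.base d := by
    intro x j hj
    rw [collapseMap_eq_base_iff]
    exact le_antisymm (not_lt.1 fun h => hj (weightSupport_eq_of_facetMin_pos F e hmax x.2 h))
      (facetMin_nonneg F e j x.2.1)
  have hqf : ∀ x j, weightSupport x.1 = F j →
      qf x = Quot.mk _ (Sum.inr ⟨j, collapseMap d (w x j)⟩) := by
    intro x j hj
    have h : ∃ j, weightSupport x.1 = F j := ⟨j, hj⟩
    have hc : h.choose = j := hF (h.choose_spec.symm.trans hj)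
    simp only [qf]
    rw [dif_pos h, hc]
  have hqA : ∀ x ∈ A, qf x = Quot.mk _ (Sum.inl ()) := by
    intro x hx
    rw [hAiff] at hx
    simp only [qf]
    rw [dif_neg (not_exists.2 hx)]
  have hpi : ∀ x, Wedge.toPi r _ _ (qf x) = fun j => collapseMap d (w x j) := by
    intro x
    by_cases hx : ∃ j, weightSupport x.1 = F j
    · obtain ⟨j, hj⟩ := hx
      rw [hqf x j hj]
      change Function.update (fun _ => UnitSphere.base d) j (collapseMap d (w x j)) = _
      funext i
      by_cases hij : i = j
      · subst hij; simp
      · rw [Function.update_of_ne hij, hbase x i]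
        intro h
        exact hij (hF (h.symm.trans hj))
    · push Not at hx
      rw [hqA x ((hAiff x).2 hx)]
      funext i
      exact (hbase x i (hx i)).symm
  have hinj := Wedge.toPi_injective r (UnitSphere d) (UnitSphere.base d)
  have hpc := Wedge.continuous_toPi r (UnitSphere d) (UnitSphere.base d)
  have : T2Space (Wedge r (UnitSphere d) (UnitSphere.base d)) :=
    T2Space.of_injective_continuous hinj hpc
  have : CompactSpace (UnitSphere d) := isCompact_iff_compactSpace.1 (isCompact_sphere _ _)
  have : CompactSpace (simplicialRealization K) :=
    isCompact_iff_compactSpace.1 (isCompact_simplicialRealization K hK)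
  have hqc : Continuous qf := by
    rw [(hpc.isClosedEmbedding hinj).isEmbedding.continuous_iff]
    have : Wedge.toPi r (UnitSphere d) (UnitSphere.base d) ∘ qf =
        fun x j => collapseMap d (w x j) := funext hpi
    rw [this]
    refine continuous_pi fun j => (continuous_collapseMap d).comp ?_
    exact Continuous.subtype_mk
      (continuous_pi fun i => show Continuous fun x : simplicialRealization K => x.1 (e j i) from
        (continuous_apply _).comp continuous_subtype_val) _
  have hptA : ∃ x, x ∈ A := by
    obtain ⟨y⟩ : Nonempty (simplicialRealization (K \ Set.range F)) := inferInstance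
    exact ⟨_, (hA.symm y).2⟩
  have hsurj : Function.Surjective qf := by
    have hbp : ∃ x, qf x = Quot.mk _ (Sum.inl ()) := hptA.imp fun x hx => hqA x hx
    rintro ⟨⟨⟩ | ⟨j, y⟩⟩
    · exact hbp
    · by_cases hy : y = UnitSphere.base d
      · obtain ⟨x, hx⟩ := hbp
        refine ⟨x, hx.trans ?_⟩
        subst hy
        exact Quot.sound ⟨j, rfl, rfl⟩
      · obtain ⟨v, hv, rfl⟩ := exists_collapseMap_eq hy
        let x : V → ℝ := fun p => if h : p ∈ F j then v.1 ((e j).symm ⟨p, h⟩) else 0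
        have hxe : ∀ i, x (e j i) = v.1 i := by
          intro i
          simp [x]
        have hsupp : weightSupport x = F j := by
          ext p
          rw [mem_weightSupport]
          by_cases hp : p ∈ F j
          · simp only [x, hp, dif_pos, iff_true]
            exact (hv.trans_le (minCoord_le _ _)).ne'
          · simp [x, hp]
        have hxK : x ∈ simplicialRealization K := by
          refine ⟨fun p => ?_, ?_, ?_⟩
          · simp only [x]
            split_ifs
            · exact v.2.1 _
            · exact le_rfl
          · rw [← v.2.2.2 hv, ← Finset.sum_congr rfl fun i _ => hxe i,
              (e j).sum_comp fun p => x p, Finset.sum_coe_sort (F j) x]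
            refine (Finset.sum_subset (Finset.subset_univ _) fun p _ hp => ?_).symm
            simp [x, hp]
          · rw [hsupp]; exact hmem j
        refine ⟨⟨x, hxK⟩, ?_⟩
        rw [hqf ⟨x, hxK⟩ j hsupp]
        have : w ⟨x, hxK⟩ j = v := Subtype.ext (funext hxe)
        rw [this]
  refine nonempty_homotopyEquiv_of_isQuotientMap ⟨qf, hqc⟩
    (hqc.isClosedMap.isQuotientMap hqc hsurj) A ?_ ?_ H hH0 hHA a hH1
  · intro x y hxy
    have hcol : ∀ j, collapseMap d (w x j) = collapseMap d (w y j) := by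
      have h1 := congrArg (Wedge.toPi r (UnitSphere d) (UnitSphere.base d)) hxy
      change Wedge.toPi _ _ _ (qf x) = Wedge.toPi _ _ _ (qf y) at h1
      rw [hpi, hpi] at h1
      exact congrFun h1
    have key : ∀ x y : simplicialRealization K,
        (∀ j, collapseMap d (w x j) = collapseMap d (w y j)) → x ∉ A → x = y := by
      intro x y hcol hx
      rw [hAiff] at hx
      push Not at hx
      obtain ⟨j, hj⟩ := hx
      have hpos : 0 < minCoord (w x j).1 := facetMin_pos_of_weightSupport_eq F e x.2.1 hj
      have hw := collapseMap_injOn hpos (hcol j)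
      have hpos' : 0 < facetMin F e j y.1 := by
        change 0 < minCoord (w y j).1
        rw [← hw]; exact hpos
      have hjy := weightSupport_eq_of_facetMin_pos F e hmax y.2 hpos'
      apply Subtype.ext
      funext p
      by_cases hp : p ∈ F j
      · have := congrFun (congrArg Subtype.val hw) ((e j).symm ⟨p, hp⟩)
        simpa [w] using this
      · have h1 : p ∉ weightSupport x.1 := hj ▸ hp
        have h2 : p ∉ weightSupport y.1 := hjy ▸ hp
        simp only [mem_weightSupport, not_not] at h1 h2
        rw [h1, h2]
    by_cases hx : x ∈ A
    · by_cases hy : y ∈ A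
      · exact Or.inr ⟨hx, hy⟩
      · exact Or.inl (key y x (fun j => (hcol j).symm) hy).symm
    · exact Or.inl (key x y hcol hx)
  · intro x hx y hy
    exact (hqA x hx).trans (hqA y hy).symm

end AttachFacets

end

/-! ### Order complexes -/

/-- The faces of the order complex of `P`. -/
def orderFaces (P : Type*) [PartialOrder P] : Set (Finset P) :=
  {s : Finset P | IsChain (· ≤ ·) (s : Set P)}

theorem mem_orderFaces {P : Type*} [PartialOrder P] {s : Finset P} :
    s ∈ orderFaces P ↔ IsChain (· ≤ ·) (s : Set P) := Iff.rfl

theorem isLowerSet_orderFaces (P : Type*) [PartialOrder P] : IsLowerSet (orderFaces P) :=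
  fun _ _ hts hs => IsChain.mono (Finset.coe_subset.2 hts) hs

theorem coe_weightSupport {V : Type*} [Fintype V] (w : V → ℝ) :
    (weightSupport w : Set V) = Function.support w := by
  ext p; simp

/-- The two descriptions of the realization of an order complex agree. -/
def orderRealizationHomeomorph (P : Type*) [PartialOrder P] [Fintype P] :
    OrderRealization P ≃ₜ simplicialRealization (orderFaces P) :=
  (Homeomorph.refl (P → ℝ)).subtype fun w => by
    simp only [simplicialRealization, Set.mem_ofPred_eq, mem_orderFaces, coe_weightSupport,
      finsum_eq_sum_of_fintype, Homeomorph.refl_apply, id_eq]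

/-! ### Partitions of a simplicial complex into Boolean intervals -/

/-- A partition of the simplicial complex `K` into the intervals `[restr c, facet c]` of faces, such
that passing from a face to a face of it in another interval lowers the rank of the interval: the
partition that a shelling induces, with `restr c` the restriction of the facet with index `c`. -/
structure FacetPartition {V : Type*} (K : Set (Finset V)) (ι : Type*) where
  /-- The facet that is the top of an interval. -/
  facet : ι → Finset V
  /-- The bottom of an interval. -/
  restr : ι → Finset V
  /-- The interval that a face lies in. -/
  cls : Finset V → ι
  /-- The order in which the facets are attached. -/
  rank : ι → ℕ
  facet_mem : ∀ c, facet c ∈ K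
  facet_max : ∀ c, ∀ s ∈ K, facet c ⊆ s → s = facet c
  restr_subset : ∀ c, restr c ⊆ facet c
  cls_eq_iff : ∀ s ∈ K, ∀ c, cls s = c ↔ restr c ⊆ s ∧ s ⊆ facet c
  rank_lt : ∀ t ∈ K, ∀ s ⊆ t, cls s ≠ cls t → rank (cls s) < rank (cls t)

namespace FacetPartition

variable {V ι : Type*} {K : Set (Finset V)} (p : FacetPartition K ι)

theorem cls_facet (c : ι) : p.cls (p.facet c) = c :=
  (p.cls_eq_iff _ (p.facet_mem c) c).2 ⟨p.restr_subset c, subset_rfl⟩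

theorem facet_injective : Function.Injective p.facet := fun c c' h => by
  rw [← p.cls_facet c, h, p.cls_facet]

/-- The faces that are not facets attached along their whole boundary. -/
def core : Set (Finset V) := {s ∈ K | p.restr (p.cls s) ≠ p.facet (p.cls s)}

theorem core_eq (s : Finset V) :
    s ∈ p.core ↔ s ∈ K ∧ ∀ c, p.restr c = p.facet c → s ≠ p.facet c := by
  constructor
  · rintro ⟨hs, h⟩
    refine ⟨hs, ?_⟩
    rintro c hc rfl
    rw [p.cls_facet] at h
    exact h hc
  · rintro ⟨hs, h⟩
    refine ⟨hs, fun hc => h _ hc ?_⟩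
    have := (p.cls_eq_iff s hs _).1 rfl
    exact subset_antisymm this.2 (hc ▸ this.1)

/-- The core is built up by elementary expansions, starting from the empty family: a property `P` holds
for the core if it holds for the empty family and passes from `L` without the faces containing `R` to
`L` whenever the link of `R` in `L` is a cone. Each interval `[restr c, facet c]` with more than one
element is such a step, with `restr c` as `R` and any other vertex of `facet c` as the apex. -/
theorem core_induction [DecidableEq V] [Finite ι] (hK : IsLowerSet K)
    (P : Set (Finset V) → Prop) (hempty : P ∅)
    (hstep : ∀ L ⊆ K, IsLowerSet L → ∀ (R : Finset V) (u : V), u ∉ R →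
      (∀ s ∈ L, R ⊆ s → insert u s ∈ L) → P {s ∈ L | ¬ R ⊆ s} → P L) : P p.core := by
  classical
  cases nonempty_fintype ι
  -- the part of the core in the intervals with index in a set `D` that is closed under lower rank
  have main : ∀ (n : ℕ) (D : Finset ι), D.card = n →
      (∀ c ∈ D, ∀ c', p.rank c' < p.rank c → c' ∈ D) → P {s ∈ p.core | p.cls s ∈ D} := by
    intro n
    induction n with
    | zero =>
      intro D hD _
      rw [Finset.card_eq_zero] at hD
      subst hD
      simpa using hempty
    | succ n ih =>
      intro D hD hdown
      -- remove an interval of the largest rank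
      obtain ⟨c, hc, hmax⟩ := D.exists_max_image p.rank (Finset.card_pos.1 (by omega))
      have ih' := ih (D.erase c) (by rw [Finset.card_erase_of_mem hc, hD]; rfl) (by
        intro a ha b hb
        rw [Finset.mem_erase] at ha ⊢
        refine ⟨?_, hdown a ha.2 b hb⟩
        rintro rfl
        exact (hmax a ha.2).not_gt hb)
      by_cases hfall : p.restr c = p.facet c
      · convert ih' using 1
        ext s
        simp only [Set.mem_ofPred_eq, Finset.mem_erase]
        refine ⟨fun h => ⟨h.1, fun he => h.1.2 (he ▸ hfall), h.2⟩, fun h => ⟨h.1, h.2.2⟩⟩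
      · obtain ⟨u, huC, huR⟩ : ∃ u ∈ p.facet c, u ∉ p.restr c := by
          by_contra h
          push Not at h
          exact hfall (subset_antisymm (p.restr_subset c) h)
        have hlower : IsLowerSet {s | s ∈ p.core ∧ p.cls s ∈ D} := by
          rintro t s hst ⟨ht, htD⟩
          have hsD : p.cls s ∈ D := by
            by_cases h : p.cls s = p.cls t
            · rwa [h]
            · exact hdown _ htD _ (p.rank_lt t ht.1 s hst h)
          refine ⟨(p.core_eq s).2 ⟨hK hst ht.1, ?_⟩, hsD⟩
          rintro c' hc' rfl
          exact ((p.core_eq t).1 ht).2 c' hc' (p.facet_max c' t ht.1 hst)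
        -- the faces that contain `restr c` lie in the interval of `c`, since its rank is the largest
        have hcls : ∀ s, s ∈ p.core ∧ p.cls s ∈ D → p.restr c ⊆ s → p.cls s = c := by
          rintro s ⟨hs, hsD⟩ hR
          by_contra hne
          have h1 : p.cls (p.restr c) = c := (p.cls_eq_iff _ (hK hR hs.1) c).2
            ⟨subset_rfl, p.restr_subset c⟩
          have := p.rank_lt s hs.1 _ hR (by rw [h1]; exact Ne.symm hne)
          rw [h1] at this
          exact (hmax _ hsD).not_gt this
        refine hstep _ (fun s hs => hs.1.1) hlower (p.restr c) u huR ?_ ?_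
        · intro s hs hR
          have h1 := hcls s hs hR
          have h2 := (p.cls_eq_iff s hs.1.1 c).1 h1
          have h3 : insert u s ⊆ p.facet c := Finset.insert_subset huC h2.2
          have h4 : insert u s ∈ K := hK h3 (p.facet_mem c)
          have h5 : p.cls (insert u s) = c :=
            (p.cls_eq_iff _ h4 c).2 ⟨hR.trans (Finset.subset_insert _ _), h3⟩
          exact ⟨⟨h4, by rw [h5]; exact hfall⟩, by rw [h5]; exact hc⟩
        · convert ih' using 1
          ext s
          simp only [Set.mem_ofPred_eq, Finset.mem_erase]
          constructor
          · rintro ⟨⟨hs, hsD⟩, hR⟩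
            refine ⟨hs, ?_, hsD⟩
            intro he
            exact hR ((p.cls_eq_iff s hs.1 c).1 he).1
          · rintro ⟨hs, hne, hsD⟩
            exact ⟨⟨hs, hsD⟩, fun hR => hne (hcls s ⟨hs, hsD⟩ hR)⟩
  have := main _ Finset.univ rfl (fun _ _ _ _ => Finset.mem_univ _)
  simpa using this

/-- The first expansion creates a cone, and the later ones preserve the homotopy type. -/
theorem contractibleSpace_core [Fintype V] [Finite ι] (hK : IsLowerSet K)
    (hne : p.core.Nonempty) : ContractibleSpace (simplicialRealization p.core) := by
  classical
  refine p.core_induction hK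
    (fun L => L.Nonempty → ContractibleSpace (simplicialRealization L)) (by simp) ?_ hne
  intro L _ hL R u huR hu ih hLne
  rcases R.eq_empty_or_nonempty with rfl | hR
  · exact contractibleSpace_simplicialRealization_of_cone hL hLne u
      fun s hs => hu s hs (Finset.empty_subset s)
  · obtain ⟨s, hs⟩ := hLne
    have := ih ⟨∅, hL (Finset.empty_subset s) hs, by simpa using hR.ne_empty⟩
    obtain ⟨f⟩ := nonempty_homotopyEquiv_collapse hL R hR u huR hu
    exact f.contractibleSpace

/-- A complex with a partition as above has the homotopy type of a wedge of spheres, one for each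
facet that is attached along its whole boundary. -/
theorem nonempty_homotopyEquiv_wedge [Fintype V] [Finite ι] (hK : IsLowerSet K)
    (hKne : K.Nonempty) {d : ℕ} (hcard : ∀ c, (p.facet c).card = d + 1) :
    Nonempty (simplicialRealization K ≃ₕ
      Wedge (Nat.card {c // p.restr c = p.facet c}) (UnitSphere d) (UnitSphere.base d)) := by
  classical
  let f := (Finite.equivFin {c // p.restr c = p.facet c}).symm
  let F : Fin (Nat.card {c // p.restr c = p.facet c}) → Finset V := fun j => p.facet (f j)
  have hcore : p.core = K \ Set.range F := by
    ext s
    rw [p.core_eq]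
    refine and_congr_right fun _ => ⟨?_, ?_⟩
    · rintro h ⟨j, rfl⟩
      exact h _ (f j).2 rfl
    · rintro h c hc rfl
      refine h ⟨f.symm ⟨c, hc⟩, ?_⟩
      simp [F]
  have hne : p.core.Nonempty := by
    obtain ⟨s, hs⟩ := hKne
    refine ⟨∅, (p.core_eq ∅).2 ⟨hK (Finset.empty_subset s) hs, fun c _ h => ?_⟩⟩
    have := hcard c
    rw [← h] at this
    simp at this
  have := p.contractibleSpace_core hK hne
  rw [hcore] at this
  exact _root_.nonempty_homotopyEquiv_wedge F hK
    (fun i j hij => f.injective (Subtype.ext (p.facet_injective hij)))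
    (fun j => hcard _) (fun j => p.facet_mem _) (fun j => p.facet_max _)

end FacetPartition

/-! ### Reduced homology of order complexes -/

namespace OrderedChain

variable {P : Type*} [PartialOrder P] {m : ℕ}

/-- The set of elements of a chain. -/
def verts (c : OrderedChain P m) : Finset P := Finset.univ.map ⟨c.1, c.2.injective⟩

theorem mem_verts {c : OrderedChain P m} {x : P} : x ∈ c.verts ↔ ∃ i, c.1 i = x := by
  simp [verts]

theorem card_verts (c : OrderedChain P m) : c.verts.card = m := by simp [verts]

theorem isChain_verts (c : OrderedChain P m) : IsChain (· ≤ ·) (c.verts : Set P) := by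
  intro x hx y hy _
  obtain ⟨i, rfl⟩ := mem_verts.1 (Finset.mem_coe.1 hx)
  obtain ⟨j, rfl⟩ := mem_verts.1 (Finset.mem_coe.1 hy)
  exact (le_total i j).imp (fun h => c.2.monotone h) (fun h => c.2.monotone h)

theorem verts_injective : Function.Injective (verts : OrderedChain P m → Finset P) := by
  intro c c' h
  apply Subtype.ext
  refine (StrictMono.range_inj c.2 c'.2).1 ?_
  ext x
  have := congrArg (fun s => x ∈ s) h
  simpa [mem_verts] using this

theorem exists_verts_eq {s : Finset P} (hs : IsChain (· ≤ ·) (s : Set P)) (hm : s.card = m) :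
    ∃ c : OrderedChain P m, c.verts = s := by
  classical
  let _ : LinearOrder s :=
    { (inferInstance : PartialOrder s) with
      le_total := fun a b => hs.total a.2 b.2
      toDecidableLE := Classical.decRel _ }
  have f : Fin m ≃o s := Fintype.orderIsoFinOfCardEq s (by simpa using hm)
  refine ⟨⟨fun i => (f i : P), fun i j hij => f.strictMono hij⟩, ?_⟩
  ext x
  rw [mem_verts]
  constructor
  · rintro ⟨i, rfl⟩
    exact (f i).2
  · intro hx
    exact ⟨f.symm ⟨x, hx⟩, by simp⟩

theorem verts_face [DecidableEq P] (c : OrderedChain P (m + 1)) (j : Fin (m + 1)) :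
    (c.face j).verts = c.verts.erase (c.1 j) := by
  ext x
  simp only [mem_verts, Finset.mem_erase]
  constructor
  · rintro ⟨i, rfl⟩
    exact ⟨fun h => Fin.succAbove_ne j i (c.2.injective h), j.succAbove i, rfl⟩
  · rintro ⟨hne, i, rfl⟩
    obtain ⟨l, rfl⟩ := Fin.exists_succAbove_eq (show i ≠ j from fun h => hne (h ▸ rfl))
    exact ⟨l, rfl⟩

end OrderedChain

section Boundary

variable {k : Type*} [Field k] {P : Type*} [PartialOrder P] {m : ℕ}

open Classical in
theorem orderBoundary_apply (z : OrderedChain P (m + 1) →₀ k) (g : OrderedChain P m) :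
    orderBoundary k P m z g =
      z.sum fun c a => a * ∑ j : Fin (m + 1), if c.face j = g then (-1) ^ (j : ℕ) else 0 := by
  rw [orderBoundary, Finsupp.linearCombination_apply, Finsupp.sum_apply]
  refine Finsupp.sum_congr fun c _ => ?_
  simp [Finsupp.single_apply]

/-- If the link of `R` in `L` is a cone with apex `u`, every cycle of `L` is homologous to a cycle
without simplices that contain `R`. -/
theorem exists_homologous_cycle [DecidableEq P] {L : Set (Finset P)} (hL : IsLowerSet L)
    (hchain : ∀ s ∈ L, IsChain (· ≤ ·) (s : Set P)) {R : Finset P} {u : P} (huR : u ∉ R)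
    (hu : ∀ s ∈ L, R ⊆ s → insert u s ∈ L) {z : OrderedChain P m →₀ k}
    (hz : z ∈ reducedCycles k P m) (hzL : ∀ c ∈ z.support, c.verts ∈ L) :
    ∃ y : OrderedChain P (m + 1) →₀ k, z - orderBoundary k P m y ∈ reducedCycles k P m ∧
      ∀ c ∈ (z - orderBoundary k P m y).support, c.verts ∈ {s ∈ L | ¬ R ⊆ s} := by
  classical
  -- for a simplex `c` of `L` with `R ⊆ c` and `u ∉ c`, the cone `u * c`, with a suitable sign, has a
  -- boundary in which `c` is the only simplex that does not contain `u`
  have hex : ∀ c : OrderedChain P m, ∃ y : OrderedChain P (m + 1) →₀ k,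
      c.verts ∈ L → R ⊆ c.verts → u ∉ c.verts →
        (∀ g : OrderedChain P m, u ∉ g.verts →
          orderBoundary k P m y g = if g = c then 1 else 0) ∧
        ∀ g ∈ (orderBoundary k P m y).support, g.verts ∈ L := by
    intro c
    by_cases h : c.verts ∈ L ∧ R ⊆ c.verts ∧ u ∉ c.verts
    · obtain ⟨h1, h2, h3⟩ := h
      obtain ⟨x, hx⟩ := OrderedChain.exists_verts_eq (m := m + 1) (hchain _ (hu _ h1 h2)) (by
        rw [Finset.card_insert_of_notMem h3, c.card_verts])
      obtain ⟨j, hj⟩ := OrderedChain.mem_verts.1 (hx ▸ Finset.mem_insert_self u c.verts)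
      have hface : x.face j = c := OrderedChain.verts_injective (by
        rw [OrderedChain.verts_face, hj, hx, Finset.erase_insert h3])
      refine ⟨Finsupp.single x ((-1) ^ (j : ℕ)), fun _ _ _ => ⟨fun g hg => ?_, fun g hg => ?_⟩⟩
      · rw [orderBoundary_apply, Finsupp.sum_single_index (by simp), Finset.sum_eq_single j]
        · rw [hface]
          simp only [eq_comm (a := c)]
          split_ifs
          · rw [← mul_pow]; simp
          · simp
        · intro i _ hij
          rw [if_neg]
          rintro rfl
          apply hg
          rw [OrderedChain.verts_face, hx, Finset.mem_erase]
          exact ⟨fun h => hij (x.2.injective (h.symm.trans hj.symm)), Finset.mem_insert_self _ _⟩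
        · simp
      · rw [Finsupp.mem_support_iff, orderBoundary_apply, Finsupp.sum_single_index (by simp)] at hg
        obtain ⟨i, -, hi⟩ := Finset.exists_ne_zero_of_sum_ne_zero (right_ne_zero_of_mul hg)
        have hi' : x.face i = g := by
          by_contra h
          exact hi (if_neg h)
        rw [← hi', OrderedChain.verts_face, hx]
        exact hL (Finset.erase_subset _ _) (hu _ h1 h2)
    · exact ⟨0, fun h1 h2 h3 => (h ⟨h1, h2, h3⟩).elim⟩
  choose y hy using hex
  let B := z.support.filter fun c => R ⊆ c.verts ∧ u ∉ c.verts
  have hB : ∀ c ∈ B, (∀ g : OrderedChain P m, u ∉ g.verts →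
          orderBoundary k P m (y c) g = if g = c then 1 else 0) ∧
        ∀ g ∈ (orderBoundary k P m (y c)).support, g.verts ∈ L := by
    intro c hc
    rw [Finset.mem_filter] at hc
    exact hy c (hzL c hc.1) hc.2.1 hc.2.2
  -- subtracting these boundaries leaves no simplex with `R` but without `u`
  let Y : OrderedChain P (m + 1) →₀ k := ∑ c ∈ B, z c • y c
  have hYapp : ∀ g, orderBoundary k P m Y g = ∑ c ∈ B, z c * orderBoundary k P m (y c) g := by
    intro g
    simp [Y, map_sum, Finsupp.finsetSum_apply]
  have hYu : ∀ g : OrderedChain P m, R ⊆ g.verts → u ∉ g.verts →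
      (z - orderBoundary k P m Y) g = 0 := by
    intro g hR hg
    rw [Finsupp.sub_apply, hYapp, Finset.sum_congr rfl fun c hc => by rw [(hB c hc).1 g hg]]
    simp only [mul_ite, mul_one, mul_zero, Finset.sum_ite_eq]
    split_ifs with h
    · simp
    · have : z g = 0 := by
        by_contra h0
        exact h (Finset.mem_filter.2 ⟨Finsupp.mem_support_iff.2 h0, hR, hg⟩)
      simp [this]
  have hsupp : ∀ g ∈ (z - orderBoundary k P m Y).support, g.verts ∈ L := by
    intro g hg
    by_contra hgL
    rw [Finsupp.mem_support_iff, Finsupp.sub_apply] at hg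
    apply hg
    have h1 : z g = 0 := by
      by_contra h0
      exact hgL (hzL g (Finsupp.mem_support_iff.2 h0))
    have h2 : orderBoundary k P m Y g = 0 := by
      rw [hYapp]
      refine Finset.sum_eq_zero fun c hc => ?_
      have : orderBoundary k P m (y c) g = 0 := by
        by_contra h0
        exact hgL ((hB c hc).2 g (Finsupp.mem_support_iff.2 h0))
      rw [this, mul_zero]
    rw [h1, h2, sub_zero]
  have hcycle : z - orderBoundary k P m Y ∈ reducedCycles k P m := by
    refine Submodule.sub_mem _ hz ?_
    cases m with
    | zero => exact Submodule.mem_top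
    | succ m =>
      exact LinearMap.congr_fun (orderBoundary_comp_orderBoundary k P m) Y
  refine ⟨Y, hcycle, fun g hg => ⟨hsupp g hg, fun hR => ?_⟩⟩
  have hug : u ∈ g.verts := by
    by_contra h
    exact Finsupp.mem_support_iff.1 hg (hYu g hR h)
  -- The coefficient at `g` is, up to sign, the coefficient of the boundary at `g` without `u`.
  generalize z - orderBoundary k P m Y = z' at *
  obtain ⟨j, hj⟩ := OrderedChain.mem_verts.1 hug
  cases m with
  | zero => exact j.elim0
  | succ m =>
    have h0 : orderBoundary k P m z' (g.face j) = 0 := by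
      have : orderBoundary k P m z' = 0 := hcycle
      rw [this]; rfl
    have hins : insert u (g.face j).verts = g.verts := by
      rw [OrderedChain.verts_face, hj, Finset.insert_erase hug]
    rw [orderBoundary_apply, Finsupp.sum, Finset.sum_eq_single g, Finset.sum_eq_single j] at h0
    · simp only [if_true, mul_eq_zero, pow_eq_zero_iff', neg_eq_zero, one_ne_zero, false_and,
        or_false] at h0
      exact Finsupp.mem_support_iff.1 hg h0
    · intro i _ hij
      rw [if_neg]
      intro h
      have h1 := congrArg OrderedChain.verts h
      rw [OrderedChain.verts_face, OrderedChain.verts_face] at h1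
      have : g.1 i ∈ g.verts.erase (g.1 j) :=
        Finset.mem_erase.2 ⟨fun h => hij (g.2.injective h), OrderedChain.mem_verts.2 ⟨i, rfl⟩⟩
      rw [← h1] at this
      exact Finset.notMem_erase _ _ this
    · simp
    · intro c hc hcg
      refine mul_eq_zero_of_right _ (Finset.sum_eq_zero fun i _ => if_neg fun h => hcg ?_)
      have hsub : (g.face j).verts ⊆ c.verts := by
        rw [← h, OrderedChain.verts_face]
        exact Finset.erase_subset _ _
      have hRc : R ⊆ c.verts := by
        refine subset_trans ?_ hsub
        rw [OrderedChain.verts_face, hj]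
        exact Finset.subset_erase.2 ⟨hR, huR⟩
      have huc : u ∈ c.verts := by
        by_contra hu'
        exact Finsupp.mem_support_iff.1 hc (hYu c hRc hu')
      apply OrderedChain.verts_injective
      refine (Finset.eq_of_subset_of_card_le ?_ ?_).symm
      · rw [← hins]
        exact Finset.insert_subset huc hsub
      · rw [c.card_verts, g.card_verts]
    · exact fun h => (h hg).elim

theorem subsingleton_reducedHomology
    (h : ∀ z ∈ reducedCycles k P m, z ∈ LinearMap.range (orderBoundary k P m)) :
    Subsingleton (ReducedHomology k P m) := by
  rw [Submodule.subsingleton_iff_eq_bot, eq_bot_iff]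
  rintro _ ⟨z, hz, rfl⟩
  exact (Submodule.Quotient.mk_eq_zero _).2 (h z hz)

/-- The case `R = ∅` of `exists_homologous_cycle`: every cycle of a cone is homologous to zero. -/
theorem subsingleton_reducedHomology_of_cone [DecidableEq P] (u : P) (hu : ∀ x : P, u ≤ x ∨ x ≤ u) :
    Subsingleton (ReducedHomology k P m) := by
  refine subsingleton_reducedHomology fun z hz => ?_
  obtain ⟨y, -, hy⟩ := exists_homologous_cycle (L := orderFaces P)
    (isLowerSet_orderFaces P) (fun s hs => hs) (Finset.notMem_empty u)
    (fun s hs _ => by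
      rw [mem_orderFaces, Finset.coe_insert]
      exact IsChain.insert hs fun b _ _ => hu b) hz (fun c _ => c.isChain_verts)
  refine ⟨y, (sub_eq_zero.1 ?_).symm⟩
  ext c
  by_contra h
  exact (hy c (Finsupp.mem_support_iff.2 h)).2 (Finset.empty_subset _)

/-- A partition into intervals as above concentrates the homology of an order complex in the
dimension of its facets. -/
theorem FacetPartition.subsingleton_reducedHomology {ι : Type*} [Finite ι]
    (p : FacetPartition (orderFaces P) ι) {d : ℕ}
    (hcard : ∀ c, (p.facet c).card = d) (hmd : m ≠ d) : Subsingleton (ReducedHomology k P m) := by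
  classical
  refine _root_.subsingleton_reducedHomology fun z hz => ?_
  refine p.core_induction (isLowerSet_orderFaces P)
    (fun L => ∀ z ∈ reducedCycles k P m, (∀ c ∈ z.support, c.verts ∈ L) →
      z ∈ LinearMap.range (orderBoundary k P m)) ?_ ?_ z hz ?_
  · intro z _ h
    have : z = 0 := by
      ext c
      by_contra h0
      exact h c (Finsupp.mem_support_iff.2 h0)
    rw [this]
    exact Submodule.zero_mem _
  · intro L hLK hL R u huR hu ih z hz hzL
    obtain ⟨y, hy1, hy2⟩ := exists_homologous_cycle hL (fun s hs => hLK hs) huR hu hz hzL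
    have := Submodule.add_mem _ (ih _ hy1 hy2) (LinearMap.mem_range_self (orderBoundary k P m) y)
    simpa using this
  · intro c _
    refine (p.core_eq _).2 ⟨c.isChain_verts, fun a _ h => hmd ?_⟩
    rw [← c.card_verts, h, hcard]

end Boundary

/-! ### Permutations and chains of sets -/

section Flags

variable {n : ℕ}

/-- The set of the first `i` values of the permutation `σ`. -/
def initialSet (σ : Equiv.Perm (Fin n)) (i : ℕ) : Finset (Fin n) :=
  Finset.univ.filter fun a => (σ.symm a : ℕ) < i

@[simp]
theorem mem_initialSet {σ : Equiv.Perm (Fin n)} {i : ℕ} {a : Fin n} :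
    a ∈ initialSet σ i ↔ (σ.symm a : ℕ) < i := by simp [initialSet]

theorem card_initialSet (σ : Equiv.Perm (Fin n)) {i : ℕ} (hi : i ≤ n) :
    (initialSet σ i).card = i := by
  have : initialSet σ i = (Finset.univ.filter fun a : Fin n => (a : ℕ) < i).map σ.toEmbedding := by
    ext a
    simp only [mem_initialSet, Finset.mem_map_equiv, Finset.mem_filter, Finset.mem_univ, true_and]
  rw [this, Finset.card_map, Fin.card_filter_val_lt, min_eq_right hi]

theorem initialSet_mono (σ : Equiv.Perm (Fin n)) : Monotone (initialSet σ) := by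
  intro i j hij a ha
  rw [mem_initialSet] at ha ⊢
  omega

theorem eq_initialSet_card {σ : Equiv.Perm (Fin n)} {S : Finset (Fin n)}
    (h : ∀ a ∈ S, ∀ b ∉ S, σ.symm a < σ.symm b) : S = initialSet σ S.card := by
  refine Finset.eq_of_subset_of_card_le (fun a ha => ?_) ?_
  · have hsub : initialSet σ (σ.symm a + 1) ⊆ S := by
      intro b hb
      by_contra hbS
      have h1 := h a ha b hbS
      rw [mem_initialSet] at hb
      rw [Fin.lt_def] at h1
      omega
    have := Finset.card_le_card hsub
    rw [card_initialSet σ (by omega)] at this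
    rw [mem_initialSet]
    omega
  · rw [card_initialSet σ]
    simpa using Finset.card_le_univ S

variable {κ : Type*}

/-- The number of sets of a family that do not contain `a`. -/
def missCount (G : Finset κ) (f : κ → Finset (Fin n)) (a : Fin n) : ℕ :=
  (G.filter fun g => a ∉ f g).card

/-- The permutation that lists the elements in the order in which the sets of a chain acquire them,
and in increasing order where the chain does not decide. -/
def sortPerm (G : Finset κ) (f : κ → Finset (Fin n)) : Equiv.Perm (Fin n) :=
  Tuple.sort (missCount G f)

variable {G : Finset κ} {f : κ → Finset (Fin n)}

theorem missCount_lt_of_mem (hG : ∀ g ∈ G, ∀ h ∈ G, f g ⊆ f h ∨ f h ⊆ f g) {g : κ} (hg : g ∈ G)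
    {a b : Fin n} (ha : a ∈ f g) (hb : b ∉ f g) : missCount G f a < missCount G f b := by
  refine Finset.card_lt_card ⟨fun h hh => ?_, fun hsub => ?_⟩
  · rw [Finset.mem_filter] at hh ⊢
    refine ⟨hh.1, fun hbh => ?_⟩
    rcases hG g hg h hh.1 with h1 | h1
    · exact hh.2 (h1 ha)
    · exact hb (h1 hbh)
  · have := hsub (Finset.mem_filter.2 ⟨hg, hb⟩)
    exact (Finset.mem_filter.1 this).2 ha

theorem sortPerm_symm_lt_of_mem (hG : ∀ g ∈ G, ∀ h ∈ G, f g ⊆ f h ∨ f h ⊆ f g) {g : κ}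
    (hg : g ∈ G) {a b : Fin n} (ha : a ∈ f g) (hb : b ∉ f g) :
    (sortPerm G f).symm a < (sortPerm G f).symm b := by
  by_contra h
  have h1 := Tuple.monotone_sort (missCount G f) (not_lt.1 h)
  have h2 := missCount_lt_of_mem hG hg ha hb
  have h3 : ∀ c, (missCount G f ∘ Tuple.sort (missCount G f)) ((sortPerm G f).symm c) =
      missCount G f c := fun c => by simp [sortPerm]
  rw [h3, h3] at h1
  omega

theorem eq_initialSet_sortPerm (hG : ∀ g ∈ G, ∀ h ∈ G, f g ⊆ f h ∨ f h ⊆ f g) {g : κ}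
    (hg : g ∈ G) : f g = initialSet (sortPerm G f) (f g).card :=
  eq_initialSet_card fun _ ha _ hb => sortPerm_symm_lt_of_mem hG hg ha hb

/-- An inversion of `sortPerm` is forced by some set of the family. -/
theorem exists_of_sortPerm_inversion {i j : Fin n} (hij : i < j)
    (h : sortPerm G f j < sortPerm G f i) :
    ∃ g ∈ G, sortPerm G f i ∈ f g ∧ sortPerm G f j ∉ f g := by
  have hs := (Tuple.eq_sort_iff (f := missCount G f) (σ := sortPerm G f)).1 rfl
  have h1 : missCount G f (sortPerm G f i) ≤ missCount G f (sortPerm G f j) := hs.1 hij.le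
  have h2 : missCount G f (sortPerm G f i) ≠ missCount G f (sortPerm G f j) := fun he =>
    (hs.2 i j hij he).not_gt h
  by_contra hcon
  push Not at hcon
  have : missCount G f (sortPerm G f j) ≤ missCount G f (sortPerm G f i) := by
    refine Finset.card_le_card fun g hg => ?_
    rw [Finset.mem_filter] at hg ⊢
    exact ⟨hg.1, fun h' => hg.2 (hcon g hg.1 h')⟩
  omega

/-- `sortPerm` is the only permutation that refines a chain of sets and has descents only at the
sizes of the sets. -/
theorem eq_sortPerm_iff (hG : ∀ g ∈ G, ∀ h ∈ G, f g ⊆ f h ∨ f h ⊆ f g)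
    (σ : Equiv.Perm (Fin n)) : sortPerm G f = σ ↔ (∀ g ∈ G, f g = initialSet σ (f g).card) ∧
      ∀ i j : Fin n, (j : ℕ) = i + 1 → σ j < σ i → ∃ g ∈ G, (f g).card = j := by
  constructor
  · rintro rfl
    refine ⟨fun g hg => eq_initialSet_sortPerm hG hg, fun i j hij h => ?_⟩
    obtain ⟨g, hg, h1, h2⟩ := exists_of_sortPerm_inversion (Fin.lt_def.2 (by omega)) h
    rw [eq_initialSet_sortPerm hG hg, mem_initialSet] at h1 h2
    simp only [Equiv.symm_apply_apply] at h1 h2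
    exact ⟨g, hg, by omega⟩
  · rintro ⟨h1, h2⟩
    have hmem : ∀ g ∈ G, ∀ i, σ i ∈ f g ↔ (i : ℕ) < (f g).card := by
      intro g hg i
      conv_lhs => rw [h1 g hg]
      simp
    refine (Tuple.eq_sort_iff.2 ⟨fun i j hij => ?_, fun i j hij he => ?_⟩).symm
    · refine Finset.card_le_card fun g hg => ?_
      rw [Finset.mem_filter] at hg ⊢
      refine ⟨hg.1, ?_⟩
      have := hg.2
      rw [hmem g hg.1] at this ⊢
      rw [Fin.le_def] at hij
      omega
    · have hno : ∀ g ∈ G, ¬ ((i : ℕ) < (f g).card ∧ (f g).card ≤ j) := by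
        rintro g hg ⟨h3, h4⟩
        have := missCount_lt_of_mem hG hg ((hmem g hg i).2 h3)
          (mt (hmem g hg j).1 (not_lt.2 h4))
        omega
      -- without a set of the chain of size in `(i, j]`, there are no descents from `i` to `j`
      have key : ∀ l : ℕ, (i : ℕ) + 1 ≤ l → ∀ hl : l ≤ j, σ i < σ ⟨l, by omega⟩ := by
        intro l hl
        induction l, hl using Nat.le_induction with
        | base =>
          intro hl
          refine lt_of_le_of_ne (not_lt.1 fun h => ?_) fun h => ?_
          · obtain ⟨g, hg, hgc⟩ := h2 i ⟨i + 1, by omega⟩ rfl h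
            exact hno g hg ⟨by rw [hgc]; simp, by rw [hgc]; exact hl⟩
          · have := σ.injective h
            simp [Fin.ext_iff] at this
        | succ l hl ih =>
          intro hl'
          refine (ih (by omega)).trans (lt_of_le_of_ne (not_lt.1 fun h => ?_) fun h => ?_)
          · obtain ⟨g, hg, hgc⟩ := h2 ⟨l, by omega⟩ ⟨l + 1, by omega⟩ rfl h
            exact hno g hg ⟨by rw [hgc]; simp; omega, by rw [hgc]; exact hl'⟩
          · have := σ.injective h
            simp [Fin.ext_iff] at this
      exact key j (by rw [Fin.lt_def] at hij; omega) le_rfl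

/-- The inversions of a permutation, as pairs of values. -/
def inversionSet (σ : Equiv.Perm (Fin n)) : Finset (Fin n × Fin n) :=
  Finset.univ.filter fun x => x.1 < x.2 ∧ σ.symm x.2 < σ.symm x.1

/-- The inversions determine the order in which a permutation lists its values. -/
theorem inversionSet_injective : Function.Injective (inversionSet (n := n)) := by
  intro σ τ h
  have key : ∀ a b, σ.symm a < σ.symm b → τ.symm a < τ.symm b := by
    intro a b hab
    have hne : a ≠ b := by rintro rfl; exact lt_irrefl _ hab
    have hiff : ∀ x : Fin n × Fin n, x ∈ inversionSet σ ↔ x ∈ inversionSet τ := by simp [h]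
    simp only [inversionSet, Finset.mem_filter, Finset.mem_univ, true_and] at hiff
    rcases lt_or_gt_of_ne hne with h1 | h1
    · by_contra h2
      have h3 : τ.symm b < τ.symm a := lt_of_le_of_ne (not_lt.1 h2) fun h => hne
        (τ.symm.injective h).symm
      exact ((hiff (a, b)).2 ⟨h1, h3⟩).2.not_gt hab
    · exact ((hiff (b, a)).1 ⟨h1, hab⟩).2
  have hmono : Monotone (σ.trans τ.symm) := by
    refine StrictMono.monotone fun i j hij => ?_
    exact key _ _ (by simpa using hij)
  rw [Equiv.Perm.monotone_iff] at hmono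
  ext i
  have := congrArg (fun ρ : Equiv.Perm (Fin n) => τ (ρ i)) hmono
  simp at this
  rw [this]

theorem mem_inversionSet_sortPerm (hG : ∀ g ∈ G, ∀ h ∈ G, f g ⊆ f h ∨ f h ⊆ f g)
    {a b : Fin n} : (a, b) ∈ inversionSet (sortPerm G f) ↔
      a < b ∧ ∃ g ∈ G, b ∈ f g ∧ a ∉ f g := by
  simp only [inversionSet, Finset.mem_filter, Finset.mem_univ, true_and]
  refine and_congr_right fun hab => ⟨fun h => ?_, ?_⟩
  · obtain ⟨g, hg, h1, h2⟩ := exists_of_sortPerm_inversion (G := G) (f := f) h (by simpa using hab)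
    exact ⟨g, hg, by simpa using h1, by simpa using h2⟩
  · rintro ⟨g, hg, h1, h2⟩
    exact sortPerm_symm_lt_of_mem hG hg h1 h2

/-- A larger chain of sets forces more inversions. -/
theorem inversionSet_sortPerm_mono {G' : Finset κ}
    (hG' : ∀ g ∈ G', ∀ h ∈ G', f g ⊆ f h ∨ f h ⊆ f g) (hsub : G ⊆ G') :
    inversionSet (sortPerm G f) ⊆ inversionSet (sortPerm G' f) := by
  rintro ⟨a, b⟩ h
  rw [mem_inversionSet_sortPerm fun g hg h hh => hG' g (hsub hg) h (hsub hh)] at h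
  rw [mem_inversionSet_sortPerm hG']
  obtain ⟨h1, g, hg, h2⟩ := h
  exact ⟨h1, g, hsub hg, h2⟩

end Flags

/-! ### The proper part of the poset of minors -/

namespace Minor

variable {n : ℕ}

/-- The number of rows of a minor. -/
def size (x : Minor n) : ℕ := x.1.1.card

theorem card_snd (x : Minor n) : x.1.2.card = x.size := x.2.symm

theorem eq_of_le_of_size_le {x y : Minor n} (h : x ≤ y) (hs : y.size ≤ x.size) : x = y :=
  Subtype.ext (Prod.ext (Finset.eq_of_subset_of_card_le h.1 hs)
    (Finset.eq_of_subset_of_card_le h.2 (by rw [card_snd, card_snd]; exact hs)))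

theorem size_mono : Monotone (size (n := n)) := fun _ _ h => Finset.card_le_card h.1

theorem size_strictMono : StrictMono (size (n := n)) := fun _ _ h =>
  lt_of_le_of_ne (size_mono h.le) fun he => h.ne (eq_of_le_of_size_le h.le he.ge)

@[simp] theorem size_bot : (⊥ : Minor n).size = 0 := rfl

@[simp] theorem size_top : (⊤ : Minor n).size = n := Finset.card_fin n

/-- The minor on the first `i` values of each of two permutations. -/
def initial (σ τ : Equiv.Perm (Fin n)) (i : ℕ) (hi : i ≤ n) : Minor n :=
  ⟨(initialSet σ i, initialSet τ i), by rw [card_initialSet σ hi, card_initialSet τ hi]⟩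

@[simp]
theorem size_initial (σ τ : Equiv.Perm (Fin n)) (i : ℕ) (hi : i ≤ n) :
    (initial σ τ i hi).size = i := card_initialSet σ hi

/-- The minor `x` belongs to the maximal chain given by the two permutations. -/
def IsInitial (c : Equiv.Perm (Fin n) × Equiv.Perm (Fin n)) (x : Minor n) : Prop :=
  x.1.1 = initialSet c.1 x.size ∧ x.1.2 = initialSet c.2 x.size

theorem isInitial_initial (c : Equiv.Perm (Fin n) × Equiv.Perm (Fin n)) (i : ℕ) (hi : i ≤ n) :
    IsInitial c (initial c.1 c.2 i hi) := by
  rw [IsInitial, size_initial]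
  exact ⟨rfl, rfl⟩

theorem IsInitial.le {c : Equiv.Perm (Fin n) × Equiv.Perm (Fin n)} {x y : Minor n}
    (hx : IsInitial c x) (hy : IsInitial c y) (h : x.size ≤ y.size) : x ≤ y := by
  refine ⟨?_, ?_⟩
  · rw [hx.1, hy.1]
    exact initialSet_mono c.1 h
  · rw [hx.2, hy.2]
    exact initialSet_mono c.2 h

theorem IsInitial.eq {c : Equiv.Perm (Fin n) × Equiv.Perm (Fin n)} {x y : Minor n}
    (hx : IsInitial c x) (hy : IsInitial c y) (h : x.size = y.size) : x = y :=
  le_antisymm (hx.le hy h.le) (hy.le hx h.ge)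

theorem comparable_fst {s : Set (Minor n)} (hs : IsChain (· ≤ ·) s) {g h : Minor n}
    (hg : g ∈ s) (hh : h ∈ s) : g.1.1 ⊆ h.1.1 ∨ h.1.1 ⊆ g.1.1 :=
  (hs.total hg hh).imp (fun h => h.1) (fun h => h.1)

theorem comparable_snd {s : Set (Minor n)} (hs : IsChain (· ≤ ·) s) {g h : Minor n}
    (hg : g ∈ s) (hh : h ∈ s) : g.1.2 ⊆ h.1.2 ∨ h.1.2 ⊆ g.1.2 :=
  (hs.total hg hh).imp (fun h => h.2) (fun h => h.2)

theorem bot_lt_iff {x : Minor n} : ⊥ < x ↔ 0 < x.size := by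
  refine ⟨fun h => by simpa using size_strictMono h, fun h => bot_lt_iff_ne_bot.2 ?_⟩
  rintro rfl
  simp at h

theorem lt_top_iff {x : Minor n} : x < ⊤ ↔ x.size < n := by
  refine ⟨fun h => by simpa using size_strictMono h, fun h => lt_top_iff_ne_top.2 ?_⟩
  rintro rfl
  simp at h

/-- The elements of a maximal chain of the proper part. -/
def properInitial (c : Equiv.Perm (Fin n) × Equiv.Perm (Fin n)) (i : ℕ) (h0 : 0 < i) (hn : i < n) :
    Set.Ioo (⊥ : Minor n) ⊤ :=
  ⟨initial c.1 c.2 i hn.le, bot_lt_iff.2 (by rwa [size_initial]),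
    lt_top_iff.2 (by rwa [size_initial])⟩

theorem size_properInitial (c : Equiv.Perm (Fin n) × Equiv.Perm (Fin n)) (i : ℕ) (h0 : 0 < i)
    (hn : i < n) : (properInitial c i h0 hn).1.size = i := size_initial _ _ i hn.le

theorem isInitial_properInitial (c : Equiv.Perm (Fin n) × Equiv.Perm (Fin n)) (i : ℕ) (h0 : 0 < i)
    (hn : i < n) : IsInitial c (properInitial c i h0 hn).1 := isInitial_initial c i hn.le

open Classical in
/-- The maximal chain of the proper part given by two permutations. -/
noncomputable def facet (c : Equiv.Perm (Fin n) × Equiv.Perm (Fin n)) : Finset (Set.Ioo (⊥ : Minor n) ⊤) :=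
  Finset.univ.filter fun x => IsInitial c x.1

open Classical in
/-- The elements of a maximal chain at which there is no common ascent. Positions are counted from `0`,
so that the element of size `j` separates the positions `j - 1` and `j`. -/
noncomputable def restr (c : Equiv.Perm (Fin n) × Equiv.Perm (Fin n)) : Finset (Set.Ioo (⊥ : Minor n) ⊤) :=
  Finset.univ.filter fun x => IsInitial c x.1 ∧
    ∃ i j : Fin n, (j : ℕ) = i + 1 ∧ x.1.size = j ∧ ¬ (c.1 i < c.1 j ∧ c.2 i < c.2 j)

theorem mem_facet {c : Equiv.Perm (Fin n) × Equiv.Perm (Fin n)} {x : Set.Ioo (⊥ : Minor n) ⊤} :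
    x ∈ facet c ↔ IsInitial c x.1 := by simp [facet]

theorem mem_restr {c : Equiv.Perm (Fin n) × Equiv.Perm (Fin n)} {x : Set.Ioo (⊥ : Minor n) ⊤} :
    x ∈ restr c ↔ IsInitial c x.1 ∧ ∃ i j : Fin n, (j : ℕ) = i + 1 ∧ x.1.size = j ∧
      ¬ (c.1 i < c.1 j ∧ c.2 i < c.2 j) := by simp [restr]

theorem properInitial_mem_facet (c : Equiv.Perm (Fin n) × Equiv.Perm (Fin n)) (i : ℕ) (h0 : 0 < i)
    (hn : i < n) : properInitial c i h0 hn ∈ facet c := mem_facet.2 (isInitial_initial c i hn.le)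

theorem facet_mem (c : Equiv.Perm (Fin n) × Equiv.Perm (Fin n)) :
    facet c ∈ orderFaces (Set.Ioo (⊥ : Minor n) ⊤) := by
  intro x hx y hy _
  rw [Finset.mem_coe, mem_facet] at hx hy
  exact (le_total x.1.size y.1.size).imp (fun h => IsInitial.le hx hy h)
    (fun h => IsInitial.le hy hx h)

theorem facet_max (c : Equiv.Perm (Fin n) × Equiv.Perm (Fin n)) :
    ∀ s ∈ orderFaces (Set.Ioo (⊥ : Minor n) ⊤), facet c ⊆ s → s = facet c := by
  intro s hs hcs
  refine subset_antisymm (fun x hx => ?_) hcs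
  have h1 := bot_lt_iff.1 x.2.1
  have h2 := lt_top_iff.1 x.2.2
  have hys := size_properInitial c x.1.size h1 h2
  have hy := properInitial_mem_facet c x.1.size h1 h2
  have hxy : x = properInitial c x.1.size h1 h2 := by
    rcases IsChain.total hs (Finset.mem_coe.2 hx) (Finset.mem_coe.2 (hcs hy)) with h | h
    · exact Subtype.ext (eq_of_le_of_size_le h hys.le)
    · exact Subtype.ext (eq_of_le_of_size_le h hys.ge).symm
  rw [hxy]
  exact hy

/-- A chain of minors is sorted into the pair `c` exactly if it lies between the restriction and the
facet of `c`: the chains of row sets and of column sets are refined by the permutations, and every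
descent of one of them occurs at the size of some minor of the chain. -/
theorem sortPerm_eq_iff {s : Finset (Set.Ioo (⊥ : Minor n) ⊤)}
    (hs : s ∈ orderFaces (Set.Ioo (⊥ : Minor n) ⊤))
    (c : Equiv.Perm (Fin n) × Equiv.Perm (Fin n)) :
    (sortPerm s fun x => x.1.1.1, sortPerm s fun x => x.1.1.2) = c ↔
      restr c ⊆ s ∧ s ⊆ facet c := by
  have hc1 : ∀ g ∈ s, ∀ h ∈ s, g.1.1.1 ⊆ h.1.1.1 ∨ h.1.1.1 ⊆ g.1.1.1 := fun g hg h hh =>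
    (IsChain.total hs hg hh).imp (fun h => h.1) (fun h => h.1)
  have hc2 : ∀ g ∈ s, ∀ h ∈ s, g.1.1.2 ⊆ h.1.1.2 ∨ h.1.1.2 ⊆ g.1.1.2 := fun g hg h hh =>
    (IsChain.total hs hg hh).imp (fun h => h.2) (fun h => h.2)
  rw [Prod.ext_iff, eq_sortPerm_iff hc1, eq_sortPerm_iff hc2]
  constructor
  · rintro ⟨⟨h1, h2⟩, h3, h4⟩
    have hsub : s ⊆ facet c := by
      intro x hx
      rw [mem_facet]
      refine ⟨h1 x hx, ?_⟩
      rw [← card_snd]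
      exact h3 x hx
    refine ⟨fun x hx => ?_, hsub⟩
    obtain ⟨hx, i, j, hij, hxj, hnot⟩ := mem_restr.1 hx
    have hne : i ≠ j := fun h => by rw [h] at hij; omega
    obtain ⟨g, hg, hgc⟩ : ∃ g ∈ s, g.1.size = j := by
      rw [not_and_or, not_lt, not_lt] at hnot
      rcases hnot with h | h
      · exact h2 i j hij (lt_of_le_of_ne h fun h => hne (c.1.injective h).symm)
      · obtain ⟨g, hg, hgc⟩ := h4 i j hij (lt_of_le_of_ne h fun h => hne (c.2.injective h).symm)
        exact ⟨g, hg, by rw [← card_snd]; exact hgc⟩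
    have : g = x := Subtype.ext
      (IsInitial.eq (mem_facet.1 (hsub hg)) hx (hgc.trans hxj.symm))
    exact this ▸ hg
  · rintro ⟨hR, hsub⟩
    have hmem : ∀ i j : Fin n, (j : ℕ) = i + 1 → ¬ (c.1 i < c.1 j ∧ c.2 i < c.2 j) →
        ∃ g ∈ s, g.1.size = j := by
      intro i j hij hnot
      refine ⟨properInitial c j (by omega) j.2, hR ?_, size_properInitial _ _ _ _⟩
      exact mem_restr.2 ⟨isInitial_properInitial c _ _ _, i, j, hij,
        size_properInitial _ _ _ _, hnot⟩
    have hin : ∀ g ∈ s, IsInitial c g.1 := fun g hg => mem_facet.1 (hsub hg)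
    refine ⟨⟨fun g hg => (hin g hg).1, fun i j hij h => ?_⟩, fun g hg => ?_, fun i j hij h => ?_⟩
    · obtain ⟨g, hg, hgc⟩ := hmem i j hij fun h' => h'.1.not_gt h
      exact ⟨g, hg, hgc⟩
    · rw [card_snd]
      exact (hin g hg).2
    · obtain ⟨g, hg, hgc⟩ := hmem i j hij fun h' => h'.2.not_gt h
      exact ⟨g, hg, by rw [card_snd]; exact hgc⟩

/-- The shelling of the proper part of the poset of minors: facets are pairs of permutations, a chain
belongs to the first facet containing it, and the number of inversions orders the facets. -/
noncomputable def properPartition (n : ℕ) :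
    FacetPartition (orderFaces (Set.Ioo (⊥ : Minor n) ⊤))
      (Equiv.Perm (Fin n) × Equiv.Perm (Fin n)) where
  facet := facet
  restr := restr
  cls s := (sortPerm s fun x => x.1.1.1, sortPerm s fun x => x.1.1.2)
  rank c := (inversionSet c.1).card + (inversionSet c.2).card
  facet_mem := facet_mem
  facet_max := facet_max
  restr_subset c x hx := mem_facet.2 (mem_restr.1 hx).1
  cls_eq_iff s hs c := sortPerm_eq_iff hs c
  rank_lt t ht s hst hne := by
    have hc1 : ∀ g ∈ t, ∀ h ∈ t, g.1.1.1 ⊆ h.1.1.1 ∨ h.1.1.1 ⊆ g.1.1.1 := fun g hg h hh =>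
      (IsChain.total ht hg hh).imp (fun h => h.1) (fun h => h.1)
    have hc2 : ∀ g ∈ t, ∀ h ∈ t, g.1.1.2 ⊆ h.1.1.2 ∨ h.1.1.2 ⊆ g.1.1.2 := fun g hg h hh =>
      (IsChain.total ht hg hh).imp (fun h => h.2) (fun h => h.2)
    have h1 := inversionSet_sortPerm_mono hc1 hst
    have h2 := inversionSet_sortPerm_mono hc2 hst
    by_contra hlt
    have h3 := Finset.card_le_card h1
    have h4 := Finset.card_le_card h2
    refine hne (Prod.ext (inversionSet_injective (Finset.eq_of_subset_of_card_le h1 ?_))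
      (inversionSet_injective (Finset.eq_of_subset_of_card_le h2 ?_)))
    · dsimp only at hlt ⊢; omega
    · dsimp only at hlt ⊢; omega

theorem card_facet (c : Equiv.Perm (Fin n) × Equiv.Perm (Fin n)) : (facet c).card = n - 1 := by
  have : (Finset.Ioo 0 n).card = n - 1 := by simp
  rw [← this]
  refine Finset.card_nbij (fun x => x.1.size) ?_ ?_ ?_
  · intro x _
    rw [Finset.mem_coe, Finset.mem_Ioo]
    exact ⟨bot_lt_iff.1 x.2.1, lt_top_iff.1 x.2.2⟩
  · intro x hx y hy h
    exact Subtype.ext (IsInitial.eq (mem_facet.1 hx) (mem_facet.1 hy) h)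
  · intro i hi
    rw [Finset.mem_coe, Finset.mem_Ioo] at hi
    exact ⟨properInitial c i hi.1 hi.2, properInitial_mem_facet c _ _ _, size_properInitial _ _ _ _⟩

/-- The facets attached along their whole boundary are the pairs without common ascent. -/
theorem restr_eq_facet_iff (c : Equiv.Perm (Fin n) × Equiv.Perm (Fin n)) :
    restr c = facet c ↔ NoCommonAscent c.1 c.2 := by
  constructor
  · intro h i j hij
    have hx := properInitial_mem_facet c j (by omega) j.2
    rw [← h] at hx
    obtain ⟨-, i', j', hij', hj', hnot⟩ := mem_restr.1 hx
    obtain rfl : j = j' := Fin.ext ((size_properInitial _ _ _ _).symm.trans hj')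
    obtain rfl : i = i' := Fin.ext (by omega)
    exact hnot
  · intro h
    refine subset_antisymm (fun x hx => mem_facet.2 (mem_restr.1 hx).1) fun x hx => ?_
    have h1 := bot_lt_iff.1 x.2.1
    have h2 := lt_top_iff.1 x.2.2
    exact mem_restr.2 ⟨mem_facet.1 hx, ⟨x.1.size - 1, by omega⟩, ⟨x.1.size, h2⟩,
      by simp; omega, rfl, h _ _ (by simp; omega)⟩

end Minor

/-! ### Intervals of the poset of minors -/

/-- A partition of the order complex is transported along an isomorphism of posets. -/
def FacetPartition.map {P Q ι : Type*} [PartialOrder P] [PartialOrder Q] (e : P ≃o Q)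
    (p : FacetPartition (orderFaces P) ι) : FacetPartition (orderFaces Q) ι :=
  have hmem : ∀ s ∈ orderFaces Q, s.map e.symm.toEquiv.toEmbedding ∈ orderFaces P := by
    intro s hs
    rw [mem_orderFaces, Finset.coe_map]
    exact e.symm.monotone.isChain_image hs
  have hsub : ∀ (a : Finset P) (s : Finset Q),
      a.map e.toEquiv.toEmbedding ⊆ s ↔ a ⊆ s.map e.symm.toEquiv.toEmbedding := by
    intro a s
    refine ⟨fun h x hx => Finset.mem_map_equiv.2 (h (Finset.mem_map_of_mem _ hx)), fun h y hy => ?_⟩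
    obtain ⟨x, hx, rfl⟩ := Finset.mem_map.1 hy
    exact Finset.mem_map_equiv.1 (h hx)
  have hsub' : ∀ (a : Finset P) (s : Finset Q),
      s ⊆ a.map e.toEquiv.toEmbedding ↔ s.map e.symm.toEquiv.toEmbedding ⊆ a := by
    intro a s
    refine ⟨fun h x hx => ?_, fun h y hy =>
      Finset.mem_map_equiv.2 (h (Finset.mem_map_of_mem e.symm.toEquiv.toEmbedding hy))⟩
    obtain ⟨y, hy, rfl⟩ := Finset.mem_map.1 hx
    exact Finset.mem_map_equiv.1 (h hy)
  { facet := fun c => (p.facet c).map e.toEquiv.toEmbedding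
    restr := fun c => (p.restr c).map e.toEquiv.toEmbedding
    cls := fun s => p.cls (s.map e.symm.toEquiv.toEmbedding)
    rank := p.rank
    facet_mem := fun c => by
      rw [mem_orderFaces, Finset.coe_map]
      exact e.monotone.isChain_image (p.facet_mem c)
    facet_max := fun c s hs h =>
      subset_antisymm ((hsub' _ _).2 (p.facet_max c _ (hmem s hs) ((hsub _ _).1 h)).subset) h
    restr_subset := fun c => Finset.map_subset_map.2 (p.restr_subset c)
    cls_eq_iff := fun s hs c => by rw [hsub, hsub']; exact p.cls_eq_iff _ (hmem s hs) c
    rank_lt := fun t ht s hst => p.rank_lt _ (hmem t ht) _ (Finset.map_subset_map.2 hst) }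

theorem FacetPartition.card_facet_map {P Q ι : Type*} [PartialOrder P] [PartialOrder Q] (e : P ≃o Q)
    (p : FacetPartition (orderFaces P) ι) (c : ι) : ((p.map e).facet c).card = (p.facet c).card :=
  Finset.card_map _

/-- The order complex of `P` has the homotopy type of a wedge of spheres of dimension `m - 1`, and
its reduced homology over `k` is concentrated in this dimension. -/
def IsSpherical (k : Type*) [Field k] (P : Type*) [PartialOrder P] [Finite P] (m : ℕ) : Prop :=
  (∃ r, IsHomotopyWedgeOfSpheres (OrderRealization P) m r) ∧
    ∀ j, j ≠ m → Subsingleton (ReducedHomology k P j)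

section Spherical

variable {k : Type*} [Field k] {P : Type*} [PartialOrder P] [Finite P]

theorem isEmpty_orderRealization [IsEmpty P] : IsEmpty (OrderRealization P) := by
  refine ⟨fun w => ?_⟩
  have := w.2.2.1
  rw [finsum_of_isEmpty] at this
  exact zero_ne_one this

theorem isSpherical_of_isEmpty [IsEmpty P] : IsSpherical k P 0 := by
  refine ⟨⟨1, isEmpty_orderRealization, rfl⟩, fun j hj => ?_⟩
  refine subsingleton_reducedHomology fun z _ => ?_
  have : z = 0 := by
    ext c
    obtain ⟨j, rfl⟩ := Nat.exists_eq_succ_of_ne_zero hj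
    exact isEmptyElim (c.1 0)
  rw [this]
  exact Submodule.zero_mem _

/-- The order complex of a poset with an element comparable to all others is contractible, hence a wedge
of no spheres, of whatever dimension. -/
theorem isSpherical_of_cone (u : P) (hu : ∀ x : P, u ≤ x ∨ x ≤ u) (d : ℕ) :
    IsSpherical k P (d + 1) := by
  classical
  cases nonempty_fintype P
  refine ⟨⟨0, ?_⟩, fun j _ => subsingleton_reducedHomology_of_cone u hu⟩
  have := contractibleSpace_simplicialRealization_of_cone (isLowerSet_orderFaces P)
    ⟨∅, by simp [mem_orderFaces]⟩ u (fun s hs => by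
      rw [mem_orderFaces, Finset.coe_insert]
      exact IsChain.insert hs fun b _ _ => hu b)
  have : ContractibleSpace (OrderRealization P) := (orderRealizationHomeomorph P).contractibleSpace
  have hW : Subsingleton (Wedge 0 (UnitSphere d) (UnitSphere.base d)) :=
    (Wedge.toPi_injective 0 _ _).subsingleton
  have : Nonempty (Wedge 0 (UnitSphere d) (UnitSphere.base d)) := ⟨Quot.mk _ (Sum.inl ())⟩
  have : ContractibleSpace (Wedge 0 (UnitSphere d) (UnitSphere.base d)) := inferInstance
  exact ContractibleSpace.hequiv _ _

/-- In the case `m = 0` the poset is empty, and there is exactly one facet. -/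
theorem FacetPartition.isHomotopyWedgeOfSpheres {ι : Type*} [Finite ι] [Nonempty ι]
    (p : FacetPartition (orderFaces P) ι) {m : ℕ} (hcard : ∀ c, (p.facet c).card = m) :
    IsHomotopyWedgeOfSpheres (OrderRealization P) m
      (Nat.card {c // p.restr c = p.facet c}) := by
  cases nonempty_fintype P
  cases m with
  | zero =>
    have hf : ∀ c, p.facet c = ∅ := fun c => Finset.card_eq_zero.1 (hcard c)
    have hP : IsEmpty P := by
      refine ⟨fun x => ?_⟩
      obtain ⟨c⟩ := ‹Nonempty ι›
      have := p.facet_max c {x} (by simp [mem_orderFaces]) (by rw [hf]; exact Finset.empty_subset _)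
      rw [hf] at this
      exact Finset.singleton_ne_empty _ this
    refine ⟨isEmpty_orderRealization, ?_⟩
    rw [Nat.card_eq_one_iff_unique]
    obtain ⟨c⟩ := ‹Nonempty ι›
    refine ⟨⟨fun a b => Subtype.ext (p.facet_injective (by rw [hf, hf]))⟩, ⟨c, ?_⟩⟩
    rw [hf, ← Finset.subset_empty, ← hf c]
    exact p.restr_subset c
  | succ d =>
    obtain ⟨f⟩ := p.nonempty_homotopyEquiv_wedge (isLowerSet_orderFaces P)
      ⟨∅, by simp [mem_orderFaces]⟩ hcard
    exact ⟨(orderRealizationHomeomorph P).toHomotopyEquiv.trans f⟩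

theorem FacetPartition.isSpherical {ι : Type*} [Finite ι] [Nonempty ι]
    (p : FacetPartition (orderFaces P) ι) {m : ℕ} (hcard : ∀ c, (p.facet c).card = m) :
    IsSpherical k P m :=
  ⟨⟨_, p.isHomotopyWedgeOfSpheres hcard⟩, fun _ hj => p.subsingleton_reducedHomology hcard hj⟩

end Spherical

namespace Minor

variable {n : ℕ}

/-- This includes `n = 0` and `n = 1`, where the proper part is empty and `n - 1` is zero. -/
theorem isHomotopyWedgeOfSpheres_properPart (n : ℕ) :
    IsHomotopyWedgeOfSpheres (OrderRealization (Set.Ioo (⊥ : Minor n) ⊤)) (n - 1)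
      (Nat.card {p : Equiv.Perm (Fin n) × Equiv.Perm (Fin n) // NoCommonAscent p.1 p.2}) := by
  have h := (properPartition n).isHomotopyWedgeOfSpheres card_facet
  have hcard := Nat.card_congr (Equiv.subtypeEquivRight fun c => restr_eq_facet_iff (n := n) c)
  rw [← hcard]
  exact h

theorem subset_union_map_iff {l : ℕ} {A : Finset (Fin n)} {e : Fin l ↪ Fin n} (he : ∀ i, e i ∉ A)
    {S T : Finset (Fin l)} : A ∪ S.map e ⊆ A ∪ T.map e ↔ S ⊆ T := by
  refine ⟨fun h i hi => ?_, fun h =>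
    Finset.union_subset_union_right (Finset.map_subset_map.2 h)⟩
  have := h (Finset.mem_union_right _ (Finset.mem_map_of_mem e hi))
  rw [Finset.mem_union] at this
  simpa [he i] using this

theorem card_union_map {l : ℕ} {A : Finset (Fin n)} {e : Fin l ↪ Fin n} (he : ∀ i, e i ∉ A)
    (S : Finset (Fin l)) : (A ∪ S.map e).card = A.card + S.card := by
  rw [Finset.card_union_of_disjoint, Finset.card_map]
  rw [Finset.disjoint_right]
  intro a ha
  obtain ⟨i, -, rfl⟩ := Finset.mem_map.1 ha
  exact he i

theorem exists_union_map_eq {l : ℕ} {A X : Finset (Fin n)} {e : Fin l ↪ Fin n} (hA : A ⊆ X)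
    (hX : X ⊆ A ∪ Finset.univ.map e) : ∃ S : Finset (Fin l), A ∪ S.map e = X := by
  refine ⟨Finset.univ.filter fun i => e i ∈ X, ?_⟩
  ext a
  simp only [Finset.mem_union, Finset.mem_map, Finset.mem_filter, Finset.mem_univ, true_and]
  constructor
  · rintro (h | ⟨i, h, rfl⟩)
    · exact hA h
    · exact h
  · intro h
    have := hX h
    simp only [Finset.mem_union, Finset.mem_map, Finset.mem_univ, true_and] at this
    rcases this with h' | ⟨i, rfl⟩
    · exact Or.inl h'
    · exact Or.inr ⟨i, h, rfl⟩

theorem exists_embedding_sdiff {A B : Finset (Fin n)} (hAB : A ⊆ B) {l : ℕ}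
    (hl : B.card = A.card + l) :
    ∃ e : Fin l ↪ Fin n, (∀ i, e i ∉ A) ∧ A ∪ Finset.univ.map e = B := by
  have hc : (B \ A).card = l := by rw [Finset.card_sdiff_of_subset hAB]; omega
  refine ⟨((B \ A).orderEmbOfFin hc).toEmbedding, fun i => ?_, ?_⟩
  · exact (Finset.mem_sdiff.1 (Finset.orderEmbOfFin_mem _ hc i)).2
  · have : Finset.univ.map ((B \ A).orderEmbOfFin hc).toEmbedding = B \ A := by
      rw [← Finset.coe_inj, Finset.coe_map]
      simp
    rw [this, Finset.union_sdiff_of_subset hAB]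

/-- An open interval of the poset of minors is the proper part of a smaller poset of minors. -/
theorem nonempty_orderIso_Ioo {p q : Minor n} (hpq : p < q) :
    Nonempty (Set.Ioo (⊥ : Minor (q.size - p.size)) ⊤ ≃o Set.Ioo p q) := by
  have hs := size_strictMono hpq
  obtain ⟨e, he, heq⟩ := exists_embedding_sdiff (l := q.size - p.size) hpq.le.1
    (by change q.size = p.size + _; omega)
  obtain ⟨e', he', heq'⟩ := exists_embedding_sdiff (l := q.size - p.size) hpq.le.2
    (by rw [card_snd, card_snd]; omega)
  let f : Minor (q.size - p.size) ↪o Minor n := OrderEmbedding.ofMapLEIff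
    (fun x => ⟨(p.1.1 ∪ x.1.1.map e, p.1.2 ∪ x.1.2.map e'), by
      rw [card_union_map he, card_union_map he', p.2, x.2]⟩)
    (fun x y => and_congr (subset_union_map_iff he) (subset_union_map_iff he'))
  have hbot : f ⊥ = p := Subtype.ext (Prod.ext (Finset.union_empty _) (Finset.union_empty _))
  have htop : f ⊤ = q := Subtype.ext (Prod.ext heq heq')
  let g : Set.Ioo (⊥ : Minor (q.size - p.size)) ⊤ ↪o Set.Ioo p q := OrderEmbedding.ofMapLEIff
    (fun x => ⟨f x.1, hbot.symm.trans_lt (f.lt_iff_lt.2 x.2.1),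
      (f.lt_iff_lt.2 x.2.2).trans_eq htop⟩) (fun x y => f.le_iff_le)
  refine ⟨RelIso.ofSurjective g fun z => ?_⟩
  obtain ⟨S, hS⟩ := exists_union_map_eq (e := e) z.2.1.le.1 (heq ▸ z.2.2.le.1)
  obtain ⟨T, hT⟩ := exists_union_map_eq (e := e') z.2.1.le.2 (heq' ▸ z.2.2.le.2)
  have hST : S.card = T.card := by
    have h1 := card_union_map he S
    have h2 := card_union_map he' T
    rw [hS] at h1
    rw [hT] at h2
    have := z.1.2
    have := p.2
    omega
  let x : Minor (q.size - p.size) := ⟨(S, T), hST⟩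
  have hx : f x = z.1 := Subtype.ext (Prod.ext hS hT)
  refine ⟨⟨x, ?_, ?_⟩, Subtype.ext hx⟩
  · rw [← f.lt_iff_lt, hx, hbot]; exact z.2.1
  · rw [← f.lt_iff_lt, hx, htop]; exact z.2.2

end Minor

/-! ### Ranks -/

/-- A strictly monotone function to the natural numbers that can be lowered in steps of one is the
height. -/
theorem height_eq_of_strictMono_nat {α : Type*} [PartialOrder α] (f : α → ℕ) (hf : StrictMono f)
    (h : ∀ x j, f x = j + 1 → ∃ y < x, f y = j) (x : α) : Order.height x = f x := by
  apply le_antisymm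
  · simpa using Order.height_le_height_apply_of_strictMono f hf x
  · induction hx : f x generalizing x with
    | zero => simp
    | succ j ih =>
      obtain ⟨y, hyx, hy⟩ := h x j hx
      have := ih y hy
      calc ((j + 1 : ℕ) : ℕ∞) = j + 1 := by push_cast; rfl
        _ ≤ Order.height y + 1 := by gcongr
        _ ≤ Order.height x := Order.height_add_one_le hyx

theorem height_finset {α : Type*} (s : Finset α) : Order.height s = s.card := by
  classical
  refine height_eq_of_strictMono_nat Finset.card Finset.card_strictMono (fun s j hs => ?_) s
  obtain ⟨a, ha⟩ := Finset.card_pos.1 (by omega : 0 < s.card)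
  exact ⟨s.erase a, Finset.erase_ssubset ha, by rw [Finset.card_erase_of_mem ha]; omega⟩

namespace Minor

variable {n : ℕ}

theorem height_eq_size (x : Minor n) : Order.height x = x.size := by
  refine height_eq_of_strictMono_nat size size_strictMono (fun x j hx => ?_) x
  obtain ⟨a, ha⟩ := Finset.card_pos.1 (by change 0 < x.size; omega : 0 < x.1.1.card)
  obtain ⟨b, hb⟩ := Finset.card_pos.1 (by rw [card_snd]; omega : 0 < x.1.2.card)
  let y : Minor n := ⟨(x.1.1.erase a, x.1.2.erase b), by
    rw [Finset.card_erase_of_mem ha, Finset.card_erase_of_mem hb, x.2]⟩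
  have hy : y.size = j := by
    change (x.1.1.erase a).card = j
    rw [Finset.card_erase_of_mem ha]
    change x.size - 1 = j
    omega
  have hyx : y ≤ x := ⟨Finset.erase_subset _ _, Finset.erase_subset _ _⟩
  exact ⟨y, lt_of_le_of_ne hyx fun h => by rw [h] at hy; omega, hy⟩

theorem height_augmented_coe (x : Minor n) :
    Order.height (((x : WithTop (Minor n)) : Augmented (Minor n))) = x.size + 1 := by
  rw [Order.height_coe_withBot, Order.height_coe_withTop, height_eq_size]

/-- The new bottom and the new top element each contribute one to the rank. -/
theorem height_augmented_top : Order.height (⊤ : Augmented (Minor n)) = n + 2 := by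
  change Order.height (((⊤ : WithTop (Minor n)) : Augmented (Minor n))) = n + 2
  rw [Order.height_coe_withBot]
  have : Order.height (⊤ : WithTop (Minor n)) = n + 1 := by
    apply le_antisymm
    · rw [Order.height_eq_iSup_lt_height]
      refine iSup₂_le fun y hy => ?_
      obtain ⟨x, rfl⟩ := WithTop.ne_top_iff_exists.1 hy.ne
      rw [Order.height_coe_withTop, height_eq_size]
      have : x.size ≤ n := by simpa using size_mono (le_top (a := x))
      gcongr
    · have := Order.height_add_one_le (WithTop.coe_lt_top (⊤ : Minor n))
      rwa [Order.height_coe_withTop, height_eq_size, size_top] at this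
  rw [this, add_assoc]
  rfl

/-- All maximal chains have one element of each size. -/
theorem isPurePoset (n : ℕ) : IsPurePoset (Minor n) := by
  suffices h : ∀ s : Set (Minor n), IsMaxChain (· ≤ ·) s → s.encard = n + 1 from
    fun s t hs ht => (h s hs).trans (h t ht).symm
  intro s hs
  classical
  let G : Finset (Minor n) := s.toFinite.toFinset
  have hG : ∀ g, g ∈ G ↔ g ∈ s := by simp [G]
  let c : Equiv.Perm (Fin n) × Equiv.Perm (Fin n) :=
    (sortPerm G fun x => x.1.1, sortPerm G fun x => x.1.2)
  have hc : ∀ g ∈ s, IsInitial c g := by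
    intro g hg
    refine ⟨eq_initialSet_sortPerm (fun g hg h hh =>
      comparable_fst hs.1 ((hG g).1 hg) ((hG h).1 hh)) ((hG g).2 hg), ?_⟩
    rw [← card_snd]
    exact eq_initialSet_sortPerm (fun g hg h hh =>
      comparable_snd hs.1 ((hG g).1 hg) ((hG h).1 hh)) ((hG g).2 hg)
  have hchain : IsChain (· ≤ ·) {x : Minor n | IsInitial c x} := fun x hx y hy _ =>
    (le_total x.size y.size).imp (fun h => IsInitial.le hx hy h) (fun h => IsInitial.le hy hx h)
  have hseq : s = {x : Minor n | IsInitial c x} := hs.2 hchain hc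
  have himg : size '' s = Set.Iic n := by
    ext i
    constructor
    · rintro ⟨x, -, rfl⟩
      simpa using size_mono (le_top (a := x))
    · intro hi
      refine ⟨initial c.1 c.2 i hi, ?_, size_initial _ _ _ _⟩
      rw [hseq]
      exact isInitial_initial c i hi
  have hinj : Set.InjOn size s := fun x hx y hy h => (hc x hx).eq (hc y hy) h
  rw [← hinj.encard_image, himg, ← Finset.coe_Iic, Set.encard_coe_eq_coe_finsetCard]
  simp

theorem nonempty_orderIso_augmented (p q : Minor n) :
    Nonempty (Set.Ioo p q ≃o Set.Ioo (((p : WithTop (Minor n)) : Augmented (Minor n)))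
      ((q : WithTop (Minor n)) : Augmented (Minor n))) := by
  let g : Set.Ioo p q ↪o Set.Ioo (((p : WithTop (Minor n)) : Augmented (Minor n)))
      ((q : WithTop (Minor n)) : Augmented (Minor n)) := OrderEmbedding.ofMapLEIff
    (fun x => ⟨((x.1 : WithTop (Minor n)) : Augmented (Minor n)),
      WithBot.coe_lt_coe.2 (WithTop.coe_lt_coe.2 x.2.1),
      WithBot.coe_lt_coe.2 (WithTop.coe_lt_coe.2 x.2.2)⟩)
    (fun x y => WithBot.coe_le_coe.trans WithTop.coe_le_coe)
  refine ⟨RelIso.ofSurjective g ?_⟩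
  rintro ⟨z, hz1, hz2⟩
  obtain ⟨z, rfl⟩ := WithBot.ne_bot_iff_exists.1 (ne_bot_of_gt hz1)
  rw [WithBot.coe_lt_coe] at hz1 hz2
  obtain ⟨z, rfl⟩ := WithTop.ne_top_iff_exists.1 (ne_top_of_lt hz2)
  exact ⟨⟨z, WithTop.coe_lt_coe.1 hz1, WithTop.coe_lt_coe.1 hz2⟩, rfl⟩

/-- An open interval of the augmented poset of minors is an interval of the poset of minors, or has
a smallest or a largest element, or is empty. -/
theorem exists_isSpherical_augmented (k : Type*) [Field k] (x y : Augmented (Minor n))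
    (hxy : x < y) :
    ∃ m : ℕ, Order.height x + m + 1 = Order.height y ∧ IsSpherical k (Set.Ioo x y) m := by
  induction x using WithBot.recBotCoe with
  | bot =>
    have hle : ∀ z : Set.Ioo (⊥ : Augmented (Minor n)) y,
        (((⊥ : Minor n) : WithTop (Minor n)) : Augmented (Minor n)) ≤ z.1 := by
      rintro ⟨z, hz1, hz2⟩
      obtain ⟨z, rfl⟩ := WithBot.ne_bot_iff_exists.1 (ne_bot_of_gt hz1)
      exact WithBot.coe_le_coe.2 bot_le
    induction y using WithBot.recBotCoe with
    | bot => exact absurd hxy (lt_irrefl _)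
    | coe y =>
      induction y using WithTop.recTopCoe with
      | top =>
        refine ⟨n + 1, ?_, isSpherical_of_cone
          ⟨(((⊥ : Minor n) : WithTop (Minor n)) : Augmented (Minor n)), WithBot.bot_lt_coe _,
            WithBot.coe_lt_coe.2 (WithTop.coe_lt_top _)⟩ (fun z => Or.inl (hle z)) n⟩
        rw [Order.height_bot]
        refine Eq.trans ?_ height_augmented_top.symm
        push_cast
        rw [zero_add, add_assoc]
        rfl
      | coe q =>
        rw [Order.height_bot, height_augmented_coe]
        refine ⟨q.size, by rw [zero_add], ?_⟩
        rcases eq_bot_or_bot_lt q with rfl | hq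
        · have : IsEmpty (Set.Ioo (⊥ : Augmented (Minor n))
              (((⊥ : Minor n) : WithTop (Minor n)) : Augmented (Minor n))) :=
            ⟨fun z => (hle z).not_gt z.2.2⟩
          exact isSpherical_of_isEmpty
        · obtain ⟨d, hd⟩ := Nat.exists_eq_succ_of_ne_zero (bot_lt_iff.1 hq).ne'
          rw [hd]
          exact isSpherical_of_cone
            ⟨(((⊥ : Minor n) : WithTop (Minor n)) : Augmented (Minor n)), WithBot.bot_lt_coe _,
              WithBot.coe_lt_coe.2 (WithTop.coe_lt_coe.2 hq)⟩ (fun z => Or.inl (hle z)) d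
  | coe x =>
    induction y using WithBot.recBotCoe with
    | bot => exact absurd hxy not_lt_bot
    | coe y =>
    induction x using WithTop.recTopCoe with
    | top => exact absurd (WithBot.coe_lt_coe.1 hxy) not_top_lt
    | coe p =>
      rw [height_augmented_coe]
      induction y using WithTop.recTopCoe with
      | top =>
        have hle : ∀ z : Set.Ioo ((p : WithTop (Minor n)) : Augmented (Minor n))
              ((⊤ : WithTop (Minor n)) : Augmented (Minor n)),
            z.1 ≤ (((⊤ : Minor n) : WithTop (Minor n)) : Augmented (Minor n)) := by
          rintro ⟨z, hz1, hz2⟩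
          obtain ⟨z, rfl⟩ := WithBot.ne_bot_iff_exists.1 (ne_bot_of_gt hz1)
          rw [WithBot.coe_lt_coe] at hz1 hz2
          obtain ⟨z, rfl⟩ := WithTop.ne_top_iff_exists.1 (ne_top_of_lt hz2)
          exact WithBot.coe_le_coe.2 (WithTop.coe_le_coe.2 le_top)
        have hp : p.size ≤ n := by simpa using size_mono (le_top (a := p))
        refine ⟨n - p.size, ?_, ?_⟩
        · refine Eq.trans ?_ height_augmented_top.symm
          norm_cast
          omega
        · rcases eq_top_or_lt_top p with rfl | hpt
          · have : IsEmpty (Set.Ioo (((⊤ : Minor n) : WithTop (Minor n)) : Augmented (Minor n))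
                ((⊤ : WithTop (Minor n)) : Augmented (Minor n))) :=
              ⟨fun z => (hle z).not_gt z.2.1⟩
            rw [size_top, Nat.sub_self]
            exact isSpherical_of_isEmpty
          · have := lt_top_iff.1 hpt
            obtain ⟨d, hd⟩ := Nat.exists_eq_succ_of_ne_zero (by omega : n - p.size ≠ 0)
            rw [hd]
            exact isSpherical_of_cone
              ⟨(((⊤ : Minor n) : WithTop (Minor n)) : Augmented (Minor n)),
                WithBot.coe_lt_coe.2 (WithTop.coe_lt_coe.2 hpt),
                WithBot.coe_lt_coe.2 (WithTop.coe_lt_top _)⟩ (fun z => Or.inr (hle z)) d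
      | coe q =>
        rw [height_augmented_coe]
        have hpq : p < q := WithTop.coe_lt_coe.1 (WithBot.coe_lt_coe.1 hxy)
        have hs := size_strictMono hpq
        refine ⟨q.size - p.size - 1, by norm_cast; omega, ?_⟩
        obtain ⟨e⟩ := nonempty_orderIso_Ioo hpq
        obtain ⟨e'⟩ := nonempty_orderIso_augmented p q
        exact ((properPartition _).map (e.trans e')).isSpherical fun c => by
          rw [FacetPartition.card_facet_map]
          exact card_facet c

theorem isCohenMacaulayPoset (n : ℕ) (k : Type*) [Field k] : IsCohenMacaulayPoset k (Minor n) := by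
  refine ⟨isPurePoset n, fun x y hxy j hj => ?_⟩
  obtain ⟨m, hm, -, h⟩ := exists_isSpherical_augmented k x y hxy
  exact h j fun hjm => hj (hjm ▸ hm)

theorem isHomotopicallyCohenMacaulayPoset (n : ℕ) :
    IsHomotopicallyCohenMacaulayPoset (Minor n) := by
  refine ⟨isPurePoset n, fun x y hxy => ?_⟩
  -- the field matters only for the homological part of the conclusion
  obtain ⟨m, hm, ⟨r, hr⟩, -⟩ := exists_isSpherical_augmented ℚ x y hxy
  exact ⟨m, r, hm, hr⟩

/-- The size of a minor is its rank, so that the poset of minors is a Segre square. -/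
theorem exists_orderIso_rankSegreProduct (n : ℕ) :
    ∃ e : Minor n ≃o RankSegreProduct (Finset (Fin n)) (Finset (Fin n)), ∀ m, (e m).1 = m.1 := by
  have h : ∀ x : Finset (Fin n) × Finset (Fin n),
      x.1.card = x.2.card ↔ Order.height x.1 = Order.height x.2 := by
    intro x
    rw [height_finset, height_finset, Nat.cast_inj]
  exact ⟨{ toEquiv := Equiv.subtypeEquivRight h, map_rel_iff' := Iff.rfl }, fun m => rfl⟩

end Minor

/-! ### Möbius numbers -/

theorem sum_Icc_neg_one_pow_card {V : Type*} [DecidableEq V] (R F : Finset V) (h : R ⊆ F) :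
    ∑ s ∈ Finset.Icc R F, (-1 : ℤ) ^ s.card = if R = F then (-1) ^ F.card else 0 := by
  rw [Finset.Icc_eq_image_powerset h, Finset.sum_image]
  · have : ∀ t ∈ (F \ R).powerset, (-1 : ℤ) ^ (R ∪ t).card = (-1) ^ R.card * (-1) ^ t.card := by
      intro t ht
      rw [Finset.card_union_of_disjoint, pow_add]
      exact Finset.disjoint_of_subset_right (Finset.mem_powerset.1 ht) Finset.disjoint_sdiff
    rw [Finset.sum_congr rfl this, ← Finset.mul_sum, Finset.sum_powerset_neg_one_pow_card]
    by_cases hRF : R = F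
    · simp [hRF]
    · have : F \ R ≠ ∅ := fun h' => hRF (subset_antisymm h (Finset.sdiff_eq_empty_iff_subset.1 h'))
      simp [hRF, this]
  · intro s hs t ht hst
    have hs' := Finset.disjoint_of_subset_right (Finset.mem_powerset.1 hs)
      (Finset.disjoint_sdiff (s := R) (t := F))
    have ht' := Finset.disjoint_of_subset_right (Finset.mem_powerset.1 ht)
      (Finset.disjoint_sdiff (s := R) (t := F))
    rw [← Finset.union_sdiff_cancel_left hs', ← Finset.union_sdiff_cancel_left ht']
    exact congrArg (· \ R) hst

open Classical in
/-- The reduced Euler characteristic, up to sign, from a partition into intervals. -/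
theorem FacetPartition.sum_neg_one_pow_card {V ι : Type*} [Fintype V] [Fintype ι]
    {K : Set (Finset V)} (p : FacetPartition K ι) (hK : IsLowerSet K) {m : ℕ}
    (hcard : ∀ c, (p.facet c).card = m) :
    ∑ s : Finset V with s ∈ K, (-1 : ℤ) ^ s.card =
      (-1) ^ m * (Nat.card {c // p.restr c = p.facet c} : ℤ) := by
  rw [← Finset.sum_fiberwise (Finset.univ.filter (· ∈ K)) p.cls]
  have hfib : ∀ c, (Finset.univ.filter (· ∈ K)).filter (fun s => p.cls s = c) =
      Finset.Icc (p.restr c) (p.facet c) := by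
    intro c
    ext s
    simp only [Finset.mem_filter, Finset.mem_univ, true_and, Finset.mem_Icc]
    refine ⟨fun h => (p.cls_eq_iff s h.1 c).1 h.2, fun h => ?_⟩
    have hs := hK h.2 (p.facet_mem c)
    exact ⟨hs, (p.cls_eq_iff s hs c).2 h⟩
  rw [Finset.sum_congr rfl fun c _ => by
    rw [hfib c, sum_Icc_neg_one_pow_card _ _ (p.restr_subset c), hcard c]]
  rw [← Finset.sum_filter, Finset.sum_const, Nat.card_eq_fintype_card, Fintype.card_subtype,
    nsmul_eq_mul, mul_comm]

section Hall

variable {P : Type*} [PartialOrder P] [LocallyFiniteOrder P]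

open Classical in
/-- The finite chains of the open interval `(a, b)`. -/
noncomputable def chainsBetween (a b : P) : Finset (Finset P) :=
  (Finset.Ioo a b).powerset.filter fun s => IsChain (· ≤ ·) (s : Set P)

theorem mem_chainsBetween {a b : P} {s : Finset P} :
    s ∈ chainsBetween a b ↔ s ⊆ Finset.Ioo a b ∧ IsChain (· ≤ ·) (s : Set P) := by
  simp [chainsBetween]

/-- Chains are classified by their largest element. -/
theorem chainsBetween_eq [DecidableEq P] (a b : P) : chainsBetween a b =
    insert ∅ ((Finset.Ioo a b).biUnion fun x => (chainsBetween a x).image (insert x)) := by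
  ext s
  simp only [Finset.mem_insert, Finset.mem_biUnion, Finset.mem_image, mem_chainsBetween]
  constructor
  · rintro ⟨hs, hchain⟩
    rcases s.eq_empty_or_nonempty with rfl | hne
    · exact Or.inl rfl
    · obtain ⟨x, hx⟩ := s.exists_maximal hne
      refine Or.inr ⟨x, hs hx.1, s.erase x, ⟨fun y hy => ?_, ?_⟩, Finset.insert_erase hx.1⟩
      · rw [Finset.mem_erase] at hy
        have hay := (Finset.mem_Ioo.1 (hs hy.2)).1
        refine Finset.mem_Ioo.2 ⟨hay, lt_of_le_of_ne ?_ hy.1⟩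
        rcases hchain.total hy.2 hx.1 with h | h
        · exact h
        · exact hx.2 hy.2 h
      · exact hchain.mono (Finset.coe_subset.2 (Finset.erase_subset _ _))
  · rintro (rfl | ⟨x, hx, t, ⟨ht, hchain⟩, rfl⟩)
    · simp
    · rw [Finset.mem_Ioo] at hx
      refine ⟨Finset.insert_subset (Finset.mem_Ioo.2 hx) fun y hy => ?_, ?_⟩
      · have := Finset.mem_Ioo.1 (ht hy)
        exact Finset.mem_Ioo.2 ⟨this.1, this.2.trans hx.2⟩
      · rw [Finset.coe_insert]
        exact hchain.insert fun y hy _ => Or.inr (Finset.mem_Ioo.1 (ht hy)).2.le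

/-- Philip Hall's theorem: the Möbius function is an alternating count of chains. -/
theorem mu_eq_sum_chainsBetween [DecidableEq P] (a b : P) (hab : a < b) :
    IncidenceAlgebra.mu ℤ a b = -∑ s ∈ chainsBetween a b, (-1) ^ s.card := by
  induction hk : (Finset.Ioo a b).card using Nat.strong_induction_on generalizing b with
  | _ k ih =>
  have hlt : ∀ x ∈ Finset.Ioo a b, (Finset.Ioo a x).card < k := by
    intro x hx
    rw [← hk]
    refine Finset.card_lt_card ⟨?_, fun h => ?_⟩
    · exact Finset.Ioo_subset_Ioo_right (Finset.mem_Ioo.1 hx).2.le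
    · exact lt_irrefl x (Finset.mem_Ioo.1 (h hx)).2
  have hmax : ∀ x, ∀ s ∈ chainsBetween a x, x ∉ s := fun x s hs hx =>
    lt_irrefl x (Finset.mem_Ioo.1 ((mem_chainsBetween.1 hs).1 hx)).2
  have hdisj : ((Finset.Ioo a b : Finset P) : Set P).PairwiseDisjoint
      fun x => (chainsBetween a x).image (insert x) := by
    intro x _ y _ hxy
    rw [Function.onFun, Finset.disjoint_left]
    intro s hs hs'
    obtain ⟨t, ht, rfl⟩ := Finset.mem_image.1 hs
    obtain ⟨t', ht', he⟩ := Finset.mem_image.1 hs'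
    have h1 : x ∈ insert y t' := he ▸ Finset.mem_insert_self x t
    have h2 : y ∈ insert x t := he ▸ Finset.mem_insert_self y t'
    have h3 := Finset.mem_Ioo.1 ((mem_chainsBetween.1 ht').1 (Finset.mem_of_mem_insert_of_ne h1 hxy))
    have h4 := Finset.mem_Ioo.1
      ((mem_chainsBetween.1 ht).1 (Finset.mem_of_mem_insert_of_ne h2 (Ne.symm hxy)))
    exact lt_asymm h3.2 h4.2
  rw [IncidenceAlgebra.mu_eq_neg_sum_Ico_of_ne hab.ne, chainsBetween_eq, Finset.sum_insert,
    Finset.sum_biUnion hdisj, ← Finset.Ioo_insert_left hab, Finset.sum_insert (by simp)]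
  · congr 2
    · simp
    · refine Finset.sum_congr rfl fun x hx => ?_
      rw [ih _ (hlt x hx) x (Finset.mem_Ioo.1 hx).1 rfl, Finset.sum_image, ← Finset.sum_neg_distrib]
      · refine Finset.sum_congr rfl fun s hs => ?_
        rw [Finset.card_insert_of_notMem (hmax x s hs), pow_succ]
        ring
      · intro s hs t ht hst
        rw [← Finset.erase_insert (hmax x s hs), ← Finset.erase_insert (hmax x t ht)]
        exact congrArg (fun u => u.erase x) hst
  · simp

open Classical in
theorem sum_chainsBetween_eq (a b : P) [Fintype (Set.Ioo a b)] :
    ∑ s ∈ chainsBetween a b, (-1 : ℤ) ^ s.card =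
      ∑ s : Finset (Set.Ioo a b) with s ∈ orderFaces (Set.Ioo a b), (-1) ^ s.card := by
  symm
  refine Finset.sum_nbij (fun s => s.map (Function.Embedding.subtype _)) ?_ ?_ ?_ ?_
  · intro s hs
    rw [Finset.mem_filter] at hs
    rw [mem_chainsBetween]
    refine ⟨fun x hx => ?_, ?_⟩
    · obtain ⟨y, -, rfl⟩ := Finset.mem_map.1 hx
      exact Finset.mem_Ioo.2 y.2
    · rw [Finset.coe_map]
      exact (Subtype.mono_coe _).isChain_image hs.2
  · intro s _ t _ hst
    exact Finset.map_injective _ hst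
  · intro s hs
    rw [Finset.mem_coe, mem_chainsBetween] at hs
    have hmem : ∀ x ∈ s, x ∈ Set.Ioo a b := fun x hx => Finset.mem_Ioo.1 (hs.1 hx)
    refine ⟨s.subtype (· ∈ Set.Ioo a b), ?_, Finset.subtype_map_of_mem hmem⟩
    rw [Finset.mem_coe, Finset.mem_filter]
    refine ⟨Finset.mem_univ _, fun x hx y hy _ => ?_⟩
    rw [Finset.mem_coe, Finset.mem_subtype] at hx hy
    exact hs.2.total hx hy
  · intro s _
    rw [Finset.card_map]

end Hall

theorem Minor.mu_bot_top (n : ℕ) : (-1) ^ n * IncidenceAlgebra.mu ℤ (⊥ : Minor n) ⊤ =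
    (Nat.card {p : Equiv.Perm (Fin n) × Equiv.Perm (Fin n) // NoCommonAscent p.1 p.2} : ℤ) := by
  have hcard : Nat.card {c // (properPartition n).restr c = (properPartition n).facet c} =
      Nat.card {p : Equiv.Perm (Fin n) × Equiv.Perm (Fin n) // NoCommonAscent p.1 p.2} :=
    Nat.card_congr (Equiv.subtypeEquivRight fun c => restr_eq_facet_iff (n := n) c)
  have hsum := (properPartition n).sum_neg_one_pow_card (isLowerSet_orderFaces _) card_facet
  cases n with
  | zero =>
    -- the interval from `⊥` to `⊤` is a point, and Hall's theorem does not apply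
    have h : (⊥ : Minor 0) = ⊤ := eq_of_le_of_size_le bot_le (by simp)
    rw [← h, IncidenceAlgebra.mu_self]
    have : Nat.card {p : Equiv.Perm (Fin 0) × Equiv.Perm (Fin 0) // NoCommonAscent p.1 p.2} = 1 := by
      rw [Nat.card_eq_one_iff_unique]
      exact ⟨inferInstance, ⟨(1, 1), fun i => i.elim0⟩⟩
    rw [this]
    simp
  | succ n =>
    rw [← hcard, mu_eq_sum_chainsBetween _ _ (bot_lt_iff.2 (by simp)), sum_chainsBetween_eq, hsum,
      Nat.add_sub_cancel, pow_succ]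
    have : ((-1 : ℤ) ^ n) * (-1) ^ n = 1 := by rw [← mul_pow]; simp
    linear_combination
      (Nat.card {c // (properPartition (n + 1)).restr c = (properPartition (n + 1)).facet c} : ℤ) *
        this

/-! ### Rank-selected invariants of the Boolean lattice -/

section RankSelection

variable {n : ℕ}

open Classical in
/-- The descents of a permutation, as the positions `j` with `σ (j - 1) > σ j`. -/
noncomputable def descentSet (σ : Equiv.Perm (Fin n)) : Finset ℕ :=
  (Finset.Ico 1 n).filter fun l => ∃ i j : Fin n, (j : ℕ) = i + 1 ∧ l = j ∧ σ j < σ i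

theorem mem_descentSet {σ : Equiv.Perm (Fin n)} {l : ℕ} :
    l ∈ descentSet σ ↔ ∃ i j : Fin n, (j : ℕ) = i + 1 ∧ l = j ∧ σ j < σ i := by
  simp only [descentSet, Finset.mem_filter, Finset.mem_Ico, and_iff_right_iff_imp]
  rintro ⟨i, j, h, rfl, -⟩
  omega

theorem mem_descentSet_coe {σ : Equiv.Perm (Fin n)} {i j : Fin n} (hij : (j : ℕ) = i + 1) :
    (j : ℕ) ∈ descentSet σ ↔ σ j < σ i := by
  rw [mem_descentSet]
  refine ⟨?_, fun h => ⟨i, j, hij, rfl, h⟩⟩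
  rintro ⟨i', j', h1, h2, h3⟩
  obtain rfl : j = j' := Fin.ext h2
  obtain rfl : i = i' := Fin.ext (by omega)
  exact h3

/-- The chain of the rank-selected Boolean lattice given by a permutation. -/
def rankFlag (J : Finset ℕ) (σ : Equiv.Perm (Fin n)) : Set (RankSelected (Finset (Fin n)) J) :=
  {x | x.1 = initialSet σ x.1.card}

theorem card_mem_of_rankSelected {J : Finset ℕ} (x : RankSelected (Finset (Fin n)) J) :
    x.1.card ∈ J := by
  obtain ⟨j, hj, h⟩ := x.2
  rw [height_finset, Nat.cast_inj] at h
  exact h ▸ hj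

/-- The element of size `j` of the chain given by a permutation. -/
def rankInitial {J : Finset ℕ} (σ : Equiv.Perm (Fin n)) {j : ℕ} (hj : j ∈ J) (hn : j ≤ n) :
    RankSelected (Finset (Fin n)) J :=
  ⟨initialSet σ j, j, hj, by rw [height_finset, card_initialSet σ hn]⟩

theorem rankInitial_mem {J : Finset ℕ} (σ : Equiv.Perm (Fin n)) {j : ℕ} (hj : j ∈ J)
    (hn : j ≤ n) : rankInitial σ hj hn ∈ rankFlag J σ := by
  change initialSet σ j = initialSet σ (initialSet σ j).card
  rw [card_initialSet σ hn]

theorem isChain_rankFlag (J : Finset ℕ) (σ : Equiv.Perm (Fin n)) :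
    IsChain (· ≤ ·) (rankFlag J σ) := by
  intro x hx y hy _
  have key : ∀ x ∈ rankFlag J σ, ∀ y ∈ rankFlag J σ, x.1.card ≤ y.1.card → x ≤ y := by
    intro x hx y hy h
    change x.1 ⊆ y.1
    rw [show x.1 = initialSet σ x.1.card from hx, show y.1 = initialSet σ y.1.card from hy]
    exact initialSet_mono σ h
  exact (le_total x.1.card y.1.card).imp (key x hx y hy) (key y hy x hx)

theorem isMaxChain_rankFlag (J : Finset ℕ) (σ : Equiv.Perm (Fin n)) :
    IsMaxChain (· ≤ ·) (rankFlag J σ) := by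
  refine ⟨isChain_rankFlag J σ, fun t ht hsub => subset_antisymm hsub fun x hx => ?_⟩
  have hn : x.1.card ≤ n := by simpa using Finset.card_le_univ x.1
  have hy := rankInitial_mem σ (card_mem_of_rankSelected x) hn
  have hc : (rankInitial σ (card_mem_of_rankSelected x) hn).1.card = x.1.card :=
    card_initialSet σ hn
  have : x = rankInitial σ (card_mem_of_rankSelected x) hn := by
    rcases ht.total hx (hsub hy) with h | h
    · exact Subtype.ext (Finset.eq_of_subset_of_card_le h hc.le)
    · exact Subtype.ext (Finset.eq_of_subset_of_card_le h hc.ge).symm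
  rw [this]
  exact hy

/-- Maximal chains of the rank-selected Boolean lattice correspond to permutations with descents in
the selected set of ranks. -/
theorem rankAlpha_eq_ncard (J : Finset ℕ) : rankAlpha (Finset (Fin n)) J =
    {σ : Equiv.Perm (Fin n) | descentSet σ ⊆ J}.ncard := by
  classical
  have hcomp : ∀ s : Set (RankSelected (Finset (Fin n)) J), IsChain (· ≤ ·) s →
      ∀ g ∈ s.toFinite.toFinset, ∀ h ∈ s.toFinite.toFinset, g.1 ⊆ h.1 ∨ h.1 ⊆ g.1 := by
    intro s hs g hg h hh
    rw [Set.Finite.mem_toFinset] at hg hh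
    exact hs.total hg hh
  have hinj : Set.InjOn (rankFlag J) {σ : Equiv.Perm (Fin n) | descentSet σ ⊆ J} := by
    have key : ∀ σ : Equiv.Perm (Fin n), descentSet σ ⊆ J →
        sortPerm (rankFlag J σ).toFinite.toFinset (fun x => x.1) = σ := by
      intro σ hσ
      rw [eq_sortPerm_iff (hcomp _ (isChain_rankFlag J σ))]
      refine ⟨fun g hg => ?_, fun i j hij h => ?_⟩
      · exact (Set.Finite.mem_toFinset (rankFlag J σ).toFinite).1 hg
      · exact ⟨_, (Set.Finite.mem_toFinset _).2
          (rankInitial_mem σ (hσ ((mem_descentSet_coe hij).2 h)) j.2.le), card_initialSet σ j.2.le⟩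
    intro σ hσ τ hτ h
    rw [← key σ hσ, ← key τ hτ]
    simp only [h]
  rw [rankAlpha, ← hinj.ncard_image]
  congr 1
  ext s
  simp only [Set.mem_ofPred_eq, Set.mem_image]
  constructor
  · intro hs
    obtain ⟨h1, h2⟩ := (eq_sortPerm_iff (hcomp s hs.1) _).1 rfl
    refine ⟨sortPerm s.toFinite.toFinset (fun x => x.1), fun l hl => ?_, ?_⟩
    · obtain ⟨i, j, hij, rfl, h⟩ := mem_descentSet.1 hl
      obtain ⟨g, -, hg⟩ := h2 i j hij h
      exact hg ▸ card_mem_of_rankSelected g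
    · exact (hs.2 (isChain_rankFlag J _) fun x hx => h1 x ((Set.Finite.mem_toFinset _).2 hx)).symm
  · rintro ⟨σ, -, rfl⟩
    exact isMaxChain_rankFlag J σ

open Classical in
theorem rankAlpha_eq_sum (J : Finset ℕ) : (rankAlpha (Finset (Fin n)) J : ℤ) =
    ∑ σ : Equiv.Perm (Fin n), if descentSet σ ⊆ J then 1 else 0 := by
  rw [rankAlpha_eq_ncard, Set.ncard_eq_toFinset_card', Finset.sum_boole]
  congr 2
  ext σ
  simp

open Classical in
/-- By inclusion and exclusion, `β_J` counts the permutations with descent set `J`. -/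
theorem rankBeta_eq_sum (J : Finset ℕ) : rankBeta (Finset (Fin n)) J =
    ∑ σ : Equiv.Perm (Fin n), if descentSet σ = J then 1 else 0 := by
  simp only [rankBeta, rankAlpha_eq_sum, Finset.mul_sum]
  rw [Finset.sum_comm]
  refine Finset.sum_congr rfl fun σ _ => ?_
  simp only [mul_ite, mul_one, mul_zero]
  rw [← Finset.sum_filter]
  have hsign : ∀ I ∈ J.powerset.filter (descentSet σ ⊆ ·),
      (-1 : ℤ) ^ (J \ I).card = (-1) ^ J.card * (-1) ^ I.card := by
    intro I hI
    have hIJ := Finset.mem_powerset.1 (Finset.mem_filter.1 hI).1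
    rw [← Finset.card_sdiff_add_card_eq_card hIJ, pow_add, mul_assoc, ← mul_pow]
    simp
  rw [Finset.sum_congr rfl hsign, ← Finset.mul_sum]
  have hIcc : J.powerset.filter (descentSet σ ⊆ ·) = Finset.Icc (descentSet σ) J := by
    ext I
    simp [and_comm]
  rw [hIcc]
  by_cases h : descentSet σ ⊆ J
  · rw [sum_Icc_neg_one_pow_card _ _ h]
    split_ifs
    · rw [← mul_pow]; simp
    · simp
  · rw [Finset.Icc_eq_empty h, if_neg fun he => h he.le]
    simp

/-- Reversing the values of `τ` turns its ascents into descents. -/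
theorem noCommonAscent_mul_revPerm_iff (σ τ : Equiv.Perm (Fin n)) :
    NoCommonAscent σ (Fin.revPerm * τ) ↔ descentSet τ ⊆ descentSet σ := by
  constructor
  · intro h l hl
    obtain ⟨i, j, hij, rfl, hτ⟩ := mem_descentSet.1 hl
    rw [mem_descentSet_coe hij]
    have hne : i ≠ j := fun h => by rw [h] at hij; omega
    refine lt_of_le_of_ne (not_lt.1 fun hσ => h i j hij ⟨hσ, ?_⟩) fun h => hne (σ.injective h).symm
    simpa using hτ
  · rintro h i j hij ⟨h1, h2⟩
    have h3 : τ j < τ i := by simpa using h2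
    exact lt_asymm h1 ((mem_descentSet_coe hij).1 (h ((mem_descentSet_coe hij).2 h3)))

/-- Both sides count the pairs `(σ, τ)` with the descents of `τ` among those of `σ`. -/
theorem card_noCommonAscent_eq_sum (n : ℕ) :
    (Nat.card {p : Equiv.Perm (Fin n) × Equiv.Perm (Fin n) // NoCommonAscent p.1 p.2} : ℤ) =
      ∑ J ∈ (Finset.Ico 1 n).powerset,
        (rankAlpha (Finset (Fin n)) J : ℤ) * rankBeta (Finset (Fin n)) J := by
  classical
  have hmem : ∀ σ : Equiv.Perm (Fin n), descentSet σ ∈ (Finset.Ico 1 n).powerset := fun σ =>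
    Finset.mem_powerset.2 (Finset.filter_subset _ _)
  have hR : ∑ J ∈ (Finset.Ico 1 n).powerset,
      (rankAlpha (Finset (Fin n)) J : ℤ) * rankBeta (Finset (Fin n)) J =
      ∑ σ : Equiv.Perm (Fin n), (rankAlpha (Finset (Fin n)) (descentSet σ) : ℤ) := by
    simp only [rankBeta_eq_sum, Finset.mul_sum]
    rw [Finset.sum_comm]
    refine Finset.sum_congr rfl fun σ _ => ?_
    simp only [mul_ite, mul_one, mul_zero]
    rw [Finset.sum_ite_eq, if_pos (hmem σ)]
  rw [hR]
  simp only [rankAlpha_eq_sum]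
  rw [← Fintype.sum_prod_type', Finset.sum_boole, Nat.card_eq_fintype_card, Fintype.card_subtype]
  congr 1
  refine (Finset.card_equiv (Equiv.prodCongr (Equiv.refl _) (Equiv.mulLeft Fin.revPerm)) ?_).symm
  rintro ⟨σ, τ⟩
  simp only [Finset.mem_filter, Finset.mem_univ, true_and]
  exact (noCommonAscent_mul_revPerm_iff σ τ).symm

end RankSelection

/-! ### Words of pairs -/

theorem List.toFinset_take_succ {α : Type*} [DecidableEq α] {l : List α} {i : ℕ}
    (hi : i < l.length) : (l.take (i + 1)).toFinset = insert l[i] (l.take i).toFinset := by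
  rw [List.take_succ_eq_append_getElem hi, List.toFinset_append]
  simp

/-- A word with strictly increasing coordinates precedes every other word whose coordinates are
permutations of its own. -/
theorem List.lex_of_pairwise_lt {α β : Type*} [PartialOrder α] [PartialOrder β] :
    ∀ {w v : List (α × β)}, (w.map Prod.fst).Pairwise (· < ·) → (w.map Prod.snd).Pairwise (· < ·) →
      (v.map Prod.fst).Perm (w.map Prod.fst) → (v.map Prod.snd).Perm (w.map Prod.snd) → v ≠ w →
      List.Lex (· < ·) w v
  | [], v, _, _, h1, _, hne => by
    simp only [List.map_nil, List.perm_nil, List.map_eq_nil_iff] at h1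
    exact absurd h1 hne
  | p :: w, [], _, _, h1, _, _ => by simp at h1
  | p :: w, q :: v, hs, ht, h1, h2, hne => by
    by_cases hpq : q = p
    · subst hpq
      simp only [List.map_cons] at hs ht h1 h2
      exact .cons (List.lex_of_pairwise_lt hs.of_cons ht.of_cons h1.cons_inv h2.cons_inv
        fun h => hne (h ▸ rfl))
    · refine .rel (lt_of_le_of_ne ⟨?_, ?_⟩ (Ne.symm hpq))
      · have hq : q.1 ∈ (p :: w).map Prod.fst := h1.subset (by simp)
        rw [List.map_cons] at hq hs
        rcases List.mem_cons.1 hq with h | h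
        · exact h.ge
        · exact ((List.pairwise_cons.1 hs).1 _ h).le
      · have hq : q.2 ∈ (p :: w).map Prod.snd := h2.subset (by simp)
        rw [List.map_cons] at hq ht
        rcases List.mem_cons.1 hq with h | h
        · exact h.ge
        · exact ((List.pairwise_cons.1 ht).1 _ h).le

namespace Minor

variable {n : ℕ}

/-! ### The natural labeling -/

theorem covBy_iff {x y : Minor n} : x ⋖ y ↔
    ∃ a b, a ∉ x.1.1 ∧ b ∉ x.1.2 ∧ y.1.1 = insert a x.1.1 ∧ y.1.2 = insert b x.1.2 := by
  constructor
  · intro h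
    have hlt : x.size < y.size := size_strictMono h.lt
    obtain ⟨a, hay, hax⟩ := Finset.exists_mem_notMem_of_card_lt_card hlt
    obtain ⟨b, hby, hbx⟩ := Finset.exists_mem_notMem_of_card_lt_card
      (show x.1.2.card < y.1.2.card by rw [card_snd, card_snd]; exact hlt)
    let z : Minor n := ⟨(insert a x.1.1, insert b x.1.2), by
      simp only [Finset.card_insert_of_notMem hax, Finset.card_insert_of_notMem hbx, x.2]⟩
    have hxz : x < z := lt_of_le_of_ne ⟨Finset.subset_insert _ _, Finset.subset_insert _ _⟩
      fun he => hax (by rw [he]; exact Finset.mem_insert_self _ _)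
    have hzy : z ≤ y := ⟨Finset.insert_subset hay h.le.1, Finset.insert_subset hby h.le.2⟩
    have hz : z = y := hzy.eq_of_not_lt (h.2 hxz)
    exact ⟨a, b, hax, hbx, hz ▸ rfl, hz ▸ rfl⟩
  · rintro ⟨a, b, ha, hb, h1, h2⟩
    have hs : y.size = x.size + 1 := by rw [size, h1, Finset.card_insert_of_notMem ha, size]
    refine ⟨lt_of_le_of_ne ⟨h1 ▸ Finset.subset_insert _ _, h2 ▸ Finset.subset_insert _ _⟩ ?_, ?_⟩
    · rintro rfl
      omega
    · intro z hxz hzy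
      have := size_strictMono hxz
      have := size_strictMono hzy
      omega

/-- The label of a covering consists of the added row and the added column. -/
def IsNaturalLabeling (lab : EdgeLabeling (Minor n) (Fin n × Fin n)) : Prop :=
  ∀ x y (h : x ⋖ y), y.1.1 \ x.1.1 = {(lab x y h).1} ∧ y.1.2 \ x.1.2 = {(lab x y h).2}

theorem exists_isNaturalLabeling (n : ℕ) :
    ∃ lab : EdgeLabeling (Minor n) (Fin n × Fin n), IsNaturalLabeling lab := by
  have h (x y : Minor n) (h : x ⋖ y) : ∃ l : Fin n × Fin n,
      y.1.1 \ x.1.1 = {l.1} ∧ y.1.2 \ x.1.2 = {l.2} := by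
    obtain ⟨a, b, ha, hb, h1, h2⟩ := covBy_iff.1 h
    exact ⟨(a, b), by rw [h1, Finset.insert_sdiff_cancel ha], by rw [h2, Finset.insert_sdiff_cancel hb]⟩
  choose lab hlab using h
  exact ⟨lab, hlab⟩

/-- The words in which each row and each column of `y` that does not belong to `x` occurs exactly
once. -/
structure IsWord (x y : Minor n) (w : List (Fin n × Fin n)) : Prop where
  nodup_fst : (w.map Prod.fst).Nodup
  nodup_snd : (w.map Prod.snd).Nodup
  toFinset_fst : (w.map Prod.fst).toFinset = y.1.1 \ x.1.1
  toFinset_snd : (w.map Prod.snd).toFinset = y.1.2 \ x.1.2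

variable {lab : EdgeLabeling (Minor n) (Fin n × Fin n)} {x y : Minor n}

/-- An element of a maximal chain is obtained by adding the letters read so far. -/
theorem IsNaturalLabeling.eq_union_take (hlab : IsNaturalLabeling lab) (c : MaxChainBetween x y)
    (i : Fin (c.1.length + 1)) :
    (c.1 i).1.1 = x.1.1 ∪ (((labelWord lab c).map Prod.fst).take i).toFinset ∧
    (c.1 i).1.2 = x.1.2 ∪ (((labelWord lab c).map Prod.snd).take i).toFinset := by
  induction i using Fin.induction with
  | zero =>
    have : c.1 0 = x := c.2.1
    simp [this]
  | succ i ih =>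
    have hi : (i : ℕ) < (labelWord lab c).length := by simp [labelWord]
    have hl := hlab _ _ (c.1.step i)
    have hle : c.1 i.castSucc ≤ c.1 i.succ := (c.1.step i : c.1 i.castSucc ⋖ c.1 i.succ).le
    have hg : (labelWord lab c)[(i : ℕ)] = lab _ _ (c.1.step i) := by simp [labelWord]
    rw [Fin.val_castSucc] at ih
    constructor
    · rw [Fin.val_succ, List.toFinset_take_succ (by simpa using hi), Finset.union_insert, ← ih.1,
        List.getElem_map, hg, Finset.insert_eq, ← hl.1]
      exact (Finset.sdiff_union_of_subset hle.1).symm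
    · rw [Fin.val_succ, List.toFinset_take_succ (by simpa using hi), Finset.union_insert, ← ih.2,
        List.getElem_map, hg, Finset.insert_eq, ← hl.2]
      exact (Finset.sdiff_union_of_subset hle.2).symm

theorem size_eq_size_add_length (c : MaxChainBetween x y) : y.size = x.size + c.1.length := by
  have h : ∀ i : Fin (c.1.length + 1), (c.1 i).size = x.size + i := by
    intro i
    induction i using Fin.induction with
    | zero =>
      have : c.1 0 = x := c.2.1
      simp [this]
    | succ i ih =>
      obtain ⟨a, b, ha, -, h1, -⟩ := covBy_iff.1 (c.1.step i)
      rw [size, h1, Finset.card_insert_of_notMem ha, Fin.val_succ, ← add_assoc]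
      exact congrArg (· + 1) ih
  have hl : c.1 (Fin.last _) = y := c.2.2
  exact (congrArg size hl).symm.trans (h _)

/-- A list which has the length of `T \ S` and fills up `S` to `T` enumerates `T \ S`. -/
theorem nodup_and_toFinset_eq {α : Type*} [DecidableEq α] {S T : Finset α} {l : List α}
    (h : T = S ∪ l.toFinset) (hc : T.card = S.card + l.length) :
    l.Nodup ∧ l.toFinset = T \ S := by
  have hST : S ⊆ T := h ▸ Finset.subset_union_left
  have hsub : T \ S ⊆ l.toFinset := by
    rw [h, Finset.union_sdiff_left]
    exact Finset.sdiff_subset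
  have hle : l.toFinset.card ≤ l.length := l.toFinset_card_le
  have hcard : (T \ S).card = l.length := by
    rw [Finset.card_sdiff_of_subset hST]
    omega
  have he := Finset.eq_of_subset_of_card_le hsub (by omega)
  have hn : (l : Multiset α).toFinset.card = (l : Multiset α).card :=
    (congrArg Finset.card he).symm.trans hcard
  exact ⟨Multiset.toFinset_card_eq_card_iff_nodup.1 hn, he.symm⟩

theorem IsNaturalLabeling.isWord (hlab : IsNaturalLabeling lab) (c : MaxChainBetween x y) :
    IsWord x y (labelWord lab c) := by
  have h := hlab.eq_union_take c (Fin.last _)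
  have hl : c.1 (Fin.last _) = y := c.2.2
  have hlen : (labelWord lab c).length = c.1.length := by simp [labelWord]
  have hs := size_eq_size_add_length c
  rw [hl, Fin.val_last, List.take_of_length_le (by simp [hlen]),
    List.take_of_length_le (by simp [hlen])] at h
  have h1 := nodup_and_toFinset_eq h.1 (by rw [List.length_map, hlen]; exact hs)
  have h2 := nodup_and_toFinset_eq h.2
    (by rw [List.length_map, hlen, card_snd, card_snd]; exact hs)
  exact ⟨h1.1, h2.1, h1.2, h2.2⟩

theorem IsNaturalLabeling.labelWord_injective (hlab : IsNaturalLabeling lab) :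
    Function.Injective (labelWord (x := x) (y := y) lab) := by
  intro c d h
  have hlen : c.1.length = d.1.length := by
    simpa [labelWord] using congrArg List.length h
  refine Subtype.ext (RelSeries.ext hlen (funext fun i => ?_))
  have hc := hlab.eq_union_take c i
  have hd := hlab.eq_union_take d (Fin.cast (by rw [hlen]) i)
  rw [h] at hc
  exact Subtype.ext (Prod.ext (hc.1.trans hd.1.symm) (hc.2.trans hd.2.symm))

theorem IsNaturalLabeling.exists_labelWord_eq (hlab : IsNaturalLabeling lab) (hxy : x ≤ y)
    {w : List (Fin n × Fin n)} (hw : IsWord x y w) :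
    ∃ c : MaxChainBetween x y, labelWord lab c = w := by
  have hcard {S T : Finset (Fin n)} {l : List (Fin n)} (hn : l.Nodup) (hl : l.toFinset = T \ S)
      (i : ℕ) (hi : i ≤ l.length) : (S ∪ (l.take i).toFinset).card = S.card + i := by
    have hd : Disjoint S (l.take i).toFinset := by
      refine Finset.disjoint_of_subset_right (fun a ha => ?_) (Finset.disjoint_sdiff (s := S) (t := T))
      rw [← hl, List.mem_toFinset]
      exact List.mem_of_mem_take (List.mem_toFinset.1 ha)
    rw [Finset.card_union_of_disjoint hd, List.toFinset_card_of_nodup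
      (hn.sublist (List.take_sublist _ _)), List.length_take, min_eq_left hi]
  have hnot {S T : Finset (Fin n)} {l : List (Fin n)} (hn : l.Nodup) (hl : l.toFinset = T \ S)
      (i : ℕ) (hi : i < l.length) : l[i] ∉ S ∪ (l.take i).toFinset := by
    intro h
    have h1 := hcard hn hl (i + 1) hi
    rw [List.toFinset_take_succ hi, Finset.union_insert, Finset.insert_eq_of_mem h,
      hcard hn hl i hi.le] at h1
    omega
  -- the `i`-th element of the chain arises from `x` by adding the first `i` letters
  let f (i : Fin (w.length + 1)) : Minor n :=
    ⟨(x.1.1 ∪ ((w.map Prod.fst).take i).toFinset, x.1.2 ∪ ((w.map Prod.snd).take i).toFinset), by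
      simp only
      rw [hcard hw.nodup_fst hw.toFinset_fst i (by simpa using i.is_le),
        hcard hw.nodup_snd hw.toFinset_snd i (by simpa using i.is_le), x.2]⟩
  have hnot1 (i : Fin w.length) : w[i].1 ∉ (f i.castSucc).1.1 := by
    simpa [f] using hnot hw.nodup_fst hw.toFinset_fst i (by simp)
  have hnot2 (i : Fin w.length) : w[i].2 ∉ (f i.castSucc).1.2 := by
    simpa [f] using hnot hw.nodup_snd hw.toFinset_snd i (by simp)
  have hins1 (i : Fin w.length) : (f i.succ).1.1 = insert w[i].1 (f i.castSucc).1.1 := by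
    simp only [f, Fin.val_succ, Fin.val_castSucc]
    rw [List.toFinset_take_succ (by simp), Finset.union_insert, List.getElem_map]
    rfl
  have hins2 (i : Fin w.length) : (f i.succ).1.2 = insert w[i].2 (f i.castSucc).1.2 := by
    simp only [f, Fin.val_succ, Fin.val_castSucc]
    rw [List.toFinset_take_succ (by simp), Finset.union_insert, List.getElem_map]
    rfl
  have hcov (i : Fin w.length) : f i.castSucc ⋖ f i.succ :=
    covBy_iff.2 ⟨w[i].1, w[i].2, hnot1 i, hnot2 i, hins1 i, hins2 i⟩
  have hhead : f 0 = x := Subtype.ext (Prod.ext (by simp [f]) (by simp [f]))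
  have hlast : f (Fin.last _) = y := by
    refine Subtype.ext (Prod.ext ?_ ?_)
    · simp only [f, Fin.val_last]
      rw [List.take_of_length_le (by simp), hw.toFinset_fst]
      exact Finset.union_sdiff_of_subset hxy.1
    · simp only [f, Fin.val_last]
      rw [List.take_of_length_le (by simp), hw.toFinset_snd]
      exact Finset.union_sdiff_of_subset hxy.2
  refine ⟨⟨⟨w.length, f, hcov⟩, hhead, hlast⟩, ?_⟩
  refine List.ext_getElem (by simp [labelWord]) fun i h1 h2 => ?_
  have hl := hlab _ _ (hcov ⟨i, h2⟩)
  rw [hins1, hins2, Finset.insert_sdiff_cancel (hnot1 _), Finset.insert_sdiff_cancel (hnot2 _)] at hl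
  simp only [labelWord, List.getElem_ofFn]
  exact Prod.ext (Finset.singleton_injective hl.1).symm (Finset.singleton_injective hl.2).symm

/-! ### Rising and falling chains -/

theorem perm_of_isWord {w v : List (Fin n × Fin n)} (hw : IsWord x y w) (hv : IsWord x y v) :
    (v.map Prod.fst).Perm (w.map Prod.fst) ∧ (v.map Prod.snd).Perm (w.map Prod.snd) :=
  ⟨List.perm_of_nodup_nodup_toFinset_eq hv.nodup_fst hw.nodup_fst
    (hv.toFinset_fst.trans hw.toFinset_fst.symm),
  List.perm_of_nodup_nodup_toFinset_eq hv.nodup_snd hw.nodup_snd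
    (hv.toFinset_snd.trans hw.toFinset_snd.symm)⟩

/-- The rising chain of `[x, y]` adds the rows and the columns in increasing order. -/
theorem IsNaturalLabeling.isELLabeling (hlab : IsNaturalLabeling lab) : IsELLabeling lab := by
  intro x y hxy
  set S := (y.1.1 \ x.1.1).sort (· ≤ ·) with hS
  set T := (y.1.2 \ x.1.2).sort (· ≤ ·) with hT
  have hlen : S.length = T.length := by
    rw [hS, hT, Finset.length_sort, Finset.length_sort, Finset.card_sdiff_of_subset hxy.1,
      Finset.card_sdiff_of_subset hxy.2, x.2, y.2]
  have h1 : (S.zip T).map Prod.fst = S := List.map_fst_zip hlen.le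
  have h2 : (S.zip T).map Prod.snd = T := List.map_snd_zip hlen.ge
  have hw : IsWord x y (S.zip T) := by
    constructor
    · rw [h1]; exact Finset.sort_nodup _ _
    · rw [h2]; exact Finset.sort_nodup _ _
    · rw [h1]; exact Finset.sort_toFinset _ _
    · rw [h2]; exact Finset.sort_toFinset _ _
  have hSle : S.Pairwise (· ≤ ·) := Finset.pairwise_sort _ _
  have hTle : T.Pairwise (· ≤ ·) := Finset.pairwise_sort _ _
  obtain ⟨c, hc⟩ := hlab.exists_labelWord_eq hxy hw
  refine ⟨c, ?_, fun c' hne => ?_⟩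
  · rw [IsRisingChain, hc, List.isChain_iff_pairwise]
    rw [← h1, List.pairwise_map] at hSle
    rw [← h2, List.pairwise_map] at hTle
    exact (hSle.and hTle).imp fun h => ⟨h.1, h.2⟩
  · have hp := perm_of_isWord hw (hlab.isWord c')
    have hne' : labelWord lab c' ≠ S.zip T := fun h => hne (hlab.labelWord_injective (h.trans hc.symm))
    refine ⟨fun hr => hne' ?_, ?_⟩
    · rw [IsRisingChain, List.isChain_iff_pairwise] at hr
      rw [h1, h2] at hp
      refine List.zip_of_prod ?_ ?_
      · exact List.Perm.eq_of_pairwise (fun _ _ _ _ => le_antisymm)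
          (List.pairwise_map.2 (hr.imp fun h => h.1)) hSle hp.1
      · exact List.Perm.eq_of_pairwise (fun _ _ _ _ => le_antisymm)
          (List.pairwise_map.2 (hr.imp fun h => h.2)) hTle hp.2
    · rw [hc]
      refine List.lex_of_pairwise_lt ?_ ?_ hp.1 hp.2 hne'
      · exact (h1.symm ▸ hSle).imp₂ (fun _ _ => lt_of_le_of_ne) hw.nodup_fst
      · exact (h2.symm ▸ hTle).imp₂ (fun _ _ => lt_of_le_of_ne) hw.nodup_snd

/-- The label words of the maximal chains of the whole poset are the pairs of permutations. -/
theorem isWord_bot_top_iff {w : List (Fin n × Fin n)} :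
    IsWord ⊥ ⊤ w ↔ ∃ σ τ : Equiv.Perm (Fin n), w = List.ofFn fun i => (σ i, τ i) := by
  have hbot : (⊥ : Minor n).1 = (∅, ∅) := rfl
  have htop : (⊤ : Minor n).1 = (Finset.univ, Finset.univ) := rfl
  constructor
  · intro h
    have hlen : w.length = n := by
      have := List.toFinset_card_of_nodup h.nodup_fst
      rw [h.toFinset_fst, hbot, htop] at this
      simpa using this.symm
    have hs : Function.Injective fun i : Fin n => (w[(i : ℕ)]).1 := fun i j hij => by
      refine Fin.ext ((h.nodup_fst.getElem_inj_iff (hi := by simp [hlen]) (hj := by simp [hlen])).1 ?_)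
      simpa using hij
    have ht : Function.Injective fun i : Fin n => (w[(i : ℕ)]).2 := fun i j hij => by
      refine Fin.ext ((h.nodup_snd.getElem_inj_iff (hi := by simp [hlen]) (hj := by simp [hlen])).1 ?_)
      simpa using hij
    refine ⟨Equiv.ofBijective _ (Finite.injective_iff_bijective.1 hs),
      Equiv.ofBijective _ (Finite.injective_iff_bijective.1 ht), ?_⟩
    exact List.ext_getElem (by simp [hlen]) fun i h1 h2 => by simp
  · rintro ⟨σ, τ, rfl⟩
    have h1 : (List.ofFn fun i => (σ i, τ i)).map Prod.fst = List.ofFn σ := by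
      rw [List.map_ofFn]; rfl
    have h2 : (List.ofFn fun i => (σ i, τ i)).map Prod.snd = List.ofFn τ := by
      rw [List.map_ofFn]; rfl
    constructor
    · rw [h1]; exact List.nodup_ofFn.2 σ.injective
    · rw [h2]; exact List.nodup_ofFn.2 τ.injective
    · rw [h1, hbot, htop]
      ext a
      simpa [List.mem_ofFn] using σ.surjective a
    · rw [h2, hbot, htop]
      ext a
      simpa [List.mem_ofFn] using τ.surjective a

theorem isChain_not_le_ofFn_iff {σ τ : Equiv.Perm (Fin n)} :
    (List.ofFn fun i => (σ i, τ i)).IsChain (fun a b => ¬ a ≤ b) ↔ NoCommonAscent σ τ := by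
  rw [List.isChain_ofFn]
  constructor
  · intro h i j hij hlt
    obtain ⟨j, hj⟩ := j
    obtain rfl : j = i + 1 := hij
    exact h i hj ⟨hlt.1.le, hlt.2.le⟩
  · intro h i hi hle
    have hne : (⟨i, by omega⟩ : Fin n) ≠ ⟨i + 1, hi⟩ := by simp
    exact h ⟨i, by omega⟩ ⟨i + 1, hi⟩ rfl
      ⟨lt_of_le_of_ne hle.1 (σ.injective.ne hne), lt_of_le_of_ne hle.2 (τ.injective.ne hne)⟩

theorem IsNaturalLabeling.bijOn_labelWord (hlab : IsNaturalLabeling lab) :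
    Set.BijOn (labelWord lab) {c : MaxChainBetween (⊥ : Minor n) ⊤ | IsFallingChain lab c}
      {w | ∃ σ τ : Equiv.Perm (Fin n), NoCommonAscent σ τ ∧
        w = List.ofFn fun i => (σ i, τ i)} := by
  refine ⟨fun c hc => ?_, hlab.labelWord_injective.injOn, ?_⟩
  · obtain ⟨σ, τ, h⟩ := isWord_bot_top_iff.1 (hlab.isWord c)
    refine ⟨σ, τ, isChain_not_le_ofFn_iff.1 ?_, h⟩
    rw [← h]
    exact hc
  · rintro w ⟨σ, τ, h, rfl⟩
    obtain ⟨c, hc⟩ := hlab.exists_labelWord_eq bot_le (isWord_bot_top_iff.2 ⟨σ, τ, rfl⟩)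
    refine ⟨c, ?_, hc⟩
    change (labelWord lab c).IsChain _
    rw [hc]
    exact isChain_not_le_ofFn_iff.2 h

end Minor

theorem mainTheorem9 (n : ℕ) (k : Type*) [Field k] :
    -- the poset of minors is the Segre square of the Boolean lattice
    (∃ e : Minor n ≃o RankSegreProduct (Finset (Fin n)) (Finset (Fin n)), ∀ m, (e m).1 = m.1) ∧
    -- it is Cohen–Macaulay over every field, and homotopically
    IsCohenMacaulayPoset k (Minor n) ∧
    IsHomotopicallyCohenMacaulayPoset (Minor n) ∧
    -- its Möbius number
    (-1) ^ n * IncidenceAlgebra.mu ℤ (⊥ : Minor n) ⊤ =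
      (Nat.card {p : Equiv.Perm (Fin n) × Equiv.Perm (Fin n) // NoCommonAscent p.1 p.2} : ℤ) ∧
    -- the number of `(n - 2)`-spheres in the homotopy type of its proper part
    (1 ≤ n → IsHomotopyWedgeOfSpheres (OrderRealization (Set.Ioo (⊥ : Minor n) ⊤)) (n - 1)
      (Nat.card {p : Equiv.Perm (Fin n) × Equiv.Perm (Fin n) // NoCommonAscent p.1 p.2})) ∧
    -- the natural labeling, with labels in the product order, is an EL-labeling, and its falling
    -- chains are labeled bijectively by the pairs of permutations with no common ascent
    (∃ lab : EdgeLabeling (Minor n) (Fin n × Fin n),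
      (∀ x y (h : x ⋖ y), y.1.1 \ x.1.1 = {(lab x y h).1} ∧ y.1.2 \ x.1.2 = {(lab x y h).2}) ∧
      IsELLabeling lab ∧
      Set.BijOn (labelWord lab) {c : MaxChainBetween (⊥ : Minor n) ⊤ | IsFallingChain lab c}
        {w | ∃ σ τ : Equiv.Perm (Fin n), NoCommonAscent σ τ ∧
          w = List.ofFn fun i => (σ i, τ i)}) ∧
    -- the Möbius number through the rank-selected invariants of the Boolean lattice
    (-1) ^ n * IncidenceAlgebra.mu ℤ (⊥ : Minor n) ⊤ =
      ∑ J ∈ (Finset.Ico 1 n).powerset,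
        (rankAlpha (Finset (Fin n)) J : ℤ) * rankBeta (Finset (Fin n)) J := by
  obtain ⟨lab, hlab⟩ := Minor.exists_isNaturalLabeling n
  exact ⟨Minor.exists_orderIso_rankSegreProduct n, Minor.isCohenMacaulayPoset n k,
    Minor.isHomotopicallyCohenMacaulayPoset n, Minor.mu_bot_top n,
    fun _ => Minor.isHomotopyWedgeOfSpheres_properPart n,
    ⟨lab, hlab, hlab.isELLabeling, hlab.bijOn_labelWord⟩,
    (Minor.mu_bot_top n).trans (card_noCommonAscent_eq_sum n)⟩
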